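/- For a smooth compactly supported function $f:\mathbb{C}\to\mathbb{C}$ let $$Bf(z)=-\frac1\pi\,\mathrm{p.v.}\!\int_{\mathbb{C}}\frac{f(w)}{(z-w)^2}\,dm(w)=-\frac1\pi\lim_{\varepsilon\to0^+}\int_{|w-z|>\varepsilon}\frac{f(w)}{(z-w)^2}\,dm(w)$$ be the Beurling--Ahlfors operator, where $m$ is Lebesgue measure on $\mathbb{C}\cong\mathbb{R}^2$. For $1<p<\infty$ let $p^*=\max\{p,q\}$ with $\frac1p+\frac1q=1$, and let $\|\cdot\|_p$ be the norm of $L^p(\mathbb{C},m)$. Then for every $f\in C_0^\infty(\mathbb{C})$ (smooth, compactly supported, complex-valued) and every $1<p\le 2$, the principal values $Bf(z)$ and $B\overline f(z)$ exist for every $z\in\mathbb{C}$, and at least one of the following inequalities holds: $$\|Bf\|_p\le\sqrt2\,(p^*-1)\,\|f\|_p,\qquad \|B\overline f\|_p\le\sqrt2\,(p^*-1)\,\|f\|_p.$$ -/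

import Mathlib

open MeasureTheory Filter Topology
open scoped ContDiff ComplexConjugate

noncomputable section

/-- The truncated Beurling-Ahlfors integral
`-(1/π) ∫_{|w - z| > ε} f(w) / (z - w)² dm(w)`, with `m` Lebesgue measure on `ℂ`. -/
def beurlingTrunc (f : ℂ → ℂ) (ε : ℝ) (z : ℂ) : ℂ :=
  -(1 / (Real.pi : ℂ)) * ∫ w in {w : ℂ | ε < ‖w - z‖}, f w / (z - w) ^ 2

/-- The Beurling-Ahlfors operator
`Bf(z) = -(1/π) p.v. ∫ f(w) / (z - w)² dm(w)`: the limit of the truncated integrals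
as `ε → 0+`. -/
def beurling (f : ℂ → ℂ) (z : ℂ) : ℂ :=
  limUnder (𝓝[>] (0 : ℝ)) (fun ε : ℝ => beurlingTrunc f ε z)

/-- `p* = max {p, q}`, where `1/p + 1/q = 1`, that is `q = p / (p - 1)`. -/
def pStar (p : ℝ) : ℝ := max p (p / (p - 1))

end

/-! The estimate is proved for the pair `(Bf, B conj f)` at once. The vector operator `f ↦ (Bf, B
conj f) / 2` maps `L^p` to `L^p` of the Euclidean space `ℂ²` with norm at most `1 / (p - 1)`. The
comparison of `ℓ^p` with `ℓ^2` for two numbers turns this into `‖Bf‖^p + ‖B conj f‖^p ≤ 2 (√2 / (p -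
1))^p ‖f‖^p`, so the smaller summand satisfies the claimed bound; for `p ≤ 2`, `p* - 1 = 1 / (p -
1)`.

The vector bound is a Bellman function and heat flow argument. Burkholder's function `U(x, y)`
majorises `|y|^p - (|x| / (p - 1))^p` (`rpow_sub_rpow_le_burkholder`) and is concave along segments
on which `y` moves no more than `x` (`burkholder_zigzag`). Its partial concave conjugate `φ(x, z) =
inf_y (U(x, y) - ⟨y, z⟩)` is nonpositive, is at least `-(|x| / (p - 1))^p - (p - 1)(|z| / p)^q`, and
has a concavity gain proportional to `|dx| |dz|` (`bellman_two_point`).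

Let `P_t = e^{tΔ/2}`, and let `G = (g₁, g₂)`. Along the flow, `∫ φ(P_t f, P_t G)` grows at least at
the rate `∫ (|D_e P_t f| |D_e P_t G| + |D_{ie} P_t f| |D_{ie} P_t G|)`, where the orthonormal frame
`e, ie` may vary from point to point. Choosing a frame in which the two derivatives of `P_t f` have
equal length, this rate dominates half the real part of `4 ∫ (∂P_t f ∂P_t g₁ + ∂P_t(conj f) ∂P_t
g₂)` (`holoPairing_le`). Since `B = ∂ ∘ (∂bar)⁻¹` and `Δ = 4 ∂ ∂bar`, the time integral of the
latter is `∫ (Bf g₁ + B(conj f) g₂)`. As `φ ≤ 0` at the end of the flow, half the real part of the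
pairing is at most `-∫ φ(f, G)` (`IsBellman.integral_cauchyTransform_le`); inserting the extremal
`G` of Young's inequality gives the norm bound (`integral_cutoff_mul_rpow_le`).

`φ` is merely concave, so the flow is discretised: finite differences replace derivatives, each step
of length `δ` costs `O(δ^{3/2})`, and a fixed time interval costs `O(δ^{1/2})` in all. The operator
itself is identified with the Cauchy transform of `∂f` by comparing sharp and smooth truncations
(`tendsto_beurlingTrunc`). -/

noncomputable section

/-- Burkholder's weak-type function at level `t`, as a function of the two norms. -/
def burkholderLevel (t a b : ℝ) : ℝ := if a + b ≤ t then b ^ 2 - a ^ 2 else t ^ 2 - 2 * t * a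

/-- Burkholder's function for `1 < p ≤ 2`, as a function of the two norms. -/
def burkholder (p a b : ℝ) : ℝ := (b - a / (p - 1)) * (a + b) ^ (p - 1)

/-! ### Zigzag concavity of Burkholder's function. -/

section Zigzag

variable {H₁ H₂ : Type*} [NormedAddCommGroup H₁] [InnerProductSpace ℝ H₁]
  [NormedAddCommGroup H₂] [InnerProductSpace ℝ H₂]

lemma burkholderLevel_le {t a b : ℝ} (hb : 0 ≤ b) :
    burkholderLevel t a b ≤ t ^ 2 - 2 * t * a := by
  unfold burkholderLevel
  split_ifs with h
  · nlinarith
  · exact le_rfl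

/-- Inside the region `a + b ≤ t` the function is the quadratic `b² - a²`. A jump `(h, k)` with `‖k‖
≤ ‖h‖` may leave the region, but the outer branch then exceeds the quadratic by at most `‖h‖² -
‖k‖²`, which is the defect that averaging can absorb. -/
lemma burkholderLevel_add_le {E₁ E₂ : Type*} [NormedAddCommGroup E₁] [NormedAddCommGroup E₂]
    {t : ℝ} {x h : E₁} {y k : E₂} (hxy : ‖x‖ + ‖y‖ ≤ t)
    (hkh : ‖k‖ ≤ ‖h‖) :
    burkholderLevel t ‖x + h‖ ‖y + k‖ ≤
      ‖y + k‖ ^ 2 - ‖x + h‖ ^ 2 + (‖h‖ ^ 2 - ‖k‖ ^ 2) := by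
  have hk0 := norm_nonneg k
  have hy0 := norm_nonneg y
  have hx0 := norm_nonneg x
  have h1 : ‖x + h‖ ≤ ‖x‖ + ‖h‖ := norm_add_le _ _
  have h2 : ‖k‖ - ‖y‖ ≤ ‖y + k‖ := by
    have := norm_sub_norm_le k (-y); rw [norm_neg, sub_neg_eq_add, add_comm k] at this; exact this
  have hb := norm_nonneg (y + k)
  generalize ‖x + h‖ = a' at *
  generalize ‖y + k‖ = b' at *
  generalize ‖x‖ = X at *
  generalize ‖y‖ = Y at *
  generalize ‖h‖ = H at *
  generalize ‖k‖ = K at *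
  unfold burkholderLevel
  split_ifs with hc
  · nlinarith
  · push Not at hc
    -- After completing the square only this remains. If `a' ≤ t`, leaving the region means `b' > t
    -- - a'`; otherwise `0 ≤ a' - t ≤ H - Y`, and `b' ≥ K - Y` suffices when `Y ≤ K`.
    have key : (t - a') ^ 2 ≤ b' ^ 2 + (H ^ 2 - K ^ 2) := by
      rcases le_total a' t with ha | ha
      · nlinarith
      · have hr : a' - t ≤ H - Y := by linarith
        have hr2 : (t - a') ^ 2 ≤ (H - Y) ^ 2 := by nlinarith
        rcases le_total Y K with hYK | hYK
        · have : (K - Y) ^ 2 ≤ b' ^ 2 := by nlinarith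
          nlinarith [mul_nonneg (sub_nonneg.2 hkh) hy0]
        · nlinarith
    nlinarith

lemma sq_norm_convexComb {H : Type*} [NormedAddCommGroup H] [InnerProductSpace ℝ H]
    (x₁ x₂ : H) {l m : ℝ} (hlm : l + m = 1) :
    l * ‖x₁‖ ^ 2 + m * ‖x₂‖ ^ 2 =
      ‖l • x₁ + m • x₂‖ ^ 2 + l * m * ‖x₁ - x₂‖ ^ 2 := by
  obtain rfl : m = 1 - l := by linarith
  rw [norm_add_sq_real, norm_sub_sq_real, norm_smul, norm_smul, mul_pow, mul_pow,
    real_inner_smul_left, real_inner_smul_right, Real.norm_eq_abs, Real.norm_eq_abs, sq_abs, sq_abs]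
  ring

/-- If the average lies outside the inner region, the concave global majorant `t² - 2ta` is attained
there. If it lies inside, both endpoints are jumps from it and the quadratic bound applies. -/
lemma burkholderLevel_zigzag {t : ℝ} (ht : 0 ≤ t) (x₁ x₂ : H₁) (y₁ y₂ : H₂)
    (h : ‖y₁ - y₂‖ ≤ ‖x₁ - x₂‖) {l m : ℝ} (hl : 0 ≤ l) (hm : 0 ≤ m) (hlm : l + m = 1) :
    l * burkholderLevel t ‖x₁‖ ‖y₁‖ + m * burkholderLevel t ‖x₂‖ ‖y₂‖ ≤
      burkholderLevel t ‖l • x₁ + m • x₂‖ ‖l • y₁ + m • y₂‖ := by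
  by_cases hc : ‖l • x₁ + m • x₂‖ + ‖l • y₁ + m • y₂‖ ≤ t
  · have e1 : x₁ = (l • x₁ + m • x₂) + m • (x₁ - x₂) := by
      obtain rfl : l = 1 - m := by linarith
      module
    have e2 : x₂ = (l • x₁ + m • x₂) + (-l) • (x₁ - x₂) := by
      obtain rfl : l = 1 - m := by linarith
      module
    have e3 : y₁ = (l • y₁ + m • y₂) + m • (y₁ - y₂) := by
      obtain rfl : l = 1 - m := by linarith
      module
    have e4 : y₂ = (l • y₁ + m • y₂) + (-l) • (y₁ - y₂) := by
      obtain rfl : l = 1 - m := by linarith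
      module
    have b1 : burkholderLevel t ‖x₁‖ ‖y₁‖ ≤
        ‖y₁‖ ^ 2 - ‖x₁‖ ^ 2 + m ^ 2 * (‖x₁ - x₂‖ ^ 2 - ‖y₁ - y₂‖ ^ 2) := by
      have := burkholderLevel_add_le (h := m • (x₁ - x₂)) (k := m • (y₁ - y₂)) hc (by
        rw [norm_smul, norm_smul]; gcongr)
      rw [← e1, ← e3, norm_smul, norm_smul, mul_pow, mul_pow, Real.norm_eq_abs, sq_abs] at this
      linarith
    have b2 : burkholderLevel t ‖x₂‖ ‖y₂‖ ≤
        ‖y₂‖ ^ 2 - ‖x₂‖ ^ 2 + l ^ 2 * (‖x₁ - x₂‖ ^ 2 - ‖y₁ - y₂‖ ^ 2) := by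
      have := burkholderLevel_add_le (h := (-l) • (x₁ - x₂)) (k := (-l) • (y₁ - y₂)) hc (by
        rw [norm_smul, norm_smul]; gcongr)
      rw [← e2, ← e4, norm_smul, norm_smul, mul_pow, mul_pow, Real.norm_eq_abs, sq_abs,
        neg_sq] at this
      linarith
    have q1 := sq_norm_convexComb x₁ x₂ hlm
    have q2 := sq_norm_convexComb y₁ y₂ hlm
    have b1' := mul_le_mul_of_nonneg_left b1 hl
    have b2' := mul_le_mul_of_nonneg_left b2 hm
    rw [burkholderLevel.eq_1 t ‖l • x₁ + m • x₂‖, if_pos hc]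
    -- The averaged jump defects equal exactly the variance terms of the two quadratics, so they
    -- cancel.
    have e : l * m ^ 2 + m * l ^ 2 = l * m := by
      obtain rfl : l = 1 - m := by linarith
      ring
    calc _ ≤ _ := add_le_add b1' b2'
      _ = (l * ‖y₁‖ ^ 2 + m * ‖y₂‖ ^ 2) - (l * ‖x₁‖ ^ 2 + m * ‖x₂‖ ^ 2) +
          (l * m ^ 2 + m * l ^ 2) * (‖x₁ - x₂‖ ^ 2 - ‖y₁ - y₂‖ ^ 2) := by ring
      _ = _ := by rw [e, q1, q2]; ring
  · have n1 : ‖l • x₁ + m • x₂‖ ≤ l * ‖x₁‖ + m * ‖x₂‖ := by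
      refine (norm_add_le _ _).trans ?_
      rw [norm_smul, norm_smul, Real.norm_of_nonneg hl, Real.norm_of_nonneg hm]
    have b1 := mul_le_mul_of_nonneg_left
      (burkholderLevel_le (t := t) (a := ‖x₁‖) (norm_nonneg y₁)) hl
    have b2 := mul_le_mul_of_nonneg_left
      (burkholderLevel_le (t := t) (a := ‖x₂‖) (norm_nonneg y₂)) hm
    have n2 := mul_le_mul_of_nonneg_left n1 ht
    rw [burkholderLevel.eq_1 t ‖l • x₁ + m • x₂‖, if_neg hc]
    calc _ ≤ _ := add_le_add b1 b2
      _ = (l + m) * t ^ 2 - 2 * (t * (l * ‖x₁‖ + m * ‖x₂‖)) := by ring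
      _ ≤ _ := by rw [hlm]; linarith

/-- The function for exponent `p` is a positive superposition of the weak-type ones. The weight is
integrable near `0` against the outer branch because `1 < p`, and near infinity against the inner
branch because `p < 2`; this is why `p = 2` is excluded. -/
lemma integral_burkholderLevel {p a b : ℝ} (hp1 : 1 < p) (hp2 : p < 2) (ha : 0 ≤ a)
    (hb : 0 ≤ b) :
    IntegrableOn (fun t : ℝ => t ^ (p - 3) * burkholderLevel t a b) (Set.Ioi 0) ∧
    ∫ t in Set.Ioi (0 : ℝ), t ^ (p - 3) * burkholderLevel t a b =
      2 / (p * (2 - p)) * burkholder p a b := by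
  rcases (add_nonneg ha hb).eq_or_lt with hs | hs
  · obtain rfl : a = 0 := by linarith
    obtain rfl : b = 0 := by linarith
    have : ∀ t ∈ Set.Ioi (0 : ℝ), t ^ (p - 3) * burkholderLevel t 0 0 = 0 := by
      intro t ht
      rw [burkholderLevel, if_pos (by simpa using (Set.mem_Ioi.1 ht).le)]
      simp
    refine ⟨(integrableOn_zero (μ := volume) (ε' := ℝ)).congr_fun
      (fun t ht => (this t ht).symm) measurableSet_Ioi, ?_⟩
    rw [setIntegral_congr_fun measurableSet_Ioi this]
    simp [burkholder]
  set s := a + b with hs'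
  have e1 : ∀ t ∈ Set.Ioo 0 s, t ^ (p - 3) * burkholderLevel t a b =
      t ^ (p - 1) - 2 * a * t ^ (p - 2) := by
    intro t ht
    have h0 : (0 : ℝ) < t := ht.1
    rw [burkholderLevel, if_neg (not_le.2 ht.2)]
    have : t ^ (p - 1) = t ^ (p - 3) * t ^ 2 := by
      rw [← Real.rpow_natCast t 2, ← Real.rpow_add h0]; norm_num; ring_nf
    have h' : t ^ (p - 2) = t ^ (p - 3) * t := by
      nth_rewrite 3 [← Real.rpow_one t]
      rw [← Real.rpow_add h0]; ring_nf
    rw [this, h']; ring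
  have e2 : ∀ t ∈ Set.Ioi s, t ^ (p - 3) * burkholderLevel t a b =
      (b ^ 2 - a ^ 2) * t ^ (p - 3) := by
    intro t ht
    rw [burkholderLevel, if_pos (le_of_lt ht)]; ring
  have i1 : IntervalIntegrable (fun t : ℝ => t ^ (p - 1)) volume 0 s :=
    intervalIntegral.intervalIntegrable_rpow' (by linarith)
  have i2 : IntervalIntegrable (fun t : ℝ => t ^ (p - 2)) volume 0 s :=
    intervalIntegral.intervalIntegrable_rpow' (by linarith)
  have i12 := i1.sub (i2.const_mul (2 * a))
  have I1 : IntegrableOn (fun t : ℝ => t ^ (p - 3) * burkholderLevel t a b) (Set.Ioc 0 s) := by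
    rw [integrableOn_Ioc_iff_integrableOn_Ioo]
    refine IntegrableOn.congr_fun ?_ (fun t ht => (e1 t ht).symm) measurableSet_Ioo
    rw [← integrableOn_Ioc_iff_integrableOn_Ioo]
    exact (intervalIntegrable_iff_integrableOn_Ioc_of_le hs.le).1 i12
  have I2 : IntegrableOn (fun t : ℝ => t ^ (p - 3) * burkholderLevel t a b) (Set.Ioi s) := by
    refine IntegrableOn.congr_fun ?_ (fun t ht => (e2 t ht).symm) measurableSet_Ioi
    exact (integrableOn_Ioi_rpow_of_lt (by linarith) hs).const_mul _
  have hU : Set.Ioi (0 : ℝ) = Set.Ioc 0 s ∪ Set.Ioi s := (Set.Ioc_union_Ioi_eq_Ioi hs.le).symm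
  refine ⟨by rw [hU]; exact I1.union I2, ?_⟩
  rw [hU, setIntegral_union (Set.Ioc_disjoint_Ioi le_rfl) measurableSet_Ioi I1 I2,
    setIntegral_congr_fun measurableSet_Ioi e2, integral_Ioc_eq_integral_Ioo,
    setIntegral_congr_fun measurableSet_Ioo e1, ← integral_Ioc_eq_integral_Ioo,
    ← intervalIntegral.integral_of_le hs.le, intervalIntegral.integral_sub i1 (i2.const_mul _),
    intervalIntegral.integral_const_mul, integral_rpow (Or.inl (by linarith)),
    integral_rpow (Or.inl (by linarith)), integral_const_mul,
    integral_Ioi_rpow_of_lt (by linarith) hs]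
  have z1 : (0 : ℝ) ^ (p - 1 + 1) = 0 := Real.zero_rpow (by linarith)
  have z2 : (0 : ℝ) ^ (p - 2 + 1) = 0 := Real.zero_rpow (by linarith)
  rw [z1, z2, burkholder, ← hs']
  have r1 : s ^ (p - 1 + 1) = s ^ (p - 1) * s := by
    rw [Real.rpow_add hs, Real.rpow_one]
  have r2 : s ^ (p - 2 + 1) = s ^ (p - 1) := by ring_nf
  have r3 : s ^ (p - 1) = s ^ (p - 3 + 1) * s := by
    nth_rewrite 3 [← Real.rpow_one s]
    rw [← Real.rpow_add hs]; ring_nf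
  have hne : s ≠ 0 := hs.ne'
  have r3' : s ^ (p - 3 + 1) = s ^ (p - 1) / s := by rw [r3]; field_simp
  rw [r1, r2, r3']
  have hq : b ^ 2 - a ^ 2 = (b - a) * s := by rw [hs']; ring
  rw [hq]
  have h1 : p - 1 ≠ 0 := by linarith
  have h2 : 2 - p ≠ 0 := by linarith
  have h3 : p - 3 + 1 ≠ 0 := by linarith
  have h4 : p ≠ 0 := by linarith
  have h5 : p - 1 + 1 = p := by ring
  have h6 : p - 2 + 1 = p - 1 := by ring
  have h7 : p - 3 + 1 = -(2 - p) := by ring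
  rw [h5, h6, h7]
  field_simp
  rw [hs']
  ring

/-- Zigzag concavity survives integration against a positive weight. For `p = 2` the function is `b²
- a²` and the variance identity is enough. -/
lemma burkholder_zigzag {p : ℝ} (hp1 : 1 < p) (hp2 : p ≤ 2) (x₁ x₂ : H₁) (y₁ y₂ : H₂)
    (h : ‖y₁ - y₂‖ ≤ ‖x₁ - x₂‖) {l m : ℝ} (hl : 0 ≤ l) (hm : 0 ≤ m) (hlm : l + m = 1) :
    l * burkholder p ‖x₁‖ ‖y₁‖ + m * burkholder p ‖x₂‖ ‖y₂‖ ≤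
      burkholder p ‖l • x₁ + m • x₂‖ ‖l • y₁ + m • y₂‖ := by
  rcases hp2.eq_or_lt with rfl | hp2
  · have e : ∀ a b : ℝ, burkholder 2 a b = b ^ 2 - a ^ 2 := by
      intro a b
      rw [burkholder, show (2 : ℝ) - 1 = 1 by norm_num, Real.rpow_one]; ring
    simp only [e]
    have q1 := sq_norm_convexComb x₁ x₂ hlm
    have q2 := sq_norm_convexComb y₁ y₂ hlm
    have : l * m * ‖y₁ - y₂‖ ^ 2 ≤ l * m * ‖x₁ - x₂‖ ^ 2 := by gcongr
    linarith
  · have hc : 0 < 2 / (p * (2 - p)) := by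
      have : 0 < 2 - p := by linarith
      positivity
    obtain ⟨i1, e1⟩ := integral_burkholderLevel hp1 hp2 (norm_nonneg x₁) (norm_nonneg y₁)
    obtain ⟨i2, e2⟩ := integral_burkholderLevel hp1 hp2 (norm_nonneg x₂) (norm_nonneg y₂)
    obtain ⟨i3, e3⟩ := integral_burkholderLevel hp1 hp2 (norm_nonneg (l • x₁ + m • x₂))
      (norm_nonneg (l • y₁ + m • y₂))
    have := setIntegral_mono_on ((i1.const_mul l).add (i2.const_mul m)) i3 measurableSet_Ioi
      (fun t ht => by
        have ht' : (0 : ℝ) ≤ t := le_of_lt ht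
        have := mul_le_mul_of_nonneg_left
          (burkholderLevel_zigzag ht' x₁ x₂ y₁ y₂ h hl hm hlm) (Real.rpow_nonneg ht' (p - 3))
        simp only [Pi.add_apply]
        linarith)
    simp only [Pi.add_apply] at this
    rw [integral_add (i1.const_mul l) (i2.const_mul m), integral_const_mul, integral_const_mul,
      e1, e2, e3] at this
    refine le_of_mul_le_mul_left ?_ hc
    linarith

end Zigzag

/-! ### The majorisation by Burkholder's function. -/

lemma rpow_sub_one_ge {p : ℝ} (hp1 : 1 < p) (hp2 : p ≤ 2) : p ≤ (p / (p - 1)) ^ (p - 1) := by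
  have hp : 0 < p - 1 := by linarith
  have h := rpow_one_add_le_one_add_mul_self (s := -(1 / p)) (p := p - 1)
    (by rw [neg_le_neg_iff, div_le_one (by linarith)]; linarith) (by linarith) (by linarith)
  have e1 : 1 + (p - 1) * -(1 / p) = p⁻¹ := by field_simp; ring
  have e2 : 1 + -(1 / p) = (p / (p - 1))⁻¹ := by field_simp; ring
  rw [e1, e2, Real.inv_rpow (by positivity)] at h
  exact (inv_le_inv₀ (by positivity) (by linarith)).1 h

/-- The difference `G` of the two sides vanishes at `d = 0` and has its minimum there: its
derivative is `p² - p k`, with `k ≤ p` for `d ≥ 0` by Bernoulli and `k ≥ p` for `d ≤ 0` by concavity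
of the power `p - 1`. -/
lemma burkholder_aux {p d : ℝ} (hp1 : 1 < p) (hp2 : p ≤ 2) (hd1 : -(1 / (p - 1)) ≤ d)
    (hd2 : d ≤ 1) : (1 + (p - 1) * d) ^ p - (1 - d) ^ p ≤ p ^ 2 * d := by
  have hp : 0 < p - 1 := by linarith
  set G : ℝ → ℝ := fun d => p ^ 2 * d - ((1 + (p - 1) * d) ^ p - (1 - d) ^ p) with hG
  set k : ℝ → ℝ := fun d => (p - 1) * (1 + (p - 1) * d) ^ (p - 1) + (1 - d) ^ (p - 1) with hk
  have hder : ∀ x, HasDerivAt G (p ^ 2 - p * k x) x := by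
    intro x
    have a1 : HasDerivAt (fun d : ℝ => 1 + (p - 1) * d) (p - 1) x := by
      simpa using ((hasDerivAt_id x).const_mul (p - 1)).const_add 1
    have a2 : HasDerivAt (fun d : ℝ => 1 - d) (-1) x := by
      simpa using (hasDerivAt_id x).const_sub 1
    have b1 := a1.rpow_const (p := p) (Or.inr hp1.le)
    have b2 := a2.rpow_const (p := p) (Or.inr hp1.le)
    have b3 : HasDerivAt (fun d : ℝ => p ^ 2 * d) (p ^ 2) x := by
      simpa using (hasDerivAt_id x).const_mul (p ^ 2)
    convert! b3.sub (b1.sub b2) using 1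
    simp only [hk]; ring
  have hcont : Continuous G := continuous_iff_continuousAt.2 fun x => (hder x).continuousAt
  have G0 : G 0 = 0 := by simp [hG]
  suffices 0 ≤ G d by simp only [hG] at this; linarith
  rcases le_total 0 d with h0 | h0
  · have : MonotoneOn G (Set.Icc 0 1) := by
      refine monotoneOn_of_deriv_nonneg (convex_Icc 0 1) hcont.continuousOn
        (fun x _ => (hder x).differentiableAt.differentiableWithinAt) ?_
      intro x hx
      rw [interior_Icc] at hx
      rw [(hder x).deriv]
      have c1 := rpow_one_add_le_one_add_mul_self (s := (p - 1) * x) (p := p - 1)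
        (by nlinarith [hx.1]) (by linarith) (by linarith)
      have c2 := rpow_one_add_le_one_add_mul_self (s := -x) (p := p - 1)
        (by linarith [hx.2]) (by linarith) (by linarith)
      rw [← sub_eq_add_neg] at c2
      have c3 : k x ≤ p := by
        simp only [hk]
        have := mul_le_mul_of_nonneg_left c1 hp.le
        have h3 : (p - 1) * ((p - 1) * ((p - 1) * x)) ≤ (p - 1) * x := by
          have := hx.1
          have : (p - 1) * (p - 1) ≤ 1 := by nlinarith
          nlinarith [mul_nonneg hp.le hx.1.le]
        linarith
      nlinarith
    have := this (Set.left_mem_Icc.2 zero_le_one) ⟨h0, hd2⟩ h0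
    rwa [G0] at this
  · have : AntitoneOn G (Set.Icc (-(1 / (p - 1))) 0) := by
      refine antitoneOn_of_deriv_nonpos (convex_Icc _ _) hcont.continuousOn
        (fun x _ => (hder x).differentiableAt.differentiableWithinAt) ?_
      intro x hx
      rw [interior_Icc] at hx
      rw [(hder x).deriv]
      -- With this parameter `1 - x` interpolates between `1` and `p / (p - 1)`; the power `p - 1`
      -- of the second endpoint is at least `p`.
      set θ := -((p - 1) * x) with hθ
      have t0 : 0 ≤ θ := by rw [hθ]; nlinarith [hx.2]
      have t1 : θ ≤ 1 := by
        have := hx.1.le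
        rw [neg_le, le_div_iff₀ hp] at this
        rw [hθ]; linarith
      have e1 : 1 + (p - 1) * x = 1 - θ := by rw [hθ]; ring
      have e2 : 1 - x = (1 - θ) • (1 : ℝ) + θ • (p / (p - 1)) := by
        rw [hθ]; simp only [smul_eq_mul]; field_simp; ring
      have c1 : 1 - θ ≤ (1 - θ) ^ (p - 1) := by
        rcases (sub_nonneg.2 t1).eq_or_lt with h | h
        · rw [← h, Real.zero_rpow hp.ne']
        · exact Real.self_le_rpow_of_le_one h.le (by linarith) (by linarith)
      have c2 := (Real.concaveOn_rpow (p := p - 1) hp.le (by linarith)).2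
        (Set.mem_Ici.2 zero_le_one) (Set.mem_Ici.2 (show 0 ≤ p / (p - 1) by positivity))
        (sub_nonneg.2 t1) t0 (by ring)
      rw [← e2] at c2
      simp only [Real.one_rpow, smul_eq_mul, mul_one] at c2
      have c3 := mul_le_mul_of_nonneg_left (rpow_sub_one_ge hp1 hp2) t0
      have c4 : p ≤ k x := by
        simp only [hk]
        rw [e1]
        have := mul_le_mul_of_nonneg_left c1 hp.le
        nlinarith
      nlinarith
    have := this ⟨hd1, h0⟩ (Set.right_mem_Icc.2 (by rw [neg_nonpos]; positivity)) h0
    rwa [G0] at this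

/-- By homogeneity the inequality depends on one parameter only; the factor `p ^ (2 - p)` is the one
that makes both sides tangent at `b = a / (p - 1)`. -/
lemma rpow_sub_rpow_le_burkholder {p a b : ℝ} (hp1 : 1 < p) (hp2 : p ≤ 2) (ha : 0 ≤ a)
    (hb : 0 ≤ b) :
    b ^ p - (a / (p - 1)) ^ p ≤ p ^ (2 - p) * burkholder p a b := by
  have hp : 0 < p - 1 := by linarith
  have hp0 : 0 < p := by linarith
  rcases (add_nonneg ha hb).eq_or_lt with hs | hs
  · obtain rfl : a = 0 := by linarith
    obtain rfl : b = 0 := by linarith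
    simp [burkholder]
  set c := a / (p - 1) with hc
  have hc0 : 0 ≤ c := by positivity
  have ha' : a = (p - 1) * c := by rw [hc]; field_simp
  set m := (a + b) / p with hm
  have hm0 : 0 < m := by positivity
  have hmp : a + b = p * m := by rw [hm]; field_simp
  -- `m` is the common value of `b` and `c` on the equality line for the given `a + b`, and `d` is
  -- the relative deviation from that line.
  set d := (b - c) / (p * m) with hd
  have eb : b = m * (1 + (p - 1) * d) := by
    rw [hd]; field_simp; linear_combination (hmp - ha')
  have ec : c = m * (1 - d) := by
    rw [hd]; field_simp; linear_combination (hmp - ha')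
  have hd1 : 0 ≤ 1 + (p - 1) * d := by
    rw [eb] at hb; exact nonneg_of_mul_nonneg_right hb hm0
  have hd2 : 0 ≤ 1 - d := by
    rw [ec] at hc0; exact nonneg_of_mul_nonneg_right hc0 hm0
  have key := burkholder_aux (d := d) hp1 hp2 (by
    rw [neg_le, le_div_iff₀ hp]; linarith) (by linarith)
  have e3 : p ^ (2 - p) * burkholder p a b = m ^ p * (p ^ 2 * d) := by
    rw [burkholder, ← hc, hmp, Real.mul_rpow hp0.le hm0.le]
    have : b - c = p * m * d := by rw [hd]; field_simp
    rw [this]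
    have h1 : m ^ p = m ^ (p - 1) * m := by
      nth_rewrite 3 [← Real.rpow_one m]
      rw [← Real.rpow_add hm0]; ring_nf
    have h2 : p ^ (2 - p) * p ^ (p - 1) = p := by
      rw [← Real.rpow_add hp0]; norm_num
    rw [h1]
    calc _ = (p ^ (2 - p) * p ^ (p - 1)) * p * m ^ (p - 1) * m * d := by ring
      _ = _ := by rw [h2]; ring
  rw [e3, ec, eb, Real.mul_rpow hm0.le hd1, Real.mul_rpow hm0.le hd2, ← mul_sub]
  gcongr

/-! ### The Bellman function, by conjugation in the second variable. -/

section Bellman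

variable {H₁ H₂ : Type*} [NormedAddCommGroup H₁] [InnerProductSpace ℝ H₁]
  [NormedAddCommGroup H₂] [InnerProductSpace ℝ H₂]

/-- The concave conjugate of Burkholder's function in its second variable. -/
def bellman (p : ℝ) (x : H₁) (z : H₂) : ℝ :=
  ⨅ y : H₂, (p ^ (2 - p) * burkholder p ‖x‖ ‖y‖ - inner ℝ y z)

/-- Young's inequality for `a` and `b / p`, multiplied by `p` so that `a ^ p` has coefficient one
and matches the majorised power. -/
lemma mul_le_rpow_add_rpow {p a b : ℝ} (hp1 : 1 < p) (ha : 0 ≤ a) (hb : 0 ≤ b) :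
    a * b ≤ a ^ p + (p - 1) * (b / p) ^ (p / (p - 1)) := by
  have hp : 0 < p := by linarith
  have hp' : p - 1 ≠ 0 := by linarith
  have hq : p.HolderConjugate (p / (p - 1)) := Real.HolderConjugate.conjExponent hp1
  have := mul_le_mul_of_nonneg_left
    (Real.young_inequality_of_nonneg ha (div_nonneg hb hp.le) hq) hp.le
  calc a * b = p * (a * (b / p)) := by field_simp
    _ ≤ _ := this
    _ = _ := by field_simp

lemma bellman_aux {E : Type*} [NormedAddCommGroup E] {p : ℝ} (hp1 : 1 < p) (hp2 : p ≤ 2) (x : E)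
    (z y : H₂) :
    -(‖x‖ / (p - 1)) ^ p - (p - 1) * (‖z‖ / p) ^ (p / (p - 1)) ≤
      p ^ (2 - p) * burkholder p ‖x‖ ‖y‖ - inner ℝ y z := by
  have h1 := rpow_sub_rpow_le_burkholder hp1 hp2 (norm_nonneg x) (norm_nonneg y)
  have h2 := mul_le_rpow_add_rpow hp1 (norm_nonneg y) (norm_nonneg z)
  have h3 := real_inner_le_norm y z
  linarith

lemma bellman_bddBelow {E : Type*} [NormedAddCommGroup E] {p : ℝ}
    (hp1 : 1 < p) (hp2 : p ≤ 2) (x : E) (z : H₂) :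
    BddBelow (Set.range fun y : H₂ => p ^ (2 - p) * burkholder p ‖x‖ ‖y‖ - inner ℝ y z) :=
  ⟨_, by rintro _ ⟨y, rfl⟩; exact bellman_aux hp1 hp2 x z y⟩

lemma le_bellman {E : Type*} [NormedAddCommGroup E] {p : ℝ}
    (hp1 : 1 < p) (hp2 : p ≤ 2) (x : E) (z : H₂) :
    -(‖x‖ / (p - 1)) ^ p - (p - 1) * (‖z‖ / p) ^ (p / (p - 1)) ≤ bellman p x z :=
  le_ciInf fun y => bellman_aux hp1 hp2 x z y

lemma bellman_nonpos {E : Type*} [NormedAddCommGroup E] {p : ℝ}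
    (hp1 : 1 < p) (hp2 : p ≤ 2) (x : E) (z : H₂) :
    bellman p x z ≤ 0 := by
  refine (ciInf_le (bellman_bddBelow hp1 hp2 x z) 0).trans ?_
  have hp : 0 < p - 1 := by linarith
  have h0 : 0 ≤ p ^ (2 - p) := by positivity
  have h1 : 0 ≤ ‖x‖ / (p - 1) * (‖x‖ + 0) ^ (p - 1) := by positivity
  rw [inner_zero_left, norm_zero, burkholder]
  nlinarith

/-- Given a competitor `y` for the infimum at the average, `y + m k` and `y - l k` compete at the
endpoints. They average to `y` and differ by `k`, so zigzag concavity applies, while the linear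
terms produce the gain `⟨k, z₁ - z₂⟩`. -/
lemma bellman_zigzag {p : ℝ} (hp1 : 1 < p) (hp2 : p ≤ 2) (x₁ x₂ : H₁) (z₁ z₂ k : H₂)
    (hk : ‖k‖ ≤ ‖x₁ - x₂‖) {l m : ℝ} (hl : 0 ≤ l) (hm : 0 ≤ m) (hlm : l + m = 1) :
    l * bellman p x₁ z₁ + m * bellman p x₂ z₂ + l * m * inner ℝ k (z₁ - z₂) ≤
      bellman p (l • x₁ + m • x₂) (l • z₁ + m • z₂) := by
  refine le_ciInf fun y => ?_
  have b1 := ciInf_le (bellman_bddBelow hp1 hp2 x₁ z₁) (y + m • k)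
  have b2 := ciInf_le (bellman_bddBelow hp1 hp2 x₂ z₂) (y - l • k)
  have ey : l • (y + m • k) + m • (y - l • k) = y := by
    obtain rfl : l = 1 - m := by linarith
    module
  have ek : (y + m • k) - (y - l • k) = k := by
    obtain rfl : l = 1 - m := by linarith
    module
  have hz := burkholder_zigzag hp1 hp2 x₁ x₂ (y + m • k) (y - l • k) (by rwa [ek]) hl hm hlm
  rw [ey] at hz
  have b1' := mul_le_mul_of_nonneg_left b1 hl
  have b2' := mul_le_mul_of_nonneg_left b2 hm
  have hz' := mul_le_mul_of_nonneg_left hz (show 0 ≤ p ^ (2 - p) by positivity)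
  simp only [inner_add_left, inner_sub_left, inner_add_right, inner_sub_right,
    real_inner_smul_left, real_inner_smul_right] at b1' b2' ⊢
  unfold bellman
  obtain rfl : l = 1 - m := by linarith
  linarith

lemma concaveOn_bellman {p : ℝ} (hp1 : 1 < p) (hp2 : p ≤ 2) :
    ConcaveOn ℝ Set.univ (fun v : H₁ × H₂ => bellman p v.1 v.2) := by
  refine ⟨convex_univ, fun v _ w _ l m hl hm hlm => ?_⟩
  have := bellman_zigzag hp1 hp2 v.1 w.1 v.2 w.2 0 (by simp) hl hm hlm
  simpa using this

lemma bellman_two_point {p : ℝ} (hp1 : 1 < p) (hp2 : p ≤ 2) (x₁ x₂ : H₁) (z₁ z₂ : H₂) :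
    (bellman p x₁ z₁ + bellman p x₂ z₂) / 2 + ‖x₁ - x₂‖ * ‖z₁ - z₂‖ / 4 ≤
      bellman p ((1 / 2 : ℝ) • (x₁ + x₂)) ((1 / 2 : ℝ) • (z₁ + z₂)) := by
  -- The best admissible `k` is parallel to `z₁ - z₂` and as long as `x₁ - x₂`. When `z₁ = z₂`,
  -- division by zero gives `k = 0`, which is harmless.
  have := bellman_zigzag hp1 hp2 x₁ x₂ z₁ z₂ ((‖x₁ - x₂‖ / ‖z₁ - z₂‖) • (z₁ - z₂))
    (by
      rw [norm_smul, norm_div, norm_norm, norm_norm]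
      by_cases h : ‖z₁ - z₂‖ = 0
      · simp [h]
      · rw [div_mul_cancel₀ _ h])
    (l := 1 / 2) (m := 1 / 2) (by norm_num) (by norm_num) (by norm_num)
  rw [real_inner_smul_left, real_inner_self_eq_norm_sq] at this
  have e : ‖x₁ - x₂‖ / ‖z₁ - z₂‖ * ‖z₁ - z₂‖ ^ 2 = ‖x₁ - x₂‖ * ‖z₁ - z₂‖ := by
    by_cases h : ‖z₁ - z₂‖ = 0
    · simp [h]
    · field_simp
  rw [e] at this
  rw [smul_add, smul_add]
  linarith

end Bellman

/-! ### Gaussian measures on the plane: moments, symmetries, convolution. -/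

section HeatMeasure

open ProbabilityTheory

/-- The law at time `t` of a standard planar Brownian motion. -/
def heatMeasure (t : ℝ) : Measure ℂ := (stdGaussian ℂ).map (fun ξ => √t • ξ)

instance (t : ℝ) : IsProbabilityMeasure (heatMeasure t) :=
  Measure.isProbabilityMeasure_map (by fun_prop)

lemma integral_heatMeasure {E : Type*} [NormedAddCommGroup E] [NormedSpace ℝ E] {t : ℝ}
    {u : ℂ → E} (hu : Continuous u) :
    ∫ η, u η ∂heatMeasure t = ∫ ξ, u (√t • ξ) ∂stdGaussian ℂ :=
  integral_map (by fun_prop) hu.aestronglyMeasurable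

lemma integrable_norm_pow_stdGaussian (n : ℕ) :
    Integrable (fun ξ : ℂ => ‖ξ‖ ^ n) (stdGaussian ℂ) :=
  (IsGaussian.memLp_id (stdGaussian ℂ) n (by simp)).integrable_norm_pow'

lemma integrable_norm_pow_heatMeasure (t : ℝ) (n : ℕ) :
    Integrable (fun η : ℂ => ‖η‖ ^ n) (heatMeasure t) := by
  refine (integrable_map_measure (by fun_prop) (by fun_prop)).2 ?_
  refine ((integrable_norm_pow_stdGaussian n).const_mul (‖√t‖ ^ n)).congr (ae_of_all _ fun ξ => ?_)
  simp [mul_pow]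

lemma integrable_one_add_norm_pow_heatMeasure (t : ℝ) (n : ℕ) :
    Integrable (fun η : ℂ => (1 + ‖η‖) ^ n) (heatMeasure t) := by
  simp only [add_pow, one_pow, one_mul]
  exact integrable_finsetSum _ fun i _ => (integrable_norm_pow_heatMeasure t _).mul_const _

lemma integral_one_add_norm_pow_heatMeasure_le {t T : ℝ} (htT : t ≤ T) (n : ℕ) :
    ∫ η, (1 + ‖η‖) ^ n ∂heatMeasure t ≤ ∫ η, (1 + ‖η‖) ^ n ∂heatMeasure T := by
  have h : ∀ s : ℝ, Integrable (fun ξ : ℂ => (1 + ‖√s • ξ‖) ^ n) (stdGaussian ℂ) := fun s =>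
    (integrable_map_measure (g := fun η : ℂ => (1 + ‖η‖) ^ n) (f := fun ξ : ℂ => √s • ξ)
      (by fun_prop) (by fun_prop)).1 (integrable_one_add_norm_pow_heatMeasure s n)
  rw [integral_heatMeasure (by fun_prop), integral_heatMeasure (by fun_prop)]
  refine integral_mono (h t) (h T) fun ξ => ?_
  have : √t ≤ √T := Real.sqrt_le_sqrt htT
  simp only [norm_smul, Real.norm_of_nonneg (Real.sqrt_nonneg _)]
  gcongr

lemma heatMeasure_map_isometry (t : ℝ) (f : ℂ ≃ₗᵢ[ℝ] ℂ) :
    (heatMeasure t).map f = heatMeasure t := by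
  have hf : Measurable f := f.continuous.measurable
  rw [heatMeasure, Measure.map_map hf (by fun_prop)]
  have : (f ∘ fun ξ => √t • ξ) = (fun ξ => √t • ξ) ∘ f := by
    ext1 ξ; exact map_smul f _ _
  rw [this, ← Measure.map_map (by fun_prop) hf, stdGaussian_map]

lemma integral_heatMeasure_isometry {E : Type*} [NormedAddCommGroup E] [NormedSpace ℝ E] {t : ℝ}
    (f : ℂ ≃ₗᵢ[ℝ] ℂ) (u : ℂ → E) :
    ∫ η, u (f η) ∂heatMeasure t = ∫ η, u η ∂heatMeasure t := by
  conv_rhs => rw [← heatMeasure_map_isometry t f]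
  exact (integral_map_equiv f.toHomeomorph.toMeasurableEquiv u).symm

lemma heatMeasure_conv {s t : ℝ} (hs : 0 ≤ s) (ht : 0 ≤ t) :
    heatMeasure s ∗ heatMeasure t = heatMeasure (s + t) := by
  refine Measure.ext_of_charFun ?_
  ext x
  rw [charFun_conv]
  simp only [heatMeasure, charFun_map_smul, charFun_stdGaussian, norm_smul]
  rw [← Complex.exp_add]
  simp only [Real.norm_eq_abs, ← Complex.ofReal_pow, sq_abs, Real.sq_sqrt hs, Real.sq_sqrt ht,
    Real.sq_sqrt (add_nonneg hs ht), mul_pow]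
  congr 1
  push_cast
  ring

lemma integral_re_sq_heatMeasure {t : ℝ} (ht : 0 ≤ t) : ∫ η, η.re ^ 2 ∂heatMeasure t = t := by
  rw [integral_heatMeasure (by fun_prop)]
  have h := variance_dual_stdGaussian (E := ℂ) Complex.reCLM
  rw [variance_of_integral_eq_zero (by fun_prop) (integral_strongDual_stdGaussian _),
    Complex.reCLM_norm] at h
  simp only [Complex.reCLM_apply] at h
  simp only [Complex.smul_re, smul_eq_mul, mul_pow, Real.sq_sqrt ht]
  rw [integral_const_mul, h]; norm_num

lemma rotation_I_apply (η : ℂ) :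
    rotation ⟨Complex.I, by simp [Submonoid.unitSphere]⟩ η = Complex.I * η := rfl

lemma integral_im_sq_heatMeasure {t : ℝ} (ht : 0 ≤ t) : ∫ η, η.im ^ 2 ∂heatMeasure t = t := by
  have := integral_heatMeasure_isometry (t := t)
    (rotation ⟨Complex.I, by simp [Submonoid.unitSphere]⟩) (fun η => η.re ^ 2)
  rw [integral_re_sq_heatMeasure ht] at this
  refine Eq.trans ?_ this
  simp [rotation_I_apply]

lemma integral_re_mul_im_heatMeasure (t : ℝ) : ∫ η, η.re * η.im ∂heatMeasure t = 0 := by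
  have := integral_heatMeasure_isometry (t := t) Complex.conjLIE (fun η => η.re * η.im)
  simp only [Complex.conjLIE_apply, Complex.conj_re, Complex.conj_im, mul_neg, integral_neg] at this
  linarith

lemma integral_odd_heatMeasure {E : Type*} [NormedAddCommGroup E] [NormedSpace ℝ E] (t : ℝ)
    (L : ℂ →L[ℝ] E) : ∫ η, L η ∂heatMeasure t = 0 := by
  have := integral_heatMeasure_isometry (t := t) (LinearIsometryEquiv.neg ℝ) (fun η => L η)
  simp only [LinearIsometryEquiv.coe_neg, map_neg, integral_neg] at this
  have h2 : (2 : ℝ) • ∫ η, L η ∂heatMeasure t = 0 := by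
    rw [two_smul]; nth_rewrite 1 [← this]; simp
  exact (smul_eq_zero.1 h2).resolve_left two_ne_zero

end HeatMeasure

/-! ### The heat semigroup on functions with cubic decay. -/

section HeatOperator

variable {V : Type*} [NormedAddCommGroup V] [NormedSpace ℝ V]

/-- The heat semigroup generated by half the Laplacian on the plane. -/
def heat (t : ℝ) (u : ℂ → V) (x : ℂ) : V := ∫ η, u (x + η) ∂heatMeasure t

lemma integrable_heatMeasure_of_bounded {E : Type*} [NormedAddCommGroup E] {u : ℂ → E}
    (hu : Continuous u) {K : ℝ}
    (hK : ∀ x, ‖u x‖ ≤ K) (t : ℝ) : Integrable u (heatMeasure t) :=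
  Integrable.of_bound hu.aestronglyMeasurable K (ae_of_all _ hK)

lemma norm_heat_le {u : ℂ → V} {K : ℝ} (hK : ∀ x, ‖u x‖ ≤ K) (t : ℝ) (x : ℂ) :
    ‖heat t u x‖ ≤ K := by
  refine (norm_integral_le_of_norm_le_const (ae_of_all _ fun η => hK (x + η))).trans ?_
  simp

lemma continuous_heat {u : ℂ → V} (hu : Continuous u) {K : ℝ} (hK : ∀ x, ‖u x‖ ≤ K) (t : ℝ) :
    Continuous (heat t u) :=
  continuous_of_dominated (fun x => (hu.comp (by fun_prop)).aestronglyMeasurable)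
    (fun x => ae_of_all _ fun η => hK _) (integrable_const K)
    (ae_of_all _ fun η => hu.comp (by fun_prop))

lemma heat_heat {u : ℂ → V} (hu : Continuous u) {K : ℝ} (hK : ∀ x, ‖u x‖ ≤ K)
    {s t : ℝ} (hs : 0 ≤ s) (ht : 0 ≤ t) : heat s (heat t u) = heat (s + t) u := by
  ext1 x
  have hc : Continuous fun η => u (x + η) := by fun_prop
  simp only [heat]
  rw [← heatMeasure_conv hs ht, integral_conv]
  · simp only [add_assoc]
  · exact Integrable.of_bound hc.aestronglyMeasurable K (ae_of_all _ fun η => hK _)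

/-- An integrable weight on the plane. -/
def decay (x : ℂ) : ℝ := ((1 + ‖x‖) ^ 3)⁻¹

lemma decay_pos (x : ℂ) : 0 < decay x := by unfold decay; positivity

lemma decay_le_one (x : ℂ) : decay x ≤ 1 := by
  unfold decay
  exact inv_le_one_of_one_le₀ (one_le_pow₀ (by linarith [norm_nonneg x]))

@[fun_prop]
lemma continuous_decay : Continuous decay := by
  unfold decay
  exact Continuous.inv₀ (by fun_prop) (fun x => by positivity)

lemma integrable_decay : Integrable decay := by
  have := integrable_one_add_norm (E := ℂ) (μ := volume) (r := 3)
    (by rw [Complex.finrank_real_complex]; norm_num)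
  refine this.congr (ae_of_all _ fun x => ?_)
  simp only [decay]
  rw [Real.rpow_neg (by positivity)]
  norm_cast

/-- A Peetre-type inequality: translations distort the weight by a polynomial factor, which Gaussian
averaging can afford. -/
lemma decay_add_le (x h : ℂ) : decay (x + h) ≤ (1 + ‖h‖) ^ 3 * decay x := by
  unfold decay
  have h1 : 1 + ‖x‖ ≤ (1 + ‖h‖) * (1 + ‖x + h‖) := by
    have := norm_sub_le (x + h) h
    rw [add_sub_cancel_right] at this
    nlinarith [norm_nonneg h, norm_nonneg (x + h)]
  rw [← div_eq_mul_inv, inv_eq_one_div, div_le_div_iff₀ (by positivity) (by positivity),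
    one_mul, ← mul_pow]
  gcongr

/-- The constant by which the heat semigroup up to time `T` distorts `decay`. -/
def heatConst (T : ℝ) : ℝ := ∫ η, (1 + ‖η‖) ^ 3 ∂heatMeasure T

lemma heatConst_nonneg (T : ℝ) : 0 ≤ heatConst T := integral_nonneg fun η => by positivity

lemma norm_heat_le_decay {u : ℂ → V} {K : ℝ} (hK : ∀ x, ‖u x‖ ≤ K * decay x) {t T : ℝ}
    (htT : t ≤ T) (x : ℂ) : ‖heat t u x‖ ≤ K * heatConst T * decay x := by
  have hK0 : 0 ≤ K := by
    have := (norm_nonneg _).trans (hK 0)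
    exact nonneg_of_mul_nonneg_left this (decay_pos 0)
  have hi := (integrable_one_add_norm_pow_heatMeasure t 3).const_mul (K * decay x)
  refine (norm_integral_le_of_norm_le hi (ae_of_all _ fun η => ?_)).trans ?_
  · refine (hK _).trans ?_
    have := mul_le_mul_of_nonneg_left (decay_add_le x η) hK0
    linarith
  · rw [integral_const_mul]
    have := integral_one_add_norm_pow_heatMeasure_le htT 3
    calc _ ≤ K * decay x * heatConst T :=
          mul_le_mul_of_nonneg_left this (mul_nonneg hK0 (decay_pos x).le)
      _ = _ := by ring

/-- `F` is differentiable with derivative `F'` and first order Taylor remainder, all controlled by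
`K` times `decay`. -/
structure Tame (K : ℝ) (F : ℂ → V) (F' : ℂ → ℂ →L[ℝ] V) : Prop where
  nonneg : 0 ≤ K
  cont : Continuous F
  cont' : Continuous F'
  bound : ∀ x, ‖F x‖ ≤ K * decay x
  bound' : ∀ x, ‖F' x‖ ≤ K * decay x
  taylor : ∀ x h, ‖F (x + h) - F x - F' x h‖ ≤ K * (‖h‖ ^ 2 * (1 + ‖h‖) ^ 3) * decay x

lemma mul_decay_le {K : ℝ} (hK : 0 ≤ K) (x : ℂ) : K * decay x ≤ K :=
  mul_le_of_le_one_right hK (decay_le_one x)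

/-- The constant depends on `T` only, not on `t ≤ T`, so every step of the discretised flow has the
same error bound. -/
lemma Tame.heat [CompleteSpace V] {K : ℝ} {F : ℂ → V} {F' : ℂ → ℂ →L[ℝ] V} (hF : Tame K F F')
    {t T : ℝ} (htT : t ≤ T) : Tame (K * heatConst T) (heat t F) (heat t F') := by
  have b1 : ∀ x, ‖F x‖ ≤ K := fun x => (hF.bound x).trans (mul_decay_le hF.nonneg x)
  have b2 : ∀ x, ‖F' x‖ ≤ K := fun x => (hF.bound' x).trans (mul_decay_le hF.nonneg x)
  have c1 := hF.cont
  have c2 := hF.cont'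
  refine ⟨mul_nonneg hF.nonneg (heatConst_nonneg T), continuous_heat hF.cont b1 t,
    continuous_heat hF.cont' b2 t, norm_heat_le_decay hF.bound htT,
    norm_heat_le_decay hF.bound' htT, fun x h => ?_⟩
  have i1 : ∀ y, Integrable (fun η => F (y + η)) (heatMeasure t) := fun y =>
    integrable_heatMeasure_of_bounded (by fun_prop) (fun _ => b1 _) t
  have i2 : Integrable (fun η => F' (x + η)) (heatMeasure t) :=
    integrable_heatMeasure_of_bounded (by fun_prop) (fun _ => b2 _) t
  have e : _root_.heat t F (x + h) - _root_.heat t F x - _root_.heat t F' x h =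
      _root_.heat t (fun y => F (y + h) - F y - F' y h) x := by
    simp only [_root_.heat]
    rw [ContinuousLinearMap.integral_apply i2, ← integral_sub (i1 _) (i1 _), ← integral_sub]
    · simp only [add_right_comm]
    · exact (i1 _).sub (i1 _)
    · exact i2.apply_continuousLinearMap h
  rw [e]
  refine (norm_heat_le_decay (fun y => hF.taylor y h) htT x).trans (le_of_eq ?_)
  ring

end HeatOperator

/-! ### The concavity gain at a point under one short heat step. -/

section OneStep

open ProbabilityTheory

variable {H₁ H₂ : Type*} [NormedAddCommGroup H₁] [InnerProductSpace ℝ H₁]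
  [NormedAddCommGroup H₂] [InnerProductSpace ℝ H₂]

/-- The properties of the Bellman function that drive the heat flow argument. -/
structure IsBellman (φ : H₁ × H₂ → ℝ) : Prop where
  concave : ConcaveOn ℝ Set.univ φ
  two_point : ∀ v w : H₁ × H₂, (φ v + φ w) / 2 + ‖v.1 - w.1‖ * ‖v.2 - w.2‖ / 4 ≤
    φ ((1 / 2 : ℝ) • (v + w))

lemma IsBellman.continuous [FiniteDimensional ℝ H₁] [FiniteDimensional ℝ H₂] {φ : H₁ × H₂ → ℝ}
    (hφ : IsBellman φ) : Continuous φ :=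
  continuousOn_univ.1 (hφ.concave.continuousOn isOpen_univ)

/-- The two-point inequality is used within each pair and once more between the midpoints. On the
four reflections of `η` in the axes, the pairs see the imaginary direction and the midpoints the
real one. -/
lemma IsBellman.four_point {φ : H₁ × H₂ → ℝ} (hφ : IsBellman φ) (v₁ v₂ v₃ v₄ : H₁ × H₂) :
    (φ v₁ + φ v₂ + φ v₃ + φ v₄) / 4 +
      (‖v₁.1 - v₂.1‖ * ‖v₁.2 - v₂.2‖ / 8 + ‖v₃.1 - v₄.1‖ * ‖v₃.2 - v₄.2‖ / 8 +
        ‖v₁.1 + v₂.1 - v₃.1 - v₄.1‖ * ‖v₁.2 + v₂.2 - v₃.2 - v₄.2‖ / 16) ≤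
      φ ((1 / 4 : ℝ) • (v₁ + v₂ + v₃ + v₄)) := by
  have a := hφ.two_point v₁ v₂
  have b := hφ.two_point v₃ v₄
  have c := hφ.two_point ((1 / 2 : ℝ) • (v₁ + v₂)) ((1 / 2 : ℝ) • (v₃ + v₄))
  have e : (1 / 2 : ℝ) • ((1 / 2 : ℝ) • (v₁ + v₂) + (1 / 2 : ℝ) • (v₃ + v₄)) =
      (1 / 4 : ℝ) • (v₁ + v₂ + v₃ + v₄) := by module
  have e1 : ((1 / 2 : ℝ) • (v₁ + v₂)).1 - ((1 / 2 : ℝ) • (v₃ + v₄)).1 =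
      (1 / 2 : ℝ) • (v₁.1 + v₂.1 - v₃.1 - v₄.1) := by simp; module
  have e2 : ((1 / 2 : ℝ) • (v₁ + v₂)).2 - ((1 / 2 : ℝ) • (v₃ + v₄)).2 =
      (1 / 2 : ℝ) • (v₁.2 + v₂.2 - v₃.2 - v₄.2) := by simp; module
  rw [e, e1, e2, norm_smul, norm_smul, Real.norm_of_nonneg (by norm_num)] at c
  linarith

lemma norm_mul_norm_ge {E₁ E₂ : Type*} [NormedAddCommGroup E₁] [NormedAddCommGroup E₂]
    {P p : E₁} {Q q : E₂} {a b ε ε' : ℝ} (hp : ‖p‖ ≤ a) (hq : ‖q‖ ≤ b) (hP : ‖P - p‖ ≤ ε)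
    (hQ : ‖Q - q‖ ≤ ε') : ‖p‖ * ‖q‖ - (a * ε' + ε * (b + ε')) ≤ ‖P‖ * ‖Q‖ := by
  have h1 : ‖p‖ - ‖P‖ ≤ ε := (norm_sub_norm_le p P).trans (by rwa [norm_sub_rev])
  have h2 : ‖q‖ - ‖Q‖ ≤ ε' := (norm_sub_norm_le q Q).trans (by rwa [norm_sub_rev])
  have h3 : ‖Q‖ ≤ b + ε' := by
    have := norm_sub_norm_le Q q
    linarith
  have e : ‖p‖ * ‖q‖ - ‖P‖ * ‖Q‖ = ‖p‖ * (‖q‖ - ‖Q‖) + (‖p‖ - ‖P‖) * ‖Q‖ := by ring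
  have h4 : ‖p‖ * (‖q‖ - ‖Q‖) ≤ a * ε' := by
    have : 0 ≤ ε' := (norm_nonneg _).trans hQ
    nlinarith [norm_nonneg p]
  have h5 : (‖p‖ - ‖P‖) * ‖Q‖ ≤ ε * (b + ε') := by
    have : 0 ≤ ε := (norm_nonneg _).trans hP
    nlinarith [norm_nonneg Q]
  linarith

/-- A Gaussian moment. -/
def momentConst : ℝ := ∫ ξ : ℂ, ‖ξ‖ ^ 3 * (1 + ‖ξ‖) ^ 7 ∂stdGaussian ℂ

lemma integrable_moment (t : ℝ) :
    Integrable (fun η : ℂ => ‖η‖ ^ 3 * (1 + ‖η‖) ^ 7) (heatMeasure t) := by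
  refine (integrable_one_add_norm_pow_heatMeasure t 10).mono' (by fun_prop)
    (ae_of_all _ fun η => ?_)
  rw [Real.norm_of_nonneg (by positivity), show 10 = 3 + 7 by norm_num, pow_add]
  gcongr
  linarith [norm_nonneg η]

lemma integral_moment_le {δ : ℝ} (hδ1 : δ ≤ 1) :
    ∫ η, ‖η‖ ^ 3 * (1 + ‖η‖) ^ 7 ∂heatMeasure δ ≤ √δ ^ 3 * momentConst := by
  have hi : ∀ t : ℝ, Integrable (fun ξ : ℂ => ‖√t • ξ‖ ^ 3 * (1 + ‖√t • ξ‖) ^ 7)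
      (stdGaussian ℂ) := fun t =>
    (integrable_map_measure (g := fun η : ℂ => ‖η‖ ^ 3 * (1 + ‖η‖) ^ 7)
      (f := fun ξ : ℂ => √t • ξ) (by fun_prop) (by fun_prop)).1 (integrable_moment t)
  have h1 := hi 1
  simp only [Real.sqrt_one, one_smul] at h1
  rw [integral_heatMeasure (by fun_prop), momentConst, ← integral_const_mul]
  refine integral_mono (hi δ) (h1.const_mul _) fun ξ => ?_
  have hs : √δ ≤ 1 := Real.sqrt_le_one.2 hδ1
  simp only [norm_smul, Real.norm_of_nonneg (Real.sqrt_nonneg _), mul_pow, mul_assoc]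
  gcongr
  exact mul_le_of_le_one_left (norm_nonneg _) hs

lemma momentConst_nonneg : 0 ≤ momentConst := integral_nonneg fun _ => by positivity

lemma IsBellman.integrable_comp [FiniteDimensional ℝ H₁] [FiniteDimensional ℝ H₂]
    {φ : H₁ × H₂ → ℝ} (hφ : IsBellman φ) {A : ℂ → H₁} {B : ℂ → H₂}
    (hA : Continuous A) (hB : Continuous B) {K : ℝ} (hAK : ∀ η, ‖A η‖ ≤ K) (hBK : ∀ η, ‖B η‖ ≤ K)
    (t : ℝ) : Integrable (fun η => φ (A η, B η)) (heatMeasure t) := by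
  obtain ⟨C, hC⟩ := (isCompact_closedBall (0 : H₁ × H₂) K).exists_bound_of_continuousOn
    hφ.continuous.continuousOn
  refine integrable_heatMeasure_of_bounded (hφ.continuous.comp (by fun_prop)) (K := C)
      (fun η => ?_) t
  refine hC _ ?_
  rw [mem_closedBall_zero_iff, Prod.norm_def]
  exact max_le (hAK η) (hBK η)

lemma integral_conj_heatMeasure {E : Type*} [NormedAddCommGroup E] [NormedSpace ℝ E] (t : ℝ)
    (u : ℂ → E) : ∫ η, u (conj η) ∂heatMeasure t = ∫ η, u η ∂heatMeasure t :=
  integral_heatMeasure_isometry Complex.conjLIE u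

lemma integral_neg_heatMeasure {E : Type*} [NormedAddCommGroup E] [NormedSpace ℝ E] (t : ℝ)
    (u : ℂ → E) : ∫ η, u (-η) ∂heatMeasure t = ∫ η, u η ∂heatMeasure t :=
  integral_heatMeasure_isometry (LinearIsometryEquiv.neg ℝ) u

lemma norm_four_point_sub_le {E : Type*} [NormedAddCommGroup E] [NormedSpace ℝ E] {A : ℂ → E}
    {a₀ : E} {L : ℂ →L[ℝ] E} {ρ : ℝ} {η : ℂ}
    (h : ∀ ζ : ℂ, ‖ζ‖ = ‖η‖ → ‖A ζ - a₀ - L ζ‖ ≤ ρ) :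
    ‖A η - A (conj η) - (2 * η.im) • L Complex.I‖ ≤ 2 * ρ ∧
    ‖A (-conj η) - A (-η) - (2 * η.im) • L Complex.I‖ ≤ 2 * ρ ∧
    ‖A η + A (conj η) - A (-conj η) - A (-η) - (4 * η.re) • L 1‖ ≤ 4 * ρ := by
  have h1 := h η rfl
  have h2 := h (conj η) (by simp)
  have h3 := h (-conj η) (by simp)
  have h4 := h (-η) (by simp)
  have eη : L η = η.re • L 1 + η.im • L Complex.I := by
    rw [← map_smul, ← map_smul, ← map_add]
    congr 1
    apply Complex.ext <;> simp
  have eη' : L (conj η) = η.re • L 1 - η.im • L Complex.I := by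
    rw [← map_smul, ← map_smul, ← map_sub]
    congr 1
    apply Complex.ext <;> simp
  rw [map_neg] at h3 h4
  rw [eη] at h1 h4
  rw [eη'] at h2 h3
  refine ⟨?_, ?_, ?_⟩
  · refine le_trans (le_of_eq ?_) ((norm_sub_le_of_le h1 h2).trans (by linarith))
    congr 1; module
  · refine le_trans (le_of_eq ?_) ((norm_sub_le_of_le h3 h4).trans (by linarith))
    congr 1; module
  · refine le_trans (le_of_eq ?_) ((norm_sub_le_of_le (norm_add_le_of_le h1 h2)
      (norm_add_le_of_le h3 h4)).trans (by linarith))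
    congr 1; module

/-- In the differences over the four reflections the constant terms cancel, and the linear parts
give the squared coordinates of `η`. The decay factor `d` is kept on the `A` side alone: one factor
already makes the error integrable over the plane. -/
lemma IsBellman.pointwise_gain {φ : H₁ × H₂ → ℝ} (hφ : IsBellman φ) {A : ℂ → H₁} {B : ℂ → H₂}
    {a₀ : H₁} {b₀ : H₂} {L : ℂ →L[ℝ] H₁} {M : ℂ →L[ℝ] H₂} {K d : ℝ} (hK : 0 ≤ K) (hd0 : 0 ≤ d)
    (hL : ‖L‖ ≤ K * d) (hM : ‖M‖ ≤ K)
    (hAL : ∀ η, ‖A η - a₀ - L η‖ ≤ K * d * (‖η‖ ^ 2 * (1 + ‖η‖) ^ 3))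
    (hBM : ∀ η, ‖B η - b₀ - M η‖ ≤ K * (‖η‖ ^ 2 * (1 + ‖η‖) ^ 3)) (η : ℂ) :
    (φ (A η, B η) + φ (A (conj η), B (conj η)) + φ (A (-conj η), B (-conj η)) +
        φ (A (-η), B (-η))) / 4 +
      (η.re ^ 2 * (‖L 1‖ * ‖M 1‖) + η.im ^ 2 * (‖L Complex.I‖ * ‖M Complex.I‖) -
        6 * K ^ 2 * d * (‖η‖ ^ 3 * (1 + ‖η‖) ^ 7)) ≤
      φ ((1 / 4 : ℝ) • ((A η, B η) + (A (conj η), B (conj η)) + (A (-conj η), B (-conj η)) +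
        (A (-η), B (-η)))) := by
  refine le_trans (add_le_add_right ?_ _) (hφ.four_point _ _ _ _)
  set r := ‖η‖ with hr
  have hr0 : 0 ≤ r := norm_nonneg η
  set σ := r ^ 2 * (1 + r) ^ 3 with hσ
  have hσ0 : 0 ≤ σ := by positivity
  obtain ⟨a1, a2, a3⟩ := norm_four_point_sub_le (A := A) (a₀ := a₀) (L := L) (ρ := K * d * σ)
    (η := η) (fun ζ hζ => by have := hAL ζ; rwa [hζ] at this)
  obtain ⟨b1, b2, b3⟩ := norm_four_point_sub_le (A := B) (a₀ := b₀) (L := M) (ρ := K * σ)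
    (η := η) (fun ζ hζ => by have := hBM ζ; rwa [hζ] at this)
  have hre : |η.re| ≤ r := Complex.abs_re_le_norm η
  have him : |η.im| ≤ r := Complex.abs_im_le_norm η
  have l1 : ∀ z : ℂ, ‖z‖ = 1 → ‖L z‖ ≤ K * d := fun z hz => by
    have := L.le_opNorm z
    rw [hz, mul_one] at this
    exact this.trans hL
  have m1 : ∀ z : ℂ, ‖z‖ = 1 → ‖M z‖ ≤ K := fun z hz => by
    have := M.le_opNorm z
    rw [hz, mul_one] at this
    exact this.trans hM
  have n2 : ∀ s : ℝ, ‖2 * s‖ = 2 * |s| := fun s => by simp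
  have n4 : ∀ s : ℝ, ‖4 * s‖ = 4 * |s| := fun s => by simp
  have hKd : 0 ≤ K * d := by positivity
  have p1 : ‖(2 * η.im) • L Complex.I‖ ≤ 2 * r * (K * d) := by
    rw [norm_smul, n2]
    exact mul_le_mul (by linarith) (l1 _ (by simp)) (norm_nonneg _) (by positivity)
  have q1 : ‖(2 * η.im) • M Complex.I‖ ≤ 2 * r * K := by
    rw [norm_smul, n2]
    exact mul_le_mul (by linarith) (m1 _ (by simp)) (norm_nonneg _) (by positivity)
  have p3 : ‖(4 * η.re) • L 1‖ ≤ 4 * r * (K * d) := by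
    rw [norm_smul, n4]
    exact mul_le_mul (by linarith) (l1 _ (by simp)) (norm_nonneg _) (by positivity)
  have q3 : ‖(4 * η.re) • M 1‖ ≤ 4 * r * K := by
    rw [norm_smul, n4]
    exact mul_le_mul (by linarith) (m1 _ (by simp)) (norm_nonneg _) (by positivity)
  have g1 := norm_mul_norm_ge p1 q1 a1 b1
  have g2 := norm_mul_norm_ge p1 q1 a2 b2
  have g3 := norm_mul_norm_ge p3 q3 a3 b3
  have eI : ‖(2 * η.im) • L Complex.I‖ * ‖(2 * η.im) • M Complex.I‖ =
      4 * (η.im ^ 2 * (‖L Complex.I‖ * ‖M Complex.I‖)) := by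
    rw [norm_smul, norm_smul, n2, ← sq_abs η.im]; ring
  have e1 : ‖(4 * η.re) • L 1‖ * ‖(4 * η.re) • M 1‖ =
      16 * (η.re ^ 2 * (‖L 1‖ * ‖M 1‖)) := by
    rw [norm_smul, norm_smul, n4, ← sq_abs η.re]; ring
  rw [eI] at g1 g2
  rw [e1] at g3
  -- The three product errors add up to `2 K² d (2 r σ + σ²)`. Both terms are at least cubic in `r`
  -- near `0`, whence the moment of order three and the error `√δ ^ 3`.
  have key : 2 * r * σ + σ ^ 2 ≤ 3 * (r ^ 3 * (1 + r) ^ 7) := by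
    have k1 : r * σ ≤ r ^ 3 * (1 + r) ^ 7 := by
      rw [hσ]
      have : (1 + r) ^ 3 ≤ (1 + r) ^ 7 := pow_le_pow_right₀ (by linarith) (by norm_num)
      nlinarith [pow_nonneg hr0 3]
    have k2 : σ ^ 2 ≤ r ^ 3 * (1 + r) ^ 7 := by
      have : σ ^ 2 = r ^ 3 * (r * (1 + r) ^ 6) := by rw [hσ]; ring
      rw [this, show (1 + r) ^ 7 = (1 + r) * (1 + r) ^ 6 by ring]
      gcongr
      linarith
    linarith
  have key' := mul_le_mul_of_nonneg_left key (show 0 ≤ 2 * K ^ 2 * d by positivity)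
  linarith

lemma integral_add_four {α E : Type*} [MeasurableSpace α] {μ : Measure α} [NormedAddCommGroup E]
    [NormedSpace ℝ E] {u₁ u₂ u₃ u₄ : α → E} (h₁ : Integrable u₁ μ) (h₂ : Integrable u₂ μ)
    (h₃ : Integrable u₃ μ) (h₄ : Integrable u₄ μ) :
    Integrable (fun a => u₁ a + u₂ a + u₃ a + u₄ a) μ ∧
    ∫ a, (u₁ a + u₂ a + u₃ a + u₄ a) ∂μ =
      ∫ a, u₁ a ∂μ + ∫ a, u₂ a ∂μ + ∫ a, u₃ a ∂μ + ∫ a, u₄ a ∂μ := by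
  refine ⟨((h₁.add h₂).add h₃).add h₄, ?_⟩
  rw [integral_add (f := fun a => u₁ a + u₂ a + u₃ a) ((h₁.add h₂).add h₃) h₄,
    integral_add (f := fun a => u₁ a + u₂ a) (h₁.add h₂) h₃, integral_add h₁ h₂]

lemma norm_average_four_le {E : Type*} [NormedAddCommGroup E] [NormedSpace ℝ E] {u : ℂ → E} {K : ℝ}
    (hu : ∀ η, ‖u η‖ ≤ K) (η : ℂ) :
    ‖(1 / 4 : ℝ) • (u η + u (conj η) + u (-conj η) + u (-η))‖ ≤ K := by
  rw [norm_smul, Real.norm_of_nonneg (by norm_num)]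
  have := norm_add_le_of_le (norm_add_le_of_le (norm_add_le_of_le (hu η) (hu (conj η)))
    (hu (-conj η))) (hu (-η))
  linarith

/-- Symmetrising over the reflections leaves the Gaussian means unchanged. Jensen's inequality for
the symmetrised variable then retains the integrated four-point gain, and both coordinates of `η`
have variance `δ`. -/
lemma IsBellman.local_gain [FiniteDimensional ℝ H₁] [FiniteDimensional ℝ H₂]
    {φ : H₁ × H₂ → ℝ} (hφ : IsBellman φ) {A : ℂ → H₁} {B : ℂ → H₂}
    (hA : Continuous A) (hB : Continuous B) {a₀ : H₁} {b₀ : H₂} {L : ℂ →L[ℝ] H₁}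
    {M : ℂ →L[ℝ] H₂} {K d : ℝ} (hd0 : 0 ≤ d) (hAK : ∀ η, ‖A η‖ ≤ K)
    (hBK : ∀ η, ‖B η‖ ≤ K) (hL : ‖L‖ ≤ K * d) (hM : ‖M‖ ≤ K)
    (hAL : ∀ η, ‖A η - a₀ - L η‖ ≤ K * d * (‖η‖ ^ 2 * (1 + ‖η‖) ^ 3))
    (hBM : ∀ η, ‖B η - b₀ - M η‖ ≤ K * (‖η‖ ^ 2 * (1 + ‖η‖) ^ 3))
    {δ : ℝ} (hδ0 : 0 ≤ δ) (hδ1 : δ ≤ 1) :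
    ∫ η, φ (A η, B η) ∂heatMeasure δ +
      δ * (‖L 1‖ * ‖M 1‖ + ‖L Complex.I‖ * ‖M Complex.I‖) -
      6 * K ^ 2 * momentConst * √δ ^ 3 * d ≤
      φ (∫ η, A η ∂heatMeasure δ, ∫ η, B η ∂heatMeasure δ) := by
  have hK : 0 ≤ K := (norm_nonneg _).trans (hAK 0)
  have cj : Continuous fun η : ℂ => conj η := Complex.continuous_conj
  set γ := heatMeasure δ with hγ
  set V : ℂ → H₁ × H₂ := fun η => (A η, B η) with hV
  have iA : ∀ {f : ℂ → ℂ}, Continuous f → Integrable (fun η => A (f η)) γ := fun hf =>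
    integrable_heatMeasure_of_bounded (by fun_prop) (fun _ => hAK _) δ
  have iB : ∀ {f : ℂ → ℂ}, Continuous f → Integrable (fun η => B (f η)) γ := fun hf =>
    integrable_heatMeasure_of_bounded (by fun_prop) (fun _ => hBK _) δ
  have iV : ∀ {f : ℂ → ℂ}, Continuous f → Integrable (fun η => V (f η)) γ := fun hf =>
    (iA hf).prodMk (iB hf)
  have iφ : ∀ {f : ℂ → ℂ}, Continuous f → Integrable (fun η => φ (V (f η))) γ := fun {f} hf =>
    hφ.integrable_comp (A := fun η => A (f η)) (B := fun η => B (f η)) (by fun_prop) (by fun_prop)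
      (fun _ => hAK _) (fun _ => hBK _) δ
  set Z : ℂ → H₁ × H₂ := fun η =>
    (1 / 4 : ℝ) • (V η + V (conj η) + V (-conj η) + V (-η)) with hZ
  have j1 := iV continuous_id
  have j2 := iV cj
  have j3 : Integrable (fun η => V (-conj η)) γ := iV cj.neg
  have j4 := iV continuous_neg
  have f1 := iφ continuous_id
  have f2 := iφ cj
  have f3 : Integrable (fun η => φ (V (-conj η))) γ := iφ cj.neg
  have f4 := iφ continuous_neg
  simp only [id] at j1 f1
  have iZ : Integrable Z γ := (integral_add_four j1 j2 j3 j4).1.smul (1 / 4 : ℝ)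
  have eZ : ∫ η, Z η ∂γ = (∫ η, A η ∂γ, ∫ η, B η ∂γ) := by
    have e0 : ∫ η, V η ∂γ = (∫ η, A η ∂γ, ∫ η, B η ∂γ) :=
      integral_pair (iA continuous_id) (iB continuous_id)
    have e2 : ∫ η, V (conj η) ∂γ = ∫ η, V η ∂γ := integral_conj_heatMeasure δ V
    have e3 : ∫ η, V (-conj η) ∂γ = ∫ η, V η ∂γ :=
      (integral_conj_heatMeasure δ (fun η => V (-η))).trans (integral_neg_heatMeasure δ V)
    have e4 : ∫ η, V (-η) ∂γ = ∫ η, V η ∂γ := integral_neg_heatMeasure δ V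
    rw [hZ, integral_smul, (integral_add_four j1 j2 j3 j4).2, e2, e3, e4, ← e0]
    module
  have eφ : ∫ η, (φ (V η) + φ (V (conj η)) + φ (V (-conj η)) + φ (V (-η))) / 4 ∂γ =
      ∫ η, φ (V η) ∂γ := by
    have e2 : ∫ η, φ (V (conj η)) ∂γ = ∫ η, φ (V η) ∂γ :=
      integral_conj_heatMeasure δ (fun η => φ (V η))
    have e3 : ∫ η, φ (V (-conj η)) ∂γ = ∫ η, φ (V η) ∂γ :=
      (integral_conj_heatMeasure δ (fun η => φ (V (-η)))).trans
        (integral_neg_heatMeasure δ (fun η => φ (V η)))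
    have e4 : ∫ η, φ (V (-η)) ∂γ = ∫ η, φ (V η) ∂γ :=
      integral_neg_heatMeasure δ (fun η => φ (V η))
    rw [integral_div, (integral_add_four f1 f2 f3 f4).2, e2, e3, e4]
    ring
  have iφZ : Integrable (φ ∘ Z) γ := by
    exact hφ.integrable_comp
      (A := fun η => (1 / 4 : ℝ) • (A η + A (conj η) + A (-conj η) + A (-η)))
      (B := fun η => (1 / 4 : ℝ) • (B η + B (conj η) + B (-conj η) + B (-η)))
      (by fun_prop) (by fun_prop) (norm_average_four_le hAK) (norm_average_four_le hBK) δ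
  have hJ := hφ.concave.le_map_integral hφ.continuous.continuousOn isClosed_univ
    (ae_of_all _ fun _ => Set.mem_univ _) iZ iφZ
  rw [eZ] at hJ
  refine le_trans ?_ hJ
  have ire : Integrable (fun η : ℂ => η.re ^ 2) γ :=
    (integrable_norm_pow_heatMeasure δ 2).mono' (by fun_prop) (ae_of_all _ fun η => by
      rw [norm_pow, Real.norm_eq_abs]
      exact pow_le_pow_left₀ (abs_nonneg _) (Complex.abs_re_le_norm η) 2)
  have iim : Integrable (fun η : ℂ => η.im ^ 2) γ :=
    (integrable_norm_pow_heatMeasure δ 2).mono' (by fun_prop) (ae_of_all _ fun η => by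
      rw [norm_pow, Real.norm_eq_abs]
      exact pow_le_pow_left₀ (abs_nonneg _) (Complex.abs_im_le_norm η) 2)
  have i12 : Integrable (fun η : ℂ => η.re ^ 2 * (‖L 1‖ * ‖M 1‖) +
      η.im ^ 2 * (‖L Complex.I‖ * ‖M Complex.I‖)) γ := (ire.mul_const _).add (iim.mul_const _)
  have i1 := ire.mul_const (‖L 1‖ * ‖M 1‖)
  have i2 := iim.mul_const (‖L Complex.I‖ * ‖M Complex.I‖)
  have i3 := (integrable_moment δ).const_mul (6 * K ^ 2 * d)
  have i0 := (integral_add_four f1 f2 f3 f4).1.div_const 4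
  have := integral_mono (i0.add (i12.sub i3)) iφZ
    (fun η => hφ.pointwise_gain hK hd0 hL hM hAL hBM η)
  refine le_trans ?_ this
  have hsum : ∫ η, (η.re ^ 2 * (‖L 1‖ * ‖M 1‖) + η.im ^ 2 * (‖L Complex.I‖ * ‖M Complex.I‖) -
      6 * K ^ 2 * d * (‖η‖ ^ 3 * (1 + ‖η‖) ^ 7)) ∂γ =
      δ * (‖L 1‖ * ‖M 1‖) + δ * (‖L Complex.I‖ * ‖M Complex.I‖) -
      6 * K ^ 2 * d * ∫ η, (‖η‖ ^ 3 * (1 + ‖η‖) ^ 7) ∂γ := by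
    rw [integral_sub i12 i3, integral_add i1 i2, integral_mul_const, integral_mul_const,
      integral_const_mul, integral_re_sq_heatMeasure hδ0, integral_im_sq_heatMeasure hδ0]
  have hadd := integral_add i0 (i12.sub i3)
  simp only [Pi.add_apply, Pi.sub_apply] at hadd ⊢
  rw [hadd, hsum, eφ]
  have hm := mul_le_mul_of_nonneg_left (integral_moment_le hδ1)
    (show 0 ≤ 6 * K ^ 2 * d by positivity)
  linarith

end OneStep

/-! ### Preservation of the integral by the heat semigroup. -/

section HeatIntegral

open ProbabilityTheory

variable {V : Type*} [NormedAddCommGroup V] [NormedSpace ℝ V]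

lemma integrable_shift_prod {E : Type*} [NormedAddCommGroup E] {t : ℝ} {u : ℂ → E}
    (hu : Continuous u) (hi : Integrable u) :
    Integrable (fun z : ℂ × ℂ => u (z.1 + z.2)) (volume.prod (heatMeasure t)) := by
  refine (integrable_prod_iff' (hu.comp (by fun_prop)).aestronglyMeasurable).2
    ⟨ae_of_all _ fun η => hi.comp_add_right η, ?_⟩
  have : (fun η : ℂ => ∫ x, ‖u (x + η)‖) = fun _ => ∫ x, ‖u x‖ := by
    ext1 η
    exact integral_add_right_eq_self (fun x => ‖u x‖) η
  exact (integrable_const (∫ x, ‖u x‖)).congr (ae_of_all _ fun η => (congrFun this η).symm)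

lemma integrable_heat {t : ℝ} {u : ℂ → V} (hu : Continuous u) (hi : Integrable u) :
    Integrable (heat t u) := (integrable_shift_prod hu hi).integral_prod_left

lemma integral_heat [CompleteSpace V] {t : ℝ} {u : ℂ → V} (hu : Continuous u) (hi : Integrable u) :
    ∫ x, heat t u x = ∫ x, u x := by
  simp only [heat]
  rw [integral_integral_swap (integrable_shift_prod hu hi)]
  have : (fun η : ℂ => ∫ x, u (x + η)) = fun _ => ∫ x, u x := by
    ext1 η
    exact integral_add_right_eq_self u η
  rw [this]
  simp

end HeatIntegral

/-! ### Monotonicity of the Bellman integral along the discretised flow. -/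

section Step

variable {H₁ H₂ : Type*} [NormedAddCommGroup H₁] [InnerProductSpace ℝ H₁] [FiniteDimensional ℝ H₁]
  [NormedAddCommGroup H₂] [InnerProductSpace ℝ H₂] [FiniteDimensional ℝ H₂]

/-- At least linear decay at the origin. -/
def LinearDecay (φ : H₁ × H₂ → ℝ) : Prop :=
  ∀ K, 0 ≤ K → ∃ C, ∀ v : H₁ × H₂, ∀ d : ℝ, 0 ≤ d → d ≤ 1 → ‖v.1‖ ≤ K * d → ‖v.2‖ ≤ K * d →
    |φ v| ≤ C * d

/-- Rotation invariance of the Gaussian moves the gain from the coordinate axes to any orthonormal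
frame `e, ie`. -/
lemma IsBellman.pointwise_step {φ : H₁ × H₂ → ℝ} (hφ : IsBellman φ) {K : ℝ} {F : ℂ → H₁}
    {F' : ℂ → ℂ →L[ℝ] H₁} {G : ℂ → H₂} {G' : ℂ → ℂ →L[ℝ] H₂} (hF : Tame K F F')
    (hG : Tame K G G') {δ : ℝ} (hδ0 : 0 ≤ δ) (hδ1 : δ ≤ 1) (x e : ℂ) (he : ‖e‖ = 1) :
    heat δ (fun y => φ (F y, G y)) x +
      δ * (‖F' x e‖ * ‖G' x e‖ + ‖F' x (e * Complex.I)‖ * ‖G' x (e * Complex.I)‖) -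
      6 * K ^ 2 * momentConst * √δ ^ 3 * decay x ≤ φ (heat δ F x, heat δ G x) := by
  set R : ℂ ≃ₗᵢ[ℝ] ℂ := rotation ⟨e, by simpa [Submonoid.unitSphere] using he⟩ with hR
  have hRe : ∀ η, R η = e * η := fun η => rfl
  have cF := hF.cont
  have cG := hG.cont
  have b1 : ∀ x, ‖F x‖ ≤ K := fun x => (hF.bound x).trans (mul_decay_le hF.nonneg x)
  have b2 : ∀ x, ‖G x‖ ≤ K := fun x => (hG.bound x).trans (mul_decay_le hF.nonneg x)
  let E : ℂ →L[ℝ] ℂ := R.toContinuousLinearEquiv.toContinuousLinearMap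
  have hE : ∀ η, E η = e * η := fun η => rfl
  have hEn : ‖E‖ ≤ 1 := R.toLinearIsometry.norm_toContinuousLinearMap_le
  have nR : ∀ η : ℂ, ‖e * η‖ = ‖η‖ := fun η => by rw [norm_mul, he, one_mul]
  have := hφ.local_gain (A := fun η => F (x + e * η)) (B := fun η => G (x + e * η))
    (a₀ := F x) (b₀ := G x) (L := (F' x).comp E) (M := (G' x).comp E) (K := K) (d := decay x)
    (by fun_prop) (by fun_prop) (decay_pos x).le (fun _ => b1 _) (fun _ => b2 _)
    (((F' x).opNorm_comp_le E).trans ((mul_le_of_le_one_right (norm_nonneg _) hEn).trans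
      (hF.bound' x)))
    (((G' x).opNorm_comp_le E).trans ((mul_le_of_le_one_right (norm_nonneg _) hEn).trans
      ((hG.bound' x).trans (mul_decay_le hF.nonneg x))))
    (fun η => by
      have := hF.taylor x (e * η)
      rw [nR] at this
      refine this.trans (le_of_eq (by ring)))
    (fun η => by
      have := hG.taylor x (e * η)
      rw [nR] at this
      refine this.trans (mul_le_of_le_one_right ?_ (decay_le_one x))
      have := hF.nonneg
      positivity) hδ0 hδ1
  have i1 : ∫ η, φ (F (x + e * η), G (x + e * η)) ∂heatMeasure δ =
      heat δ (fun y => φ (F y, G y)) x :=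
    integral_heatMeasure_isometry R (fun η => φ (F (x + η), G (x + η)))
  have i2 : ∫ η, F (x + e * η) ∂heatMeasure δ = heat δ F x :=
    integral_heatMeasure_isometry R (fun η => F (x + η))
  have i3 : ∫ η, G (x + e * η) ∂heatMeasure δ = heat δ G x :=
    integral_heatMeasure_isometry R (fun η => G (x + η))
  rw [i1, i2, i3] at this
  simpa only [ContinuousLinearMap.comp_apply, hE, mul_one] using this

lemma LinearDecay.integrable {φ : H₁ × H₂ → ℝ} (hφ : IsBellman φ) (hd : LinearDecay φ) {K : ℝ}
    {F : ℂ → H₁} {F' : ℂ → ℂ →L[ℝ] H₁} {G : ℂ → H₂} {G' : ℂ → ℂ →L[ℝ] H₂} (hF : Tame K F F')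
    (hG : Tame K G G') : Integrable (fun y => φ (F y, G y)) := by
  obtain ⟨C, hC⟩ := hd K hF.nonneg
  have cF := hF.cont
  have cG := hG.cont
  exact (integrable_decay.const_mul C).mono'
    (hφ.continuous.comp (by fun_prop)).aestronglyMeasurable
    (ae_of_all _ fun y => hC (F y, G y) _ (decay_pos y).le (decay_le_one y) (hF.bound y)
        (hG.bound y))

lemma Tame.mono {V : Type*} [NormedAddCommGroup V] [NormedSpace ℝ V] {K K' : ℝ} (h : K ≤ K')
    {F : ℂ → V} {F' : ℂ → ℂ →L[ℝ] V} (hF : Tame K F F') :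
    Tame K' F F' := by
  have := hF.nonneg
  refine ⟨this.trans h, hF.cont, hF.cont', fun x => (hF.bound x).trans ?_,
    fun x => (hF.bound' x).trans ?_, fun x k => (hF.taylor x k).trans ?_⟩
  all_goals
    have := decay_pos x
    gcongr

/-- The frame is chosen separately at each point and without any measurability; only its consequence
`β`, assumed integrable, is integrated. -/
lemma IsBellman.step {φ : H₁ × H₂ → ℝ} (hφ : IsBellman φ) (hd : LinearDecay φ) {K : ℝ}
    {F : ℂ → H₁} {F' : ℂ → ℂ →L[ℝ] H₁} {G : ℂ → H₂} {G' : ℂ → ℂ →L[ℝ] H₂} (hF : Tame K F F')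
    (hG : Tame K G G') {β : ℂ → ℝ} (hβ : Integrable β)
    (hβe : ∀ x, ∃ e : ℂ, ‖e‖ = 1 ∧ β x ≤ 2 * (‖F' x e‖ * ‖G' x e‖ +
      ‖F' x (e * Complex.I)‖ * ‖G' x (e * Complex.I)‖))
    {δ : ℝ} (hδ0 : 0 ≤ δ) (hδ1 : δ ≤ 1) :
    (∫ y, φ (F y, G y)) + δ / 2 * (∫ y, β y) - 6 * K ^ 2 * momentConst * √δ ^ 3 * ∫ y, decay y ≤
      ∫ y, φ (heat δ F y, heat δ G y) := by
  have cF := hF.cont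
  have cG := hG.cont
  have c0 : Continuous (fun y => φ (F y, G y)) := hφ.continuous.comp (by fun_prop)
  have i0 := hd.integrable hφ hF hG
  have i1 : Integrable (heat δ (fun y => φ (F y, G y))) := integrable_heat c0 i0
  have i2 := hβ.const_mul (δ / 2)
  have i3 := integrable_decay.const_mul (6 * K ^ 2 * momentConst * √δ ^ 3)
  have i4 : Integrable (fun y => φ (heat δ F y, heat δ G y)) :=
    hd.integrable hφ (hF.heat (le_refl δ)) (hG.heat (le_refl δ))
  have i12 : Integrable (fun y => heat δ (fun y => φ (F y, G y)) y + δ / 2 * β y) := i1.add i2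
  have := integral_mono (i12.sub i3) i4 fun x => by
    obtain ⟨e, he, hb⟩ := hβe x
    have h1 := hφ.pointwise_step hF hG hδ0 hδ1 x e he
    have h2 := mul_le_mul_of_nonneg_left hb (show 0 ≤ δ / 2 by positivity)
    simp only [Pi.sub_apply]
    linarith
  have e := integral_sub i12 i3
  have e' := integral_add i1 i2
  rw [integral_const_mul] at e e'
  simp only [Pi.sub_apply] at this
  rw [e, e', integral_heat c0 i0] at this
  exact this

lemma IsBellman.telescope {φ : H₁ × H₂ → ℝ} (hφ : IsBellman φ) (hd : LinearDecay φ) {K : ℝ}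
    {F : ℂ → H₁} {F' : ℂ → ℂ →L[ℝ] H₁} {G : ℂ → H₂} {G' : ℂ → ℂ →L[ℝ] H₂} (hF : Tame K F F')
    (hG : Tame K G G') {β : ℝ → ℂ → ℝ} (hβ : ∀ t, 0 ≤ t → Integrable (β t))
    (hβe : ∀ t x, ∃ e : ℂ, ‖e‖ = 1 ∧ β t x ≤ 2 * (‖heat t F' x e‖ * ‖heat t G' x e‖ +
      ‖heat t F' x (e * Complex.I)‖ * ‖heat t G' x (e * Complex.I)‖))
    {δ T : ℝ} (hδ0 : 0 ≤ δ) (hδ1 : δ ≤ 1) (N : ℕ) (hN : N * δ ≤ T) :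
    (∫ y, φ (F y, G y)) + δ / 2 * (∑ k ∈ Finset.range N, ∫ y, β (k * δ) y) -
        N * (6 * (K * heatConst T) ^ 2 * momentConst * √δ ^ 3 * ∫ y, decay y) ≤
      ∫ y, φ (heat (N * δ) F y, heat (N * δ) G y) := by
  have b1 : ∀ x, ‖F x‖ ≤ K := fun x => (hF.bound x).trans (mul_decay_le hF.nonneg x)
  have b2 : ∀ x, ‖G x‖ ≤ K := fun x => (hG.bound x).trans (mul_decay_le hF.nonneg x)
  induction N with
  | zero =>
    have h0 : heatMeasure 0 = Measure.dirac 0 := by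
      simp [heatMeasure]
    have hF0 : heat 0 F = F := by ext1 x; simp [heat, h0]
    have hG0 : heat 0 G = G := by ext1 x; simp [heat, h0]
    simp [hF0, hG0]
  | succ N ih =>
    have hN' : N * δ ≤ T := by
      push_cast at hN
      linarith
    have ih := ih hN'
    have s := hφ.step hd (hF.heat hN') (hG.heat hN') (hβ (N * δ) (by positivity)) (hβe (N * δ))
      hδ0 hδ1
    have eF := heat_heat hF.cont b1 hδ0 (show 0 ≤ N * δ by positivity)
    have eG := heat_heat hG.cont b2 hδ0 (show 0 ≤ N * δ by positivity)
    have ed : δ + N * δ = ((N + 1 : ℕ) : ℝ) * δ := by push_cast; ring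
    rw [eF, eG, ed] at s
    rw [Finset.sum_range_succ]
    push_cast at s ⊢
    linarith

end Step

/-! ### The bilinear form of the pair of operators, and isotropic frames. -/

section Pairing

/-- Twice the holomorphic part of a real linear map. -/
def dz (D : ℂ →L[ℝ] ℂ) : ℂ := D 1 - Complex.I * D Complex.I

lemma dz_eq (D : ℂ →L[ℝ] ℂ) {e : ℂ} (he : ‖e‖ = 1) :
    dz D = conj e * (D e - Complex.I * D (e * Complex.I)) := by
  have h1 : D e = e.re * D 1 + e.im * D Complex.I := by
    conv_lhs => rw [show e = e.re • (1 : ℂ) + e.im • Complex.I by apply Complex.ext <;> simp]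
    rw [map_add, map_smul, map_smul]; simp
  have h2 : D (e * Complex.I) = e.re * D Complex.I - e.im * D 1 := by
    conv_lhs => rw [show e * Complex.I = e.re • Complex.I - e.im • (1 : ℂ) by
      apply Complex.ext <;> simp]
    rw [map_sub, map_smul, map_smul]; simp
  have h3 : conj e * (e.re + e.im * Complex.I) = 1 := by
    rw [Complex.re_add_im, mul_comm, Complex.mul_conj, Complex.normSq_eq_norm_sq, he]; simp
  have h4 : D e - Complex.I * D (e * Complex.I) = (e.re + e.im * Complex.I) * dz D := by
    rw [h1, h2, dz]
    linear_combination ((e.im : ℂ) * D Complex.I) * Complex.I_sq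
  rw [h4, ← mul_assoc, h3, one_mul]

/-- Turning the frame by a right angle exchanges the two lengths, so their difference changes sign
and vanishes at some angle. -/
lemma exists_isotropic_frame (D : ℂ →L[ℝ] ℂ) :
    ∃ e : ℂ, ‖e‖ = 1 ∧ ‖D e‖ = ‖D (e * Complex.I)‖ := by
  set g : ℝ → ℝ := fun θ => ‖D (Complex.exp (θ * Complex.I))‖ -
    ‖D (Complex.exp (θ * Complex.I) * Complex.I)‖ with hg
  have hc : Continuous g := by fun_prop
  have h0 : g 0 = ‖D 1‖ - ‖D Complex.I‖ := by simp [hg]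
  have h1 : g (Real.pi / 2) = -(‖D 1‖ - ‖D Complex.I‖) := by
    simp only [hg]
    push_cast
    rw [Complex.exp_pi_div_two_mul_I, Complex.I_mul_I, map_neg, norm_neg]
    ring
  have hm : (0 : ℝ) ∈ Set.range g := by
    rcases le_total (g 0) 0 with h | h
    · exact mem_range_of_exists_le_of_exists_ge hc ⟨0, h⟩ ⟨Real.pi / 2, by linarith⟩
    · exact mem_range_of_exists_le_of_exists_ge hc ⟨Real.pi / 2, by linarith⟩ ⟨0, h⟩
  obtain ⟨θ, hθ⟩ := hm
  exact ⟨Complex.exp (θ * Complex.I), Complex.norm_exp_ofReal_mul_I θ, sub_eq_zero.1 hθ⟩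

/-- The cross terms have opposite signs for a linear map and its conjugate. This cancellation is
what using `f` and `conj f` together provides. -/
lemma norm_sq_sub_add_norm_sq_conj (a b : ℂ) :
    ‖a - Complex.I * b‖ ^ 2 + ‖conj a - Complex.I * conj b‖ ^ 2 =
      2 * (‖a‖ ^ 2 + ‖b‖ ^ 2) := by
  simp only [← Complex.normSq_eq_norm_sq, Complex.normSq_apply]
  simp
  ring

lemma mul_add_mul_le_sqrt {a b c d s t : ℝ} (hs : 0 ≤ s) (ht : 0 ≤ t)
    (h1 : a ^ 2 + b ^ 2 = s ^ 2) (h2 : c ^ 2 + d ^ 2 = t ^ 2) : a * c + b * d ≤ s * t := by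
  refine abs_le_of_sq_le_sq' ?_ (by positivity) |>.2
  rw [mul_pow, ← h1, ← h2]
  nlinarith [sq_nonneg (a * d - b * c)]

/-- The bilinear form obtained by differentiating the pairing of `(Bf, B conj f)` with `(g₁, g₂)`
along the heat flow. -/
def holoPairing (D : ℂ →L[ℝ] ℂ) (Γ : ℂ →L[ℝ] WithLp 2 (ℂ × ℂ)) : ℝ :=
  ((D 1 - Complex.I * D Complex.I) * ((Γ 1).fst - Complex.I * (Γ Complex.I).fst) +
    (conj (D 1) - Complex.I * conj (D Complex.I)) *
      ((Γ 1).snd - Complex.I * (Γ Complex.I).snd)).re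

/-- Changing frame multiplies each Wirtinger derivative by a unimodular factor. In an isotropic
frame the two derivatives of `f` and `conj f` form a vector of length exactly `2 ‖D e‖`;
Cauchy–Schwarz against `Γ e` and `Γ (ie)` gives the two terms. -/
lemma holoPairing_le (D : ℂ →L[ℝ] ℂ) (Γ : ℂ →L[ℝ] WithLp 2 (ℂ × ℂ)) :
    ∃ e : ℂ, ‖e‖ = 1 ∧ holoPairing D Γ ≤ 2 * (‖D e‖ * ‖Γ e‖ +
      ‖D (e * Complex.I)‖ * ‖Γ (e * Complex.I)‖) := by
  obtain ⟨e, he, hs⟩ := exists_isotropic_frame D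
  refine ⟨e, he, ?_⟩
  let pr₁ : WithLp 2 (ℂ × ℂ) →L[ℝ] ℂ :=
    (ContinuousLinearMap.fst ℝ ℂ ℂ).comp
        (WithLp.prodContinuousLinearEquiv 2 ℝ ℂ ℂ).toContinuousLinearMap
  let pr₂ : WithLp 2 (ℂ × ℂ) →L[ℝ] ℂ :=
    (ContinuousLinearMap.snd ℝ ℂ ℂ).comp
        (WithLp.prodContinuousLinearEquiv 2 ℝ ℂ ℂ).toContinuousLinearMap
  have d1 : D 1 - Complex.I * D Complex.I = _ := dz_eq D he
  have d2 : conj (D 1) - Complex.I * conj (D Complex.I) =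
      conj e * (conj (D e) - Complex.I * conj (D (e * Complex.I))) :=
    dz_eq (Complex.conjCLE.toContinuousLinearMap.comp D) he
  have d3 : (Γ 1).fst - Complex.I * (Γ Complex.I).fst =
      conj e * ((Γ e).fst - Complex.I * (Γ (e * Complex.I)).fst) := dz_eq (pr₁.comp Γ) he
  have d4 : (Γ 1).snd - Complex.I * (Γ Complex.I).snd =
      conj e * ((Γ e).snd - Complex.I * (Γ (e * Complex.I)).snd) := dz_eq (pr₂.comp Γ) he
  have nc : ‖conj e‖ = 1 := by simpa using he
  have nsub : ∀ a b : ℂ, ‖a - Complex.I * b‖ ≤ ‖a‖ + ‖b‖ := fun a b => by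
    refine (norm_sub_le _ _).trans ?_
    simp
  have hX := norm_sq_sub_add_norm_sq_conj (D e) (D (e * Complex.I))
  rw [← hs] at hX ⊢
  have hg1 := WithLp.prod_norm_sq_eq_of_L2 (Γ e)
  have hg2 := WithLp.prod_norm_sq_eq_of_L2 (Γ (e * Complex.I))
  refine (Complex.re_le_norm _).trans ?_
  rw [d1, d2, d3, d4]
  refine (norm_add_le _ _).trans ?_
  simp only [norm_mul, nc, one_mul]
  have n3 := nsub (Γ e).fst (Γ (e * Complex.I)).fst
  have n4 := nsub (Γ e).snd (Γ (e * Complex.I)).snd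
  have c1 := mul_add_mul_le_sqrt (s := 2 * ‖D e‖) (t := ‖Γ e‖) (by positivity) (by positivity)
    (hX.trans (by ring)) hg1.symm
  have c2 := mul_add_mul_le_sqrt (s := 2 * ‖D e‖) (t := ‖Γ (e * Complex.I)‖) (by positivity)
    (by positivity) (hX.trans (by ring)) hg2.symm
  have m1 := mul_le_mul_of_nonneg_left n3 (norm_nonneg (D e - Complex.I * D (e * Complex.I)))
  have m2 := mul_le_mul_of_nonneg_left n4
    (norm_nonneg (conj (D e) - Complex.I * conj (D (e * Complex.I))))
  linarith

end Pairing

/-! ### Two integrals in polar coordinates. -/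

section RadialIntegrals

lemma integrable_and_integral_poissonKernel :
    Integrable (fun w : ℂ => 1 / (1 + ‖w‖ ^ 2) ^ 2) ∧
    ∫ w : ℂ, 1 / (1 + ‖w‖ ^ 2) ^ 2 = Real.pi := by
  have hd : ∀ x ∈ Set.Ici (0 : ℝ), HasDerivAt (fun y : ℝ => -(1 / 2) * (1 + y ^ 2)⁻¹)
      (x * (1 / (1 + x ^ 2) ^ 2)) x := by
    intro x _
    have h1 : HasDerivAt (fun y : ℝ => 1 + y ^ 2) (2 * x) x := by
      simpa using (hasDerivAt_pow 2 x).const_add 1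
    convert! (h1.inv (by positivity)).const_mul (-(1 / 2)) using 1
    field_simp
  have hp : ∀ x ∈ Set.Ioi (0 : ℝ), 0 ≤ x * (1 / (1 + x ^ 2) ^ 2) := fun x hx => by
    have : (0 : ℝ) < x := hx
    positivity
  have hl : Tendsto (fun y : ℝ => -(1 / 2) * (1 + y ^ 2)⁻¹) atTop (𝓝 0) := by
    rw [show (0 : ℝ) = -(1 / 2) * 0 by simp]
    exact (tendsto_inv_atTop_zero.comp
      (tendsto_atTop_add_const_left _ _ (tendsto_pow_atTop two_ne_zero))).const_mul _
  have hi := integrableOn_Ioi_deriv_of_nonneg' hd hp hl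
  have hv := integral_Ioi_of_hasDerivAt_of_nonneg' hd hp hl
  constructor
  · refine (integrable_fun_norm_addHaar (volume : Measure ℂ)
      (f := fun y : ℝ => 1 / (1 + y ^ 2) ^ 2)).2 ?_
    rw [Complex.finrank_real_complex]
    simpa using hi
  · rw [integral_fun_norm_addHaar (volume : Measure ℂ) (fun y : ℝ => 1 / (1 + y ^ 2) ^ 2),
      Complex.finrank_real_complex]
    simp only [Nat.add_one_sub_one, pow_one, smul_eq_mul]
    rw [hv, Measure.real, Complex.volume_ball]
    simp
    ring

lemma integrableOn_inv_norm : IntegrableOn (fun w : ℂ => ‖w‖⁻¹) (Metric.ball 0 1) := by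
  refine (integrableOn_fun_norm_addHaar (volume : Measure ℂ) (f := fun y : ℝ => y⁻¹)).2 ?_
  rw [Complex.finrank_real_complex]
  refine IntegrableOn.congr_fun (f := fun _ : ℝ => (1 : ℝ)) ?_ (fun y hy => ?_) measurableSet_Ioo
  · exact integrableOn_const (by simp)
  · have : (0 : ℝ) < y := hy.1
    simp; field_simp

end RadialIntegrals

/-! ### The Cauchy transform and its commutation with the heat semigroup. -/

section CauchyTransform

/-- The integrable majorant of `decay (x - w) / ‖w‖`. -/
def cauchyMajorant (x w : ℂ) : ℝ :=
  (Metric.ball (0 : ℂ) 1).indicator (fun w => ‖w‖⁻¹) w + decay (x - w)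

lemma integrable_cauchyMajorant (x : ℂ) : Integrable (cauchyMajorant x) :=
  ((integrable_indicator_iff Metric.isOpen_ball.measurableSet).2 integrableOn_inv_norm).add
    (integrable_decay.comp_sub_left x)

/-- The supremum of `∫ decay (x - w) / ‖w‖`, up to a constant. -/
def cauchyConst : ℝ :=
  (∫ w : ℂ, (Metric.ball (0 : ℂ) 1).indicator (fun w => ‖w‖⁻¹) w) + ∫ w, decay w

lemma integral_cauchyMajorant (x : ℂ) : ∫ w, cauchyMajorant x w = cauchyConst := by
  unfold cauchyMajorant cauchyConst
  rw [integral_add ((integrable_indicator_iff Metric.isOpen_ball.measurableSet).2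
    integrableOn_inv_norm) (integrable_decay.comp_sub_left x),
    integral_sub_left_eq_self (fun w => decay w)]

lemma norm_div_le_cauchyMajorant {g : ℂ → ℂ} {K : ℝ} (hg : ∀ x, ‖g x‖ ≤ K * decay x) (x w : ℂ) :
    ‖g (x - w) / w‖ ≤ K * cauchyMajorant x w := by
  have hK0 : 0 ≤ K := nonneg_of_mul_nonneg_left ((norm_nonneg _).trans (hg 0)) (decay_pos 0)
  rw [norm_div, div_eq_mul_inv]
  have hd := (decay_pos (x - w)).le
  by_cases hw : w ∈ Metric.ball (0 : ℂ) 1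
  · rw [cauchyMajorant, Set.indicator_of_mem hw]
    have h1 : ‖g (x - w)‖ ≤ K := (hg _).trans (mul_decay_le hK0 _)
    have := mul_le_mul_of_nonneg_right h1 (inv_nonneg.2 (norm_nonneg w))
    nlinarith [mul_nonneg hK0 hd]
  · rw [cauchyMajorant, Set.indicator_of_notMem hw, zero_add]
    have h1 : ‖w‖⁻¹ ≤ 1 := inv_le_one_of_one_le₀ (by simpa using hw)
    exact (mul_le_of_le_one_right (norm_nonneg _) h1).trans (hg _)

lemma integrable_div_of_decay {g : ℂ → ℂ} (hc : Continuous g) {K : ℝ}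
    (hg : ∀ x, ‖g x‖ ≤ K * decay x) (x : ℂ) : Integrable (fun w => g (x - w) / w) := by
  refine ((integrable_cauchyMajorant x).const_mul K).mono' ?_
    (ae_of_all _ fun w => norm_div_le_cauchyMajorant hg x w)
  exact (Measurable.div (by fun_prop) measurable_id).aestronglyMeasurable

/-- The Cauchy transform, normalised to invert `∂_x + i ∂_y`. -/
def cauchyTransform (g : ℂ → ℂ) (x : ℂ) : ℂ := (1 / (2 * (Real.pi : ℂ))) * ∫ w, g (x - w) / w

lemma norm_integral_div_le {g : ℂ → ℂ} {K : ℝ} (hg : ∀ x, ‖g x‖ ≤ K * decay x) (x : ℂ) :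
    ‖∫ w, g (x - w) / w‖ ≤ K * cauchyConst := by
  rw [← integral_cauchyMajorant x, ← integral_const_mul]
  exact norm_integral_le_of_norm_le ((integrable_cauchyMajorant x).const_mul K)
    (ae_of_all _ fun w => norm_div_le_cauchyMajorant hg x w)

lemma norm_cauchyTransform_le {g : ℂ → ℂ} {K : ℝ} (hg : ∀ x, ‖g x‖ ≤ K * decay x) (x : ℂ) :
    ‖cauchyTransform g x‖ ≤ K * cauchyConst := by
  rw [cauchyTransform, norm_mul]
  have h1 : ‖1 / (2 * (Real.pi : ℂ))‖ ≤ 1 := by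
    rw [norm_div, norm_mul, norm_one, Complex.norm_real, Complex.norm_ofNat,
      Real.norm_of_nonneg Real.pi_pos.le, div_le_one (by positivity)]
    linarith [Real.pi_gt_three]
  exact (mul_le_of_le_one_left (norm_nonneg _) h1).trans (norm_integral_div_le hg x)

lemma heat_cauchyTransform {g : ℂ → ℂ} (hc : Continuous g) {K : ℝ}
    (hg : ∀ x, ‖g x‖ ≤ K * decay x) (t : ℝ) (x : ℂ) :
    heat t (cauchyTransform g) x = cauchyTransform (heat t g) x := by
  have hint : Integrable (fun z : ℂ × ℂ => g (x + z.1 - z.2) / z.2)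
      ((heatMeasure t).prod volume) := by
    have hm : AEStronglyMeasurable (fun z : ℂ × ℂ => g (x + z.1 - z.2) / z.2)
        ((heatMeasure t).prod volume) :=
      (Measurable.div (by fun_prop) measurable_snd).aestronglyMeasurable
    refine (integrable_prod_iff hm).2
      ⟨ae_of_all _ fun η => integrable_div_of_decay hc hg (x + η), ?_⟩
    refine Integrable.of_bound (hm.norm.integral_prod_right') (K * cauchyConst)
      (ae_of_all _ fun η => ?_)
    rw [Real.norm_of_nonneg (integral_nonneg fun _ => norm_nonneg _),
      ← integral_cauchyMajorant (x + η), ← integral_const_mul]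
    exact integral_mono (integrable_div_of_decay hc hg (x + η)).norm
      ((integrable_cauchyMajorant _).const_mul K)
      fun w => norm_div_le_cauchyMajorant hg (x + η) w
  simp only [heat, cauchyTransform]
  rw [integral_const_mul, integral_integral_swap hint]
  congr 2
  ext1 w
  rw [integral_div]
  simp only [add_sub_right_comm]

end CauchyTransform

/-! ### Wirtinger derivatives, integration by parts and the regularised kernel. -/

section Wirtinger

/-- `∂_x - i ∂_y`. -/
def dzF (u : ℂ → ℂ) (x : ℂ) : ℂ := dz (fderiv ℝ u x)

/-- `∂_x + i ∂_y`. -/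
def dzbF (u : ℂ → ℂ) (x : ℂ) : ℂ := fderiv ℝ u x 1 + Complex.I * fderiv ℝ u x Complex.I

lemma contDiff_fderiv_apply {V : Type*} [NormedAddCommGroup V] [NormedSpace ℝ V] {u : ℂ → V}
    (hu : ContDiff ℝ ∞ u) (v : ℂ) : ContDiff ℝ ∞ (fun x => fderiv ℝ u x v) :=
  (hu.fderiv_right (m := ∞) le_rfl).clm_apply contDiff_const

lemma contDiff_dzF {u : ℂ → ℂ} (hu : ContDiff ℝ ∞ u) : ContDiff ℝ ∞ (dzF u) :=
  (contDiff_fderiv_apply hu 1).sub (contDiff_const.mul (contDiff_fderiv_apply hu Complex.I))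

lemma contDiff_dzbF {u : ℂ → ℂ} (hu : ContDiff ℝ ∞ u) : ContDiff ℝ ∞ (dzbF u) :=
  (contDiff_fderiv_apply hu 1).add (contDiff_const.mul (contDiff_fderiv_apply hu Complex.I))

lemma hasCompactSupport_dzF {u : ℂ → ℂ} (hu : HasCompactSupport u) : HasCompactSupport (dzF u) :=
  (hu.fderiv (𝕜 := ℝ)).comp_left (g := dz) (by simp [dz])

lemma hasCompactSupport_dzbF {u : ℂ → ℂ} (hu : HasCompactSupport u) :
    HasCompactSupport (dzbF u) :=
  (hu.fderiv (𝕜 := ℝ)).comp_left (g := fun D : ℂ →L[ℝ] ℂ => D 1 + Complex.I * D Complex.I)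
    (by simp)

lemma integral_mul_fderiv {u k : ℂ → ℂ} (hu : ContDiff ℝ 1 u) (hc : HasCompactSupport u)
    (hk : ContDiff ℝ 1 k) (v : ℂ) :
    Integrable (fun w => u w * fderiv ℝ k w v) ∧ Integrable (fun w => fderiv ℝ u w v * k w) ∧
    ∫ w, u w * fderiv ℝ k w v = -∫ w, fderiv ℝ u w v * k w := by
  have cu := hu.continuous
  have ck := hk.continuous
  have cu' : Continuous fun w => fderiv ℝ u w v :=
      (hu.continuous_fderiv one_ne_zero).clm_apply continuous_const
  have ck' : Continuous fun w => fderiv ℝ k w v :=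
      (hk.continuous_fderiv one_ne_zero).clm_apply continuous_const
  have i1 : Integrable (fun w => u w * fderiv ℝ k w v) :=
    (cu.mul ck').integrable_of_hasCompactSupport hc.mul_right
  have i2 : Integrable (fun w => fderiv ℝ u w v * k w) :=
    (cu'.mul ck).integrable_of_hasCompactSupport (hc.fderiv_apply (𝕜 := ℝ) v).mul_right
  exact ⟨i1, i2, integral_mul_fderiv_eq_neg_fderiv_mul_of_integrable i2 i1
    ((cu.mul ck).integrable_of_hasCompactSupport hc.mul_right)
    (fun w _ => hu.differentiable one_ne_zero w) (fun w _ => hk.differentiable one_ne_zero w)⟩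

lemma integral_mul_dzF {u k : ℂ → ℂ} (hu : ContDiff ℝ 1 u) (hc : HasCompactSupport u)
    (hk : ContDiff ℝ 1 k) : ∫ w, u w * dzF k w = -∫ w, dzF u w * k w := by
  obtain ⟨a1, a2, a3⟩ := integral_mul_fderiv hu hc hk 1
  obtain ⟨b1, b2, b3⟩ := integral_mul_fderiv hu hc hk Complex.I
  have e1 : ∀ w, u w * dzF k w =
      u w * fderiv ℝ k w 1 - Complex.I * (u w * fderiv ℝ k w Complex.I) := fun w => by
    rw [dzF, dz]; ring
  have e2 : ∀ w, dzF u w * k w =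
      fderiv ℝ u w 1 * k w - Complex.I * (fderiv ℝ u w Complex.I * k w) := fun w => by
    rw [dzF, dz]; ring
  simp only [e1, e2]
  rw [integral_sub a1 (b1.const_mul _), integral_sub a2 (b2.const_mul _), integral_const_mul,
    integral_const_mul, a3, b3]
  ring

lemma integral_mul_dzbF {u k : ℂ → ℂ} (hu : ContDiff ℝ 1 u) (hc : HasCompactSupport u)
    (hk : ContDiff ℝ 1 k) : ∫ w, u w * dzbF k w = -∫ w, dzbF u w * k w := by
  obtain ⟨a1, a2, a3⟩ := integral_mul_fderiv hu hc hk 1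
  obtain ⟨b1, b2, b3⟩ := integral_mul_fderiv hu hc hk Complex.I
  have e1 : ∀ w, u w * dzbF k w =
      u w * fderiv ℝ k w 1 + Complex.I * (u w * fderiv ℝ k w Complex.I) := fun w => by
    rw [dzbF]; ring
  have e2 : ∀ w, dzbF u w * k w =
      fderiv ℝ u w 1 * k w + Complex.I * (fderiv ℝ u w Complex.I * k w) := fun w => by
    rw [dzbF]; ring
  simp only [e1, e2]
  rw [integral_add a1 (b1.const_mul _), integral_add a2 (b2.const_mul _), integral_const_mul,
    integral_const_mul, a3, b3]
  ring

/-- A smooth regularisation of `1 / w`. -/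
def regInv (ε : ℝ) (w : ℂ) : ℂ := conj w / (w * conj w + (ε : ℂ) ^ 2)

lemma regInv_denom (ε : ℝ) (w : ℂ) :
    w * conj w + (ε : ℂ) ^ 2 = ((‖w‖ ^ 2 + ε ^ 2 : ℝ) : ℂ) := by
  rw [Complex.mul_conj, Complex.normSq_eq_norm_sq]; push_cast; rfl

lemma regInv_denom_ne {ε : ℝ} (hε : 0 < ε) (w : ℂ) : w * conj w + (ε : ℂ) ^ 2 ≠ 0 := by
  rw [regInv_denom]
  exact_mod_cast (by positivity : (0 : ℝ) < ‖w‖ ^ 2 + ε ^ 2).ne'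

lemma contDiff_regInv {ε : ℝ} (hε : 0 < ε) : ContDiff ℝ 1 (regInv ε) := by
  have hc : ContDiff ℝ 1 (fun w : ℂ => conj w) := Complex.conjCLE.contDiff
  have hn : ContDiff ℝ 1 (fun w : ℂ => w * conj w + (ε : ℂ) ^ 2) :=
    (contDiff_id.mul hc).add contDiff_const
  simpa only [regInv, div_eq_mul_inv] using! hc.mul (hn.inv (regInv_denom_ne hε))

lemma fderiv_regInv {ε : ℝ} (hε : 0 < ε) (w v : ℂ) :
    fderiv ℝ (regInv ε) w v = (conj v * (ε : ℂ) ^ 2 - conj w ^ 2 * v) /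
      (w * conj w + (ε : ℂ) ^ 2) ^ 2 := by
  have hne := regInv_denom_ne hε w
  have hc : HasFDerivAt (fun w : ℂ => conj w) (Complex.conjCLE : ℂ →L[ℝ] ℂ) w :=
    Complex.conjCLE.hasFDerivAt
  have hn : HasFDerivAt (fun w : ℂ => w * conj w + (ε : ℂ) ^ 2) _ w :=
    ((hasFDerivAt_id w).mul hc).add_const _
  have hk := ((contDiff_regInv hε).differentiable one_ne_zero w).hasFDerivAt
  have hm := hk.mul hn
  have he : (regInv ε * fun w : ℂ => w * conj w + (ε : ℂ) ^ 2) = fun w => conj w := by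
    ext1 w
    simp only [Pi.mul_apply, regInv]
    rw [div_mul_cancel₀ _ (regInv_denom_ne hε w)]
  rw [he] at hm
  have := DFunLike.congr_fun (hm.unique hc) v
  simp [regInv] at this
  rw [eq_div_iff (pow_ne_zero 2 hne)]
  have hne' : conj w * w + (ε : ℂ) ^ 2 ≠ 0 := by rwa [mul_comm]
  field_simp at this
  linear_combination this

lemma dzbF_regInv {ε : ℝ} (hε : 0 < ε) (w : ℂ) :
    dzbF (regInv ε) w = 2 * (ε : ℂ) ^ 2 / (w * conj w + (ε : ℂ) ^ 2) ^ 2 := by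
  rw [dzbF, fderiv_regInv hε, fderiv_regInv hε, map_one, Complex.conj_I, ← mul_div_assoc,
    ← add_div]
  congr 1
  linear_combination (-(ε : ℂ) ^ 2 - conj w ^ 2) * Complex.I_sq

lemma dzF_regInv {ε : ℝ} (hε : 0 < ε) (w : ℂ) :
    dzF (regInv ε) w = -2 * (conj w ^ 2 / (w * conj w + (ε : ℂ) ^ 2) ^ 2) := by
  rw [dzF, dz, fderiv_regInv hε, fderiv_regInv hε, map_one, Complex.conj_I, ← mul_div_assoc,
    ← sub_div, ← mul_div_assoc]
  congr 1
  linear_combination ((ε : ℂ) ^ 2 + conj w ^ 2) * Complex.I_sq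

lemma norm_regInv_le {ε : ℝ} (w : ℂ) : ‖regInv ε w‖ ≤ ‖w‖⁻¹ := by
  rw [regInv, regInv_denom, norm_div, Complex.norm_real, RCLike.norm_conj,
    Real.norm_of_nonneg (by positivity)]
  by_cases hw : ‖w‖ = 0
  · simp [hw]
  · have : 0 < ‖w‖ := lt_of_le_of_ne (norm_nonneg _) (Ne.symm hw)
    rw [div_le_iff₀ (by positivity)]
    field_simp
    nlinarith [sq_nonneg ε]

lemma tendsto_regInv (w : ℂ) : Tendsto (fun ε : ℝ => regInv ε w) (𝓝[>] 0) (𝓝 w⁻¹) := by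
  by_cases hw : w = 0
  · simp [hw, regInv]
  · have hne : w * conj w + ((0 : ℝ) : ℂ) ^ 2 ≠ 0 := by simp [hw]
    have hc : ContinuousAt (fun ε : ℝ => regInv ε w) 0 := by
      unfold regInv
      exact ContinuousAt.div (by fun_prop) (by fun_prop) hne
    have : regInv 0 w = w⁻¹ := by
      have : conj w ≠ 0 := by simpa using hw
      simp only [regInv]
      field_simp
      simp
    rw [← this]
    exact hc.tendsto.mono_left nhdsWithin_le_nhds

end Wirtinger

/-! ### The Cauchy–Pompeiu formula and the principal value. -/

section CauchyFormula

lemma exists_decay_bound {V : Type*} [NormedAddCommGroup V] {g : ℂ → V} (hg : Continuous g)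
    (hc : HasCompactSupport g) : ∃ K, 0 ≤ K ∧ ∀ x, ‖g x‖ ≤ K * decay x := by
  have h1 : Continuous fun x => ‖g x‖ / decay x := by
    exact hg.norm.div continuous_decay (fun x => (decay_pos x).ne')
  have h2 : HasCompactSupport fun x => ‖g x‖ / decay x := by
    simp only [div_eq_mul_inv]
    exact hc.norm.mul_right
  obtain ⟨K, hK⟩ := h2.exists_bound_of_continuous h1
  refine ⟨K, (norm_nonneg _).trans (hK 0), fun x => ?_⟩
  have := hK x
  rw [Real.norm_of_nonneg (div_nonneg (norm_nonneg _) (decay_pos x).le),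
    div_le_iff₀ (decay_pos x)] at this
  exact this

/-- An approximate identity on the plane. It is used both for a kernel of mass `2π` and for one of
mass zero, which disappears in the limit. -/
lemma tendsto_integral_rescale {u q : ℂ → ℂ} (hu : Continuous u) {K : ℝ} (hK : ∀ x, ‖u x‖ ≤ K)
    (hq : Integrable q) :
    Tendsto (fun ε : ℝ => ∫ w, u w * (((ε : ℂ) ^ 2)⁻¹ * q (ε⁻¹ • w))) (𝓝[>] 0)
      (𝓝 (u 0 * ∫ w, q w)) := by
  have h1 : Tendsto (fun ε : ℝ => ∫ w, u (ε • w) * q w) (𝓝[>] 0) (𝓝 (u 0 * ∫ w, q w)) := by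
    rw [← integral_const_mul]
    refine tendsto_integral_filter_of_dominated_convergence (fun w => K * ‖q w‖)
      (Eventually.of_forall fun ε => ?_) (Eventually.of_forall fun ε => ae_of_all _ fun w => ?_)
      (hq.norm.const_mul K) (ae_of_all _ fun w => ?_)
    · exact (hu.comp (by fun_prop)).aestronglyMeasurable.mul hq.aestronglyMeasurable
    · rw [norm_mul]
      exact mul_le_mul_of_nonneg_right (hK _) (norm_nonneg _)
    · refine Tendsto.mul_const _ ?_
      have : Continuous fun ε : ℝ => u (ε • w) := by fun_prop
      have := this.tendsto 0
      rw [zero_smul] at this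
      exact this.mono_left nhdsWithin_le_nhds
  refine h1.congr' ?_
  filter_upwards [self_mem_nhdsWithin] with ε hε
  have hε0 : (0 : ℝ) < ε := hε
  have := Measure.integral_comp_smul (volume : Measure ℂ) (fun w => u w * q (ε⁻¹ • w)) ε
  simp only [smul_smul, inv_mul_cancel₀ hε0.ne', one_smul] at this
  rw [this, Complex.finrank_real_complex, abs_of_pos (by positivity), ← integral_smul]
  refine integral_congr_ae (ae_of_all _ fun w => ?_)
  simp
  ring

lemma one_div_poisson (w : ℂ) : (1 / (w * conj w + 1) ^ 2 : ℂ) =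
    ((1 / (1 + ‖w‖ ^ 2) ^ 2 : ℝ) : ℂ) := by
  rw [Complex.mul_conj, Complex.normSq_eq_norm_sq]
  push_cast
  ring

lemma integral_poissonKernel_complex :
    Integrable (fun w : ℂ => (2 : ℂ) * (1 / (w * conj w + 1) ^ 2)) ∧
    (∫ w : ℂ, (2 : ℂ) * (1 / (w * conj w + 1) ^ 2)) = (2 * Real.pi : ℂ) := by
  obtain ⟨h1, h2⟩ := integrable_and_integral_poissonKernel
  simp only [one_div_poisson]
  refine ⟨h1.ofReal.const_mul 2, ?_⟩
  rw [integral_const_mul, integral_complex_ofReal, h2]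

lemma tendsto_integral_regInv {g : ℂ → ℂ} (hg : Continuous g) (hc : HasCompactSupport g) :
    Tendsto (fun ε : ℝ => ∫ w, g w * regInv ε w) (𝓝[>] 0) (𝓝 (∫ w, g w / w)) := by
  obtain ⟨K, -, hK⟩ := exists_decay_bound hg hc
  have hK' : ∀ x, ‖(fun w => g (-w)) x‖ ≤ K * decay x := fun x => by
    have := hK (-x)
    simpa [decay] using this
  have hint := integrable_div_of_decay (g := fun w => g (-w)) (by fun_prop) hK' 0
  simp only [zero_sub, neg_neg] at hint
  refine tendsto_integral_filter_of_dominated_convergence (fun w => ‖g w / w‖)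
    (Filter.eventually_of_mem self_mem_nhdsWithin fun ε hε =>
      (hg.mul (contDiff_regInv hε).continuous).aestronglyMeasurable)
    (Eventually.of_forall fun ε => ae_of_all _ fun w => ?_)
    hint.norm (ae_of_all _ fun w => ?_)
  · rw [norm_mul, norm_div, div_eq_mul_inv]
    exact mul_le_mul_of_nonneg_left (norm_regInv_le w) (norm_nonneg _)
  · rw [div_eq_mul_inv]
    exact (tendsto_regInv w).const_mul _

/-- Integrating by parts against the regularised `1 / w` replaces it by its `∂_x + i ∂_y`
derivative, an approximate identity of mass `2π`. -/
lemma integral_dzbF_div {u : ℂ → ℂ} (hu : ContDiff ℝ 1 u) (hc : HasCompactSupport u)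
    (hu' : Continuous (dzbF u)) : ∫ w, dzbF u w / w = -(2 * Real.pi * u 0) := by
  obtain ⟨K, hK⟩ := hc.exists_bound_of_continuous hu.continuous
  have h1 := tendsto_integral_regInv hu' (hasCompactSupport_dzbF hc)
  have h2 := tendsto_integral_rescale hu.continuous hK integral_poissonKernel_complex.1
  rw [integral_poissonKernel_complex.2] at h2
  have h3 := h2.neg
  rw [show -(u 0 * (2 * (Real.pi : ℂ))) = -(2 * Real.pi * u 0) by ring] at h3
  refine tendsto_nhds_unique (h1.congr' ?_) h3
  filter_upwards [self_mem_nhdsWithin] with ε hε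
  have hε0 : (0 : ℝ) < ε := hε
  have hεc : (ε : ℂ) ≠ 0 := by exact_mod_cast hε0.ne'
  rw [← neg_eq_iff_eq_neg.2 (integral_mul_dzbF hu hc (contDiff_regInv hε))]
  congr 1
  refine integral_congr_ae (ae_of_all _ fun w => ?_)
  have hn := regInv_denom_ne hε w
  simp only [dzbF_regInv hε0]
  congr 1
  simp only [Complex.real_smul, map_mul, map_inv₀, Complex.conj_ofReal, Complex.ofReal_inv]
  have e : (ε : ℂ)⁻¹ * w * ((ε : ℂ)⁻¹ * conj w) + 1 =
      (w * conj w + (ε : ℂ) ^ 2) / (ε : ℂ) ^ 2 := by field_simp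
  rw [e]
  field_simp

lemma fderiv_comp_const_sub {u : ℂ → ℂ} (hu : Differentiable ℝ u) (x w : ℂ) :
    fderiv ℝ (fun w => u (x - w)) w = -fderiv ℝ u (x - w) := by
  have := (hu (x - w)).hasFDerivAt.comp w ((hasFDerivAt_id w).const_sub x)
  refine (HasFDerivAt.fderiv (f := fun w => u (x - w)) this).trans ?_
  ext v
  simp

lemma cauchyTransform_dzbF {u : ℂ → ℂ} (hu : ContDiff ℝ ∞ u) (hc : HasCompactSupport u) :
    cauchyTransform (dzbF u) = u := by
  ext1 x
  set v : ℂ → ℂ := fun w => u (x - w) with hv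
  have hvs : ContDiff ℝ ∞ v := hu.comp (contDiff_const.sub contDiff_id)
  have hvc : HasCompactSupport v := hc.comp_homeomorph (Homeomorph.subLeft x)
  have h := integral_dzbF_div (hvs.of_le (by simp)) hvc (contDiff_dzbF hvs).continuous
  have e : ∀ w, dzbF v w = -dzbF u (x - w) := fun w => by
    simp only [dzbF, hv]
    rw [fderiv_comp_const_sub (hu.differentiable (by simp))]
    simp; ring
  simp only [e, neg_div, integral_neg, neg_inj] at h
  rw [cauchyTransform, h]
  have : (Real.pi : ℂ) ≠ 0 := by exact_mod_cast Real.pi_ne_zero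
  simp [hv]
  field_simp

/-- The difference between the sharp and the smooth truncation of `1 / w ^ 2`. -/
def truncDiff (w : ℂ) : ℂ :=
  {w : ℂ | 1 < ‖w‖}.indicator (fun w => 1 / w ^ 2) w - conj w ^ 2 / (w * conj w + 1) ^ 2

lemma norm_truncDiff_le (w : ℂ) : ‖truncDiff w‖ ≤ 3 * (1 / (1 + ‖w‖ ^ 2) ^ 2) := by
  have hd : (w * conj w + 1 : ℂ) = ((1 + ‖w‖ ^ 2 : ℝ) : ℂ) := by
    rw [Complex.mul_conj, Complex.normSq_eq_norm_sq]; push_cast; ring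
  have hpos : 0 < 1 + ‖w‖ ^ 2 := by positivity
  by_cases hw : 1 < ‖w‖
  · have hw0 : 0 < ‖w‖ := by linarith
    have hwne : w ≠ 0 := norm_pos_iff.1 hw0
    have hcne : conj w ≠ 0 := by simpa using hwne
    have e : truncDiff w = conj w ^ 2 * ((2 * ‖w‖ ^ 2 + 1 : ℝ) : ℂ) /
        ((‖w‖ ^ 4 * (1 + ‖w‖ ^ 2) ^ 2 : ℝ) : ℂ) := by
      rw [truncDiff, Set.indicator_of_mem (show w ∈ {w : ℂ | 1 < ‖w‖} from hw)]
      have hn : ((‖w‖ : ℝ) : ℂ) ^ 2 = w * conj w := by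
        rw [Complex.mul_conj, Complex.normSq_eq_norm_sq]; push_cast; rfl
      have hd' : w * conj w + 1 ≠ 0 := by
        rw [hd]; exact_mod_cast hpos.ne'
      have hd'' : 1 + w * conj w ≠ 0 := by rwa [add_comm]
      push_cast
      rw [show ((‖w‖ : ℝ) : ℂ) ^ 4 = (((‖w‖ : ℝ) : ℂ) ^ 2) ^ 2 by ring, hn]
      field_simp
      ring
    rw [e, norm_div, norm_mul, norm_pow, RCLike.norm_conj, Complex.norm_real, Complex.norm_real,
      Real.norm_of_nonneg (by positivity), Real.norm_of_nonneg (by positivity),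
      div_le_iff₀ (by positivity)]
    have : ‖w‖ ^ 2 * (2 * ‖w‖ ^ 2 + 1) ≤ 3 * ‖w‖ ^ 4 := by
      have : 1 ≤ ‖w‖ ^ 2 := one_le_pow₀ hw.le
      nlinarith
    calc _ ≤ _ := this
      _ = _ := by field_simp
  · rw [truncDiff, Set.indicator_of_notMem (by simpa using hw), zero_sub, norm_neg, hd, norm_div,
      norm_pow, norm_pow, RCLike.norm_conj, Complex.norm_real, Real.norm_of_nonneg hpos.le]
    push Not at hw
    rw [← mul_div_assoc, mul_one]
    gcongr
    nlinarith [norm_nonneg w]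

lemma measurableSet_one_lt_norm (r : ℝ) : MeasurableSet {w : ℂ | r < ‖w‖} :=
  measurableSet_lt measurable_const measurable_norm

lemma integrable_truncDiff : Integrable truncDiff := by
  refine (integrable_and_integral_poissonKernel.1.const_mul 3).mono' ?_
    (ae_of_all _ norm_truncDiff_le)
  refine Measurable.aestronglyMeasurable ?_
  refine Measurable.sub (Measurable.indicator ?_ (measurableSet_one_lt_norm 1)) ?_
  · fun_prop
  · have : Measurable fun w : ℂ => conj w := Complex.continuous_conj.measurable
    fun_prop

/-- Rotation by a right angle preserves Lebesgue measure and changes the sign of the integrand, as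
it does for `1 / w²`. -/
lemma integral_truncDiff : ∫ w, truncDiff w = 0 := by
  set R : ℂ ≃ₗᵢ[ℝ] ℂ := rotation ⟨Complex.I, by simp [Submonoid.unitSphere]⟩ with hR
  have h := R.measurePreserving.integral_comp' (f := R.toMeasurableEquiv) truncDiff
  have e : ∀ w, truncDiff (R w) = -truncDiff w := fun w => by
    have hRw : R w = Complex.I * w := rfl
    have hI : Complex.I * w * (-Complex.I * conj w) = w * conj w := by
      linear_combination (-w * conj w) * Complex.I_sq
    have hn : ‖Complex.I * w‖ = ‖w‖ := by simp
    simp only [truncDiff, hRw, map_mul, Complex.conj_I, hI]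
    by_cases hw : 1 < ‖w‖
    · rw [Set.indicator_of_mem (show Complex.I * w ∈ {w : ℂ | 1 < ‖w‖} by simpa using hw),
        Set.indicator_of_mem (show w ∈ {w : ℂ | 1 < ‖w‖} from hw), mul_pow, mul_pow, neg_sq,
        Complex.I_sq]
      ring
    · rw [Set.indicator_of_notMem (show Complex.I * w ∉ {w : ℂ | 1 < ‖w‖} by simpa using hw),
        Set.indicator_of_notMem (show w ∉ {w : ℂ | 1 < ‖w‖} from hw), mul_pow, neg_sq,
        Complex.I_sq]
      ring
  have h' : ∫ w, truncDiff (R w) = ∫ w, truncDiff w := h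
  simp only [e, integral_neg] at h'
  exact self_eq_neg.1 h'.symm

/-- The sharp truncation differs from a smooth one by a rescaled integrable kernel of mean zero,
hence negligibly. The smooth one is minus half the `∂_x - i ∂_y` derivative of the regularised `1 /
w`, so integration by parts moves the derivative onto `f`. -/
lemma tendsto_beurlingTrunc {f : ℂ → ℂ} (hf : ContDiff ℝ ∞ f) (hc : HasCompactSupport f) (z : ℂ) :
    Tendsto (fun ε : ℝ => beurlingTrunc f ε z) (𝓝[>] 0) (𝓝 (cauchyTransform (dzF f) z)) := by
  set u : ℂ → ℂ := fun w => f (z - w) with hu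
  have hus : ContDiff ℝ ∞ u := hf.comp (contDiff_const.sub contDiff_id)
  have hus1 : ContDiff ℝ 1 u := hus.of_le (by simp)
  have huc : HasCompactSupport u := hc.comp_homeomorph (Homeomorph.subLeft z)
  obtain ⟨K, hK⟩ := huc.exists_bound_of_continuous hus.continuous
  have h1 := tendsto_integral_regInv (contDiff_dzF hus).continuous (hasCompactSupport_dzF huc)
  have h2 := tendsto_integral_rescale hus.continuous hK integrable_truncDiff
  rw [integral_truncDiff, mul_zero] at h2
  have e : ∀ w, dzF u w = -dzF f (z - w) := fun w => by
    simp only [dzF, hu]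
    rw [fderiv_comp_const_sub (hf.differentiable (by simp))]
    simp [dz]; ring
  have h3 := (h2.add (h1.const_mul (1 / 2))).const_mul (-(1 / (Real.pi : ℂ)))
  have e3 : -(1 / (Real.pi : ℂ)) * (0 + 1 / 2 * ∫ w, dzF u w / w) =
      cauchyTransform (dzF f) z := by
    simp only [e, neg_div, integral_neg, cauchyTransform]
    ring
  rw [e3] at h3
  refine h3.congr' ?_
  filter_upwards [self_mem_nhdsWithin] with ε hε
  have hε0 : (0 : ℝ) < ε := hε
  have hεc : (ε : ℂ) ≠ 0 := by exact_mod_cast hε0.ne'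
  have hn := regInv_denom_ne hε0
  rw [beurlingTrunc]
  congr 1
  have i1 : Integrable ({w : ℂ | ε < ‖w‖}.indicator fun w => u w / w ^ 2) := by
    refine Integrable.mono' (g := fun w => (ε ^ 2)⁻¹ * ‖u w‖)
      ((hus.continuous.integrable_of_hasCompactSupport huc).norm.const_mul _) ?_
      (ae_of_all _ fun w => ?_)
    · refine (Measurable.indicator ?_ (measurableSet_one_lt_norm ε)).aestronglyMeasurable
      exact hus.continuous.measurable.div (by fun_prop)
    · by_cases hw : w ∈ {w : ℂ | ε < ‖w‖}
      · rw [Set.indicator_of_mem hw, norm_div, norm_pow, div_eq_inv_mul]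
        have : ε < ‖w‖ := hw
        gcongr
      · rw [Set.indicator_of_notMem hw, norm_zero]; positivity
  have ck : Continuous fun w : ℂ => conj w ^ 2 / (w * conj w + (ε : ℂ) ^ 2) ^ 2 := by
    refine Continuous.div ?_ ?_ fun w => pow_ne_zero 2 (hn w)
    · exact Complex.continuous_conj.pow 2
    · exact ((continuous_id.mul Complex.continuous_conj).add continuous_const).pow 2
  have i2 : Integrable fun w => u w * (conj w ^ 2 / (w * conj w + (ε : ℂ) ^ 2) ^ 2) :=
    (hus.continuous.mul ck).integrable_of_hasCompactSupport huc.mul_right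
  have hp := integral_mul_dzF hus1 huc (contDiff_regInv hε0)
  have e4 : ∫ w, dzF u w * regInv ε w =
      2 * ∫ w, u w * (conj w ^ 2 / (w * conj w + (ε : ℂ) ^ 2) ^ 2) := by
    rw [← neg_eq_iff_eq_neg.2 hp, ← integral_neg, ← integral_const_mul]
    refine integral_congr_ae (ae_of_all _ fun w => ?_)
    simp only [dzF_regInv hε0]
    ring
  have e5 : ∀ w, u w * (((ε : ℂ) ^ 2)⁻¹ * truncDiff (ε⁻¹ • w)) =
      {w : ℂ | ε < ‖w‖}.indicator (fun w => u w / w ^ 2) w -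
        u w * (conj w ^ 2 / (w * conj w + (ε : ℂ) ^ 2) ^ 2) := fun w => by
    have hiff : ε⁻¹ • w ∈ {w : ℂ | 1 < ‖w‖} ↔ w ∈ {w : ℂ | ε < ‖w‖} := by
      simp only [Set.mem_ofPred_eq, norm_smul, norm_inv, Real.norm_of_nonneg hε0.le]
      rw [← div_eq_inv_mul, one_lt_div hε0]
    have ed : (ε : ℂ)⁻¹ * w * ((ε : ℂ)⁻¹ * conj w) + 1 =
        (w * conj w + (ε : ℂ) ^ 2) / (ε : ℂ) ^ 2 := by field_simp
    have hw' := hn w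
    by_cases hw : w ∈ {w : ℂ | ε < ‖w‖}
    · have hwn : w ≠ 0 := norm_pos_iff.1 (hε0.trans hw)
      rw [truncDiff, Set.indicator_of_mem hw, Set.indicator_of_mem (hiff.2 hw)]
      simp only [Complex.real_smul, map_mul, map_inv₀, Complex.conj_ofReal, Complex.ofReal_inv]
      rw [ed]
      field_simp
    · rw [truncDiff, Set.indicator_of_notMem hw, Set.indicator_of_notMem (mt hiff.1 hw)]
      simp only [Complex.real_smul, map_mul, map_inv₀, Complex.conj_ofReal, Complex.ofReal_inv]
      rw [ed]
      field_simp
      ring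
  simp only [e5]
  rw [integral_sub i1 i2, e4, integral_indicator (measurableSet_one_lt_norm ε)]
  have e6 : ∫ w in {w : ℂ | ε < ‖w‖}, u w / w ^ 2 =
      ∫ w in {w : ℂ | ε < ‖w - z‖}, f w / (z - w) ^ 2 := by
    rw [← integral_indicator (measurableSet_one_lt_norm ε),
      ← integral_indicator (measurableSet_lt measurable_const (by fun_prop)),
      ← integral_sub_left_eq_self _ volume z]
    refine integral_congr_ae (ae_of_all _ fun w => ?_)
    simp only [Set.indicator, Set.mem_ofPred_eq, hu]
    simp [norm_sub_rev z w]
  rw [e6]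
  ring

end CauchyFormula

/-! ### Weighted Taylor estimates and the short-time heat expansion. -/

section TaylorEstimates

set_option maxSynthPendingDepth 3

variable {V : Type*} [NormedAddCommGroup V] [NormedSpace ℝ V]

lemma two_le_infty : (2 : WithTop ℕ∞) ≤ ∞ := WithTop.coe_le_coe.2 (le_top : (2 : ℕ∞) ≤ ⊤)

lemma three_le_infty : (3 : WithTop ℕ∞) ≤ ∞ := WithTop.coe_le_coe.2 (le_top : (3 : ℕ∞) ≤ ⊤)

lemma decay_le_of_mem_closedBall {x y h : ℂ} (hy : y ∈ Metric.closedBall x ‖h‖) :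
    decay y ≤ (1 + ‖h‖) ^ 3 * decay x := by
  have h1 := decay_add_le x (y - x)
  rw [add_sub_cancel] at h1
  rw [mem_closedBall_iff_norm] at hy
  have := decay_pos x
  exact h1.trans (by gcongr)

lemma norm_taylor_zero_le {g : ℂ → V} (hg : Differentiable ℝ g) {K : ℝ}
    (hK : ∀ x, ‖fderiv ℝ g x‖ ≤ K * decay x) (hK0 : 0 ≤ K) (x h : ℂ) :
    ‖g (x + h) - g x‖ ≤ K * ((1 + ‖h‖) ^ 3 * decay x) * ‖h‖ := by
  have := (convex_closedBall x ‖h‖).norm_image_sub_le_of_norm_fderiv_le (𝕜 := ℝ) (f := g)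
    (C := K * ((1 + ‖h‖) ^ 3 * decay x)) (fun y _ => hg y)
    (fun y hy => (hK y).trans (mul_le_mul_of_nonneg_left (decay_le_of_mem_closedBall hy) hK0))
    (Metric.mem_closedBall_self (norm_nonneg h)) (y := x + h) (by simp)
  simpa using this

lemma norm_taylor_one_le {g : ℂ → V} (hg : ContDiff ℝ 2 g) {K : ℝ}
    (hK : ∀ x, ‖fderiv ℝ (fderiv ℝ g) x‖ ≤ K * decay x) (hK0 : 0 ≤ K) (x h : ℂ) :
    ‖g (x + h) - g x - fderiv ℝ g x h‖ ≤ K * ((1 + ‖h‖) ^ 3 * decay x) * ‖h‖ ^ 2 := by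
  have hd : Differentiable ℝ (fderiv ℝ g) :=
    (hg.fderiv_right (m := 1) (by norm_num)).differentiable one_ne_zero
  have := (convex_closedBall x ‖h‖).norm_image_sub_le_of_norm_fderiv_le' (𝕜 := ℝ) (f := g)
    (C := K * ((1 + ‖h‖) ^ 3 * decay x) * ‖h‖) (φ := fderiv ℝ g x)
    (fun y _ => hg.differentiable two_ne_zero y)
    (fun y hy => by
      have h1 := norm_taylor_zero_le hd hK hK0 x (y - x)
      rw [add_sub_cancel] at h1
      rw [mem_closedBall_iff_norm] at hy
      have := decay_pos x
      exact h1.trans (by gcongr))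
    (Metric.mem_closedBall_self (norm_nonneg h)) (y := x + h) (by simp)
  rw [add_sub_cancel_left] at this
  exact this.trans (le_of_eq (by ring))

lemma norm_taylor_two_le {g : ℂ → V} (hg : ContDiff ℝ 3 g) {K : ℝ}
    (hK : ∀ x, ‖fderiv ℝ (fderiv ℝ (fderiv ℝ g)) x‖ ≤ K * decay x) (hK0 : 0 ≤ K) (x h : ℂ) :
    ‖g (x + h) - g x - fderiv ℝ g x h - (1 / 2 : ℝ) • fderiv ℝ (fderiv ℝ g) x h h‖ ≤
      K * ((1 + ‖h‖) ^ 3 * decay x) * ‖h‖ ^ 3 := by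
  have hg' : ContDiff ℝ 2 (fderiv ℝ g) := hg.fderiv_right (by norm_num)
  have hs : ∀ v w, fderiv ℝ (fderiv ℝ g) x v w = fderiv ℝ (fderiv ℝ g) x w v :=
    (hg.contDiffAt (x := x)).isSymmSndFDerivAt (by simp; norm_num)
  set B := fderiv ℝ (fderiv ℝ g) x with hB
  -- Subtracting the quadratic term leaves a function whose derivative is controlled by the
  -- first-order estimate for `fderiv ℝ g`; symmetry of the second derivative makes the factor `1 /
  -- 2` correct.
  have hder : ∀ y, HasFDerivAt (fun y => g y - (1 / 2 : ℝ) • B (y - x) (y - x))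
      (fderiv ℝ g y - B (y - x)) y := fun y => by
    have h1 := (hg.differentiable (by norm_num) y).hasFDerivAt
    have h2 : HasFDerivAt (fun y => y - x) (ContinuousLinearMap.id ℝ ℂ) y :=
      (hasFDerivAt_id y).sub_const x
    have h3 := (B.hasFDerivAt (x := y - x)).comp y h2
    have h4 := (h3.clm_apply h2).const_smul (1 / 2 : ℝ)
    refine (h1.sub h4).congr_fderiv ?_
    ext v
    simp [-map_sub, hs v (y - x)]
    ring_nf
    module
  have := (convex_closedBall x ‖h‖).norm_image_sub_le_of_norm_hasFDerivWithin_le' (𝕜 := ℝ)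
    (C := K * ((1 + ‖h‖) ^ 3 * decay x) * ‖h‖ ^ 2) (φ := fderiv ℝ g x)
    (fun y _ => (hder y).hasFDerivWithinAt)
    (fun y hy => by
      have h1 := norm_taylor_one_le hg' hK hK0 x (y - x)
      rw [add_sub_cancel] at h1
      rw [mem_closedBall_iff_norm] at hy
      have := decay_pos x
      rw [sub_right_comm]
      exact h1.trans (by gcongr))
    (Metric.mem_closedBall_self (norm_nonneg h)) (y := x + h) (by simp)
  simp only [add_sub_cancel_left, sub_self, map_zero, smul_zero, sub_zero] at this
  refine le_trans (le_of_eq ?_) (this.trans (le_of_eq (by ring)))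
  congr 1
  abel

lemma exists_tame {F : ℂ → V} (hF : ContDiff ℝ ∞ F) (hc : HasCompactSupport F) :
    ∃ K, Tame K F (fderiv ℝ F) := by
  have h1 : ContDiff ℝ ∞ (fderiv ℝ F) := hF.fderiv_right (m := ∞) le_rfl
  have h2 : ContDiff ℝ ∞ (fderiv ℝ (fderiv ℝ F)) := h1.fderiv_right (m := ∞) le_rfl
  obtain ⟨K₀, p0, b0⟩ := exists_decay_bound hF.continuous hc
  obtain ⟨K₁, p1, b1⟩ := exists_decay_bound h1.continuous (hc.fderiv (𝕜 := ℝ))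
  obtain ⟨K₂, p2, b2⟩ := exists_decay_bound h2.continuous ((hc.fderiv (𝕜 := ℝ)).fderiv (𝕜 := ℝ))
  have hd := fun x => (decay_pos x).le
  refine ⟨K₀ + K₁ + K₂, by positivity, hF.continuous, h1.continuous,
    fun x => (b0 x).trans (mul_le_mul_of_nonneg_right (by linarith) (hd x)),
    fun x => (b1 x).trans (mul_le_mul_of_nonneg_right (by linarith) (hd x)), fun x h => ?_⟩
  refine (norm_taylor_one_le (hF.of_le two_le_infty) b2 p2 x h).trans ?_
  have := hd x
  calc K₂ * ((1 + ‖h‖) ^ 3 * decay x) * ‖h‖ ^ 2 = K₂ * (‖h‖ ^ 2 * (1 + ‖h‖) ^ 3) * decay x :=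
      by ring
    _ ≤ _ := by gcongr; linarith

lemma dzbF_dzF {g : ℂ → ℂ} (hg : ContDiff ℝ ∞ g) (x : ℂ) :
    dzbF (dzF g) x = fderiv ℝ (fderiv ℝ g) x 1 1 +
      fderiv ℝ (fderiv ℝ g) x Complex.I Complex.I := by
  have hs : ∀ v w, fderiv ℝ (fderiv ℝ g) x v w = fderiv ℝ (fderiv ℝ g) x w v :=
    (hg.contDiffAt (x := x)).isSymmSndFDerivAt
      (by simpa using two_le_infty)
  have h1 : ContDiff ℝ ∞ (fderiv ℝ g) := hg.fderiv_right (m := ∞) le_rfl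
  have h2 := (h1.differentiable (by simp) x).hasFDerivAt
  have h3 : HasFDerivAt (dzF g) _ x := (h2.clm_apply (hasFDerivAt_const (1 : ℂ) x)).sub
    ((h2.clm_apply (hasFDerivAt_const Complex.I x)).const_mul Complex.I)
  rw [dzbF, h3.fderiv]
  simp [hs 1 Complex.I]
  linear_combination (-(fderiv ℝ (fderiv ℝ g) x Complex.I Complex.I)) * Complex.I_sq

/-- Taylor's formula is averaged over the Gaussian: the odd and mixed terms vanish and the diagonal
ones give `(t / 2) Δg`. The weight in the error is what allows the Cauchy transform to be applied to
it afterwards. -/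
lemma exists_heat_expansion {g : ℂ → ℂ} (hg : ContDiff ℝ ∞ g) (hc : HasCompactSupport g) :
    ∃ K, 0 ≤ K ∧ ∀ t, 0 ≤ t → t ≤ 1 → ∀ x,
      ‖heat t g x - g x - (t / 2 : ℝ) * dzbF (dzF g) x‖ ≤ K * √t ^ 3 * decay x := by
  have h1 : ContDiff ℝ ∞ (fderiv ℝ g) := hg.fderiv_right (m := ∞) le_rfl
  have h2 : ContDiff ℝ ∞ (fderiv ℝ (fderiv ℝ g)) := h1.fderiv_right (m := ∞) le_rfl
  have h3 : ContDiff ℝ ∞ (fderiv ℝ (fderiv ℝ (fderiv ℝ g))) := h2.fderiv_right (m := ∞) le_rfl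
  obtain ⟨K, p0, hK⟩ := exists_decay_bound h3.continuous
    (((hc.fderiv (𝕜 := ℝ)).fderiv (𝕜 := ℝ)).fderiv (𝕜 := ℝ))
  obtain ⟨M, hM⟩ := hc.exists_bound_of_continuous hg.continuous
  refine ⟨K * momentConst, mul_nonneg p0 momentConst_nonneg, fun t ht0 ht1 x => ?_⟩
  set γ := heatMeasure t with hγ
  set B := fderiv ℝ (fderiv ℝ g) x with hB
  have cg := hg.continuous
  have i0 : Integrable (fun η => g (x + η)) γ :=
    integrable_heatMeasure_of_bounded (by fun_prop) (fun _ => hM _) t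
  have i1 : Integrable (fun η => fderiv ℝ g x η) γ := by
    refine ((integrable_norm_pow_heatMeasure t 1).const_mul ‖fderiv ℝ g x‖).mono' (by fun_prop)
      (ae_of_all _ fun η => ?_)
    rw [pow_one]
    exact (fderiv ℝ g x).le_opNorm η
  have ire : Integrable (fun η : ℂ => η.re ^ 2) γ :=
    (integrable_norm_pow_heatMeasure t 2).mono' (by fun_prop) (ae_of_all _ fun η => by
      rw [norm_pow, Real.norm_eq_abs]
      exact pow_le_pow_left₀ (abs_nonneg _) (Complex.abs_re_le_norm η) 2)
  have iim : Integrable (fun η : ℂ => η.im ^ 2) γ :=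
    (integrable_norm_pow_heatMeasure t 2).mono' (by fun_prop) (ae_of_all _ fun η => by
      rw [norm_pow, Real.norm_eq_abs]
      exact pow_le_pow_left₀ (abs_nonneg _) (Complex.abs_im_le_norm η) 2)
  have irm : Integrable (fun η : ℂ => η.re * η.im) γ :=
    (integrable_norm_pow_heatMeasure t 2).mono' (by fun_prop) (ae_of_all _ fun η => by
      rw [norm_mul, Real.norm_eq_abs, Real.norm_eq_abs, sq]
      exact mul_le_mul (Complex.abs_re_le_norm η) (Complex.abs_im_le_norm η) (abs_nonneg _)
        (norm_nonneg _))
  have eB : ∀ η : ℂ, (1 / 2 : ℝ) • B η η = η.re ^ 2 • ((1 / 2 : ℝ) • B 1 1) +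
      (η.re * η.im) • ((1 / 2 : ℝ) • (B 1 Complex.I + B Complex.I 1)) +
      η.im ^ 2 • ((1 / 2 : ℝ) • B Complex.I Complex.I) := fun η => by
    have : η = η.re • (1 : ℂ) + η.im • Complex.I := by apply Complex.ext <;> simp
    conv_lhs => rw [this]
    simp only [map_add, map_smul, _root_.add_apply, _root_.smul_apply]
    module
  have j1 := ire.smul_const ((1 / 2 : ℝ) • B 1 1)
  have j2 := irm.smul_const ((1 / 2 : ℝ) • (B 1 Complex.I + B Complex.I 1))
  have j3 := iim.smul_const ((1 / 2 : ℝ) • B Complex.I Complex.I)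
  have j12 : Integrable (fun η : ℂ => η.re ^ 2 • ((1 / 2 : ℝ) • B 1 1) +
      (η.re * η.im) • ((1 / 2 : ℝ) • (B 1 Complex.I + B Complex.I 1))) γ := j1.add j2
  have i2 : Integrable (fun η => (1 / 2 : ℝ) • B η η) γ :=
    (j12.add j3).congr (ae_of_all _ fun η => (eB η).symm)
  have e2 : ∫ η, (1 / 2 : ℝ) • B η η ∂γ = (t / 2 : ℝ) * dzbF (dzF g) x := by
    rw [integral_congr_ae (ae_of_all _ eB), integral_add j12 j3, integral_add j1 j2,
      integral_smul_const, integral_smul_const,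
      integral_smul_const, integral_re_sq_heatMeasure ht0, integral_im_sq_heatMeasure ht0,
      integral_re_mul_im_heatMeasure, dzbF_dzF hg, ← hB]
    generalize B 1 1 = a
    generalize B Complex.I Complex.I = b
    generalize B 1 Complex.I + B Complex.I 1 = c
    rw [zero_smul, add_zero, ← smul_add, ← smul_add, smul_smul, Complex.real_smul, mul_one_div]
  have ei : ∫ η, (g (x + η) - g x - fderiv ℝ g x η - (1 / 2 : ℝ) • B η η) ∂γ =
      heat t g x - g x - (t / 2 : ℝ) * dzbF (dzF g) x := by
    have k1 : Integrable (fun η => g (x + η) - g x) γ := i0.sub (integrable_const _)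
    have k2 : Integrable (fun η => g (x + η) - g x - fderiv ℝ g x η) γ := k1.sub i1
    rw [integral_sub k2 i2, integral_sub k1 i1, integral_sub i0 (integrable_const _), e2,
      integral_odd_heatMeasure]
    simp [heat, hγ]
  rw [← ei]
  have hd := decay_pos x
  refine (norm_integral_le_of_norm_le (g := fun η : ℂ => K * decay x *
    (‖η‖ ^ 3 * (1 + ‖η‖) ^ 7)) ((integrable_moment t).const_mul _)
        (ae_of_all _ fun η => ?_)).trans ?_
  · refine (norm_taylor_two_le (hg.of_le three_le_infty) hK p0 x η).trans ?_
    have : (1 + ‖η‖) ^ 3 ≤ (1 + ‖η‖) ^ 7 :=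
      pow_le_pow_right₀ (by linarith [norm_nonneg η]) (by norm_num)
    calc K * ((1 + ‖η‖) ^ 3 * decay x) * ‖η‖ ^ 3
        = K * decay x * (‖η‖ ^ 3 * (1 + ‖η‖) ^ 3) := by ring
      _ ≤ _ := by gcongr
  · rw [integral_const_mul]
    have := mul_le_mul_of_nonneg_left (integral_moment_le ht1) (mul_nonneg p0 hd.le)
    linarith

end TaylorEstimates

/-! ### Regularity and decay of the Cauchy transform; large-time heat flow. -/

section CauchyAtInfinity

lemma locallyIntegrable_inv : LocallyIntegrable (fun w : ℂ => w⁻¹) := by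
  have h1 : LocallyIntegrable (fun w : ℂ =>
      (Metric.ball (0 : ℂ) 1).indicator (fun w => ‖w‖⁻¹) w + 1) :=
    (((integrable_indicator_iff Metric.isOpen_ball.measurableSet).2
      integrableOn_inv_norm).locallyIntegrable).add (locallyIntegrable_const 1)
  refine h1.mono measurable_inv.aestronglyMeasurable (ae_of_all _ fun w => ?_)
  rw [norm_inv]
  by_cases hw : w ∈ Metric.ball (0 : ℂ) 1
  · rw [Set.indicator_of_mem hw, Real.norm_of_nonneg (by positivity)]
    linarith
  · rw [Set.indicator_of_notMem hw, zero_add, norm_one]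
    exact inv_le_one_of_one_le₀ (by simpa using hw)

lemma contDiff_cauchyTransform {g : ℂ → ℂ} (hg : ContDiff ℝ ∞ g) (hc : HasCompactSupport g) :
    ContDiff ℝ ∞ (cauchyTransform g) := by
  have h := hc.contDiff_convolution_right (n := ⊤) (ContinuousLinearMap.mul ℝ ℂ)
    (μ := volume) locallyIntegrable_inv hg
  have e : cauchyTransform g = fun x => (1 / (2 * (Real.pi : ℂ))) *
      (convolution (fun w : ℂ => w⁻¹) g (ContinuousLinearMap.mul ℝ ℂ) volume) x := by
    ext1 x
    rw [cauchyTransform, convolution]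
    congr 2
    ext1 w
    rw [ContinuousLinearMap.mul_apply', div_eq_inv_mul]
  rw [e]
  exact contDiff_const.mul h

lemma tendsto_cauchyTransform_cocompact {g : ℂ → ℂ} (hg : Continuous g)
    (hc : HasCompactSupport g) : Tendsto (cauchyTransform g) (cocompact ℂ) (𝓝 0) := by
  obtain ⟨R, hR0, hR⟩ := hc.isCompact.isBounded.subset_closedBall_lt 0 (0 : ℂ)
  have hi := hg.integrable_of_hasCompactSupport (μ := volume) hc
  have hz : ∀ y, R < ‖y‖ → g y = 0 := fun y hy => by
    by_contra hne
    have := hR (subset_tsupport g hne)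
    rw [mem_closedBall_zero_iff] at this
    linarith
  have hb : ∀ x : ℂ, 2 * R ≤ ‖x‖ → ‖∫ w, g (x - w) / w‖ ≤ (∫ w, ‖g w‖) * (2 * ‖x‖⁻¹) := by
    intro x hx
    have hx0 : 0 < ‖x‖ := by linarith
    rw [← integral_sub_left_eq_self (fun w => ‖g w‖) volume x, ← integral_mul_const]
    refine norm_integral_le_of_norm_le ((hi.comp_sub_left x).norm.mul_const _)
      (ae_of_all _ fun w => ?_)
    rw [norm_div, div_eq_mul_inv]
    by_cases hw : R < ‖x - w‖
    · simp [hz _ hw]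
    · have h1 : ‖x‖ / 2 ≤ ‖w‖ := by
        have := norm_sub_norm_le x w
        linarith
      have h2 : ‖w‖⁻¹ ≤ 2 * ‖x‖⁻¹ := by
        rw [show 2 * ‖x‖⁻¹ = (‖x‖ / 2)⁻¹ by rw [inv_div, div_eq_mul_inv]]
        gcongr
      gcongr
  have hl : Tendsto (fun x : ℂ => (∫ w, ‖g w‖) * (2 * ‖x‖⁻¹)) (cocompact ℂ) (𝓝 0) := by
    rw [show (0 : ℝ) = (∫ w, ‖g w‖) * (2 * 0) by simp]
    exact ((tendsto_inv_atTop_zero.comp (tendsto_norm_cocompact_atTop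
      (E := ℂ))).const_mul 2).const_mul _
  have h0 : Tendsto (fun x => ∫ w, g (x - w) / w) (cocompact ℂ) (𝓝 0) := by
    refine squeeze_zero_norm' ?_ hl
    filter_upwards [(tendsto_norm_cocompact_atTop (E := ℂ)).eventually_ge_atTop (2 * R)] with x hx
    exact hb x hx
  simpa only [cauchyTransform, mul_zero] using! h0.const_mul (1 / (2 * (Real.pi : ℂ)))

open ProbabilityTheory in
lemma ae_ne_zero_stdGaussian : ∀ᵐ ξ ∂stdGaussian ℂ, ξ ≠ 0 := by
  have : NullSingletonClass (stdGaussian ℂ) := by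
    refine IsGaussian.nullSingletonClass fun x hx => ?_
    have h := variance_dual_stdGaussian (E := ℂ) Complex.reCLM
    rw [Complex.reCLM_norm, hx, variance_dirac] at h
    norm_num at h
  rw [ae_iff]
  simp

open ProbabilityTheory in
-- The points `x + √T ξ` escape to infinity for every `ξ ≠ 0`, that is, almost surely; dominated
-- convergence does the rest.
lemma tendsto_heat_atTop {S : ℂ → ℂ} (hS : Continuous S) {K : ℝ} (hK : ∀ x, ‖S x‖ ≤ K)
    (h0 : Tendsto S (cocompact ℂ) (𝓝 0)) (x : ℂ) :
    Tendsto (fun T => heat T S x) atTop (𝓝 0) := by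
  have h : Tendsto (fun T : ℝ => ∫ ξ, S (x + √T • ξ) ∂stdGaussian ℂ) atTop
      (𝓝 (∫ _, 0 ∂stdGaussian ℂ)) := by
    refine tendsto_integral_filter_of_dominated_convergence (fun _ => K)
      (Eventually.of_forall fun T => (hS.comp (by fun_prop)).aestronglyMeasurable)
      (Eventually.of_forall fun T => ae_of_all _ fun ξ => hK _) (integrable_const K) ?_
    filter_upwards [ae_ne_zero_stdGaussian] with ξ hξ
    refine h0.comp ?_
    rw [← Metric.cobounded_eq_cocompact, ← tendsto_norm_atTop_iff_cobounded]
    have h1 : Tendsto (fun T : ℝ => √T * ‖ξ‖ - ‖x‖) atTop atTop :=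
      tendsto_atTop_add_const_right _ _
        (Real.tendsto_sqrt_atTop.atTop_mul_const (norm_pos_iff.2 hξ))
    refine tendsto_atTop_mono (fun T => ?_) h1
    have := norm_sub_le (x + √T • ξ) x
    rw [add_sub_cancel_left, norm_smul, Real.norm_of_nonneg (Real.sqrt_nonneg T)] at this
    linarith
  rw [integral_zero] at h
  refine h.congr fun T => ?_
  exact (integral_heatMeasure (u := fun η => S (x + η)) (by fun_prop)).symm

end CauchyAtInfinity

/-! ### The heat flow of a Cauchy transform as a sum over time steps. -/

section CauchyHeat

lemma cauchyTransform_sub_sub_mul {a b c : ℂ → ℂ} (ha : Continuous a) (hb : Continuous b)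
    (hc : Continuous c) {K : ℝ} (hKa : ∀ x, ‖a x‖ ≤ K * decay x) (hKb : ∀ x, ‖b x‖ ≤ K * decay x)
    (hKc : ∀ x, ‖c x‖ ≤ K * decay x) (r x : ℂ) :
    cauchyTransform (fun y => a y - b y - r * c y) x =
      cauchyTransform a x - cauchyTransform b x - r * cauchyTransform c x := by
  have i1 := integrable_div_of_decay ha hKa x
  have i2 := integrable_div_of_decay hb hKb x
  have i3 := integrable_div_of_decay hc hKc x
  simp only [cauchyTransform]
  have e : ∀ w, (a (x - w) - b (x - w) - r * c (x - w)) / w =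
      a (x - w) / w - b (x - w) / w - r * (c (x - w) / w) := fun w => by ring
  simp only [e]
  have i12 : Integrable fun w => a (x - w) / w - b (x - w) / w := i1.sub i2
  rw [integral_sub i12 (i3.const_mul r), integral_sub i1 i2, integral_const_mul]
  ring

/-- A Cauchy transform need not have compact support, so the expansion is proved for `g` and then
transformed. The Laplacian term becomes `dzF g`, because the Cauchy transform inverts `dzbF`. -/
lemma exists_heat_cauchyTransform_expansion {g : ℂ → ℂ} (hg : ContDiff ℝ ∞ g)
    (hc : HasCompactSupport g) : ∃ K, 0 ≤ K ∧ ∀ t, 0 ≤ t → t ≤ 1 → ∀ x,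
      ‖heat t (cauchyTransform g) x - cauchyTransform g x - (t / 2 : ℝ) * dzF g x‖ ≤
        K * √t ^ 3 := by
  obtain ⟨K, hK0, hK⟩ := exists_heat_expansion hg hc
  have hdz := contDiff_dzF hg
  have hdzc := hasCompactSupport_dzF hc
  have hl := contDiff_dzbF hdz
  obtain ⟨M₁, m1, hM₁⟩ := exists_decay_bound hg.continuous hc
  obtain ⟨M₂, m2, hM₂⟩ := exists_decay_bound hl.continuous (hasCompactSupport_dzbF hdzc)
  have hcc : 0 ≤ cauchyConst := by
    rw [← integral_cauchyMajorant 0]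
    refine integral_nonneg fun w => add_nonneg (Set.indicator_nonneg (fun w _ => by positivity) w)
      (decay_pos _).le
  refine ⟨K * cauchyConst, mul_nonneg hK0 hcc, fun t ht0 ht1 x => ?_⟩
  have hd := fun x => (decay_pos x).le
  have hch : Continuous (heat t g) :=
    continuous_heat hg.continuous (fun y => (hM₁ y).trans (mul_decay_le m1 y)) t
  set M := M₁ * heatConst t + M₁ + M₂ with hM
  have hh := heatConst_nonneg t
  have e := cauchyTransform_sub_sub_mul hch hg.continuous hl.continuous (K := M)
    (fun y => (norm_heat_le_decay hM₁ le_rfl y).trans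
      (mul_le_mul_of_nonneg_right (by rw [hM]; linarith) (hd y)))
    (fun y => (hM₁ y).trans (mul_le_mul_of_nonneg_right
      (by rw [hM]; linarith [mul_nonneg m1 hh]) (hd y)))
    (fun y => (hM₂ y).trans (mul_le_mul_of_nonneg_right
      (by rw [hM]; linarith [mul_nonneg m1 hh]) (hd y))) ((t / 2 : ℝ) : ℂ) x
  rw [cauchyTransform_dzbF hdz hdzc] at e
  rw [heat_cauchyTransform hg.continuous hM₁, ← e]
  refine (norm_cauchyTransform_le (hK t ht0 ht1) x).trans (le_of_eq (by ring))

lemma heat_zero {V : Type*} [NormedAddCommGroup V] [NormedSpace ℝ V] [CompleteSpace V]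
    (u : ℂ → V) : heat 0 u = u := by
  have h0 : heatMeasure 0 = Measure.dirac 0 := by simp [heatMeasure]
  ext1 x
  simp [heat, h0]

lemma exists_heat_cauchyTransform_telescope {g : ℂ → ℂ} (hg : ContDiff ℝ ∞ g)
    (hc : HasCompactSupport g) : ∃ K, 0 ≤ K ∧ ∀ t, 0 ≤ t → t ≤ 1 → ∀ (N : ℕ) (x : ℂ),
      ‖heat (N * t) (cauchyTransform g) x - cauchyTransform g x -
        (t / 2 : ℝ) * ∑ k ∈ Finset.range N, heat (k * t) (dzF g) x‖ ≤ N * (K * √t ^ 3) := by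
  obtain ⟨K, hK0, hK⟩ := exists_heat_cauchyTransform_expansion hg hc
  refine ⟨K, hK0, fun t ht0 ht1 N x => ?_⟩
  obtain ⟨M, -, hM⟩ := exists_decay_bound hg.continuous hc
  have cS := (contDiff_cauchyTransform hg hc).continuous
  have bS := norm_cauchyTransform_le hM
  have cd := (contDiff_dzF hg).continuous
  obtain ⟨M', hM'⟩ := (hasCompactSupport_dzF hc).exists_bound_of_continuous cd
  induction N with
  | zero => simp [heat_zero]
  | succ N ih =>
    have hs : (0 : ℝ) ≤ N * t := by positivity
    have h1 := norm_heat_le (hK t ht0 ht1) (N * t) x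
    have cH := continuous_heat cS bS t
    have bH := norm_heat_le bS t
    have i1 : Integrable (fun η => heat t (cauchyTransform g) (x + η)) (heatMeasure (N * t)) :=
      integrable_heatMeasure_of_bounded (by fun_prop) (fun _ => bH _) _
    have i2 : Integrable (fun η => cauchyTransform g (x + η)) (heatMeasure (N * t)) :=
      integrable_heatMeasure_of_bounded (by fun_prop) (fun _ => bS _) _
    have i3 : Integrable (fun η => dzF g (x + η)) (heatMeasure (N * t)) :=
      integrable_heatMeasure_of_bounded (by fun_prop) (fun _ => hM' _) _
    have i12 : Integrable (fun η => heat t (cauchyTransform g) (x + η) -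
      cauchyTransform g (x + η)) (heatMeasure (N * t)) := i1.sub i2
    have e : heat (N * t) (fun x => heat t (cauchyTransform g) x - cauchyTransform g x -
        (t / 2 : ℝ) * dzF g x) x = heat ((N + 1 : ℕ) * t) (cauchyTransform g) x -
          heat (N * t) (cauchyTransform g) x - (t / 2 : ℝ) * heat (N * t) (dzF g) x := by
      have e1 : heat (N * t) (heat t (cauchyTransform g)) x =
          heat ((N + 1 : ℕ) * t) (cauchyTransform g) x := by
        rw [heat_heat cS bS hs ht0]
        congr 1
        push_cast
        ring
      rw [← e1]
      rw [heat, integral_sub i12 (i3.const_mul _), integral_sub i1 i2, integral_const_mul]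
      rfl
    rw [e] at h1
    rw [Finset.sum_range_succ]
    refine le_trans (le_of_eq ?_) ((norm_add_le_of_le ih h1).trans (le_of_eq ?_))
    · congr 1; ring
    · push_cast; ring

end CauchyHeat

/-! ### Summing the heat pairings in time. -/

section HeatPairing

lemma integral_heat_mul {u v : ℂ → ℂ} (hu : Continuous u) {K : ℝ} (hK : ∀ x, ‖u x‖ ≤ K)
    (hv : Continuous v) (hvi : Integrable v) (t : ℝ) :
    ∫ x, heat t u x * v x = ∫ x, u x * heat t v x := by
  have hi1 : Integrable (fun z : ℂ × ℂ => u (z.1 + z.2) * v z.1)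
      (volume.prod (heatMeasure t)) := by
    have h1 : Integrable (fun z : ℂ × ℂ => v z.1) (volume.prod (heatMeasure t)) := hvi.comp_fst _
    exact h1.bdd_mul (c := K) (hu.comp (by fun_prop)).aestronglyMeasurable
      (ae_of_all _ fun z => hK _)
  have hi2 : Integrable (fun z : ℂ × ℂ => u z.1 * v (z.1 + z.2))
      (volume.prod (heatMeasure t)) :=
    (integrable_shift_prod hv hvi).bdd_mul (c := K) (hu.comp (by fun_prop)).aestronglyMeasurable
      (ae_of_all _ fun z => hK _)
  calc ∫ x, heat t u x * v x = ∫ x, ∫ η, u (x + η) * v x ∂heatMeasure t := by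
        simp only [heat, integral_mul_const]
    _ = ∫ η, (∫ x, u (x + η) * v x) ∂heatMeasure t := integral_integral_swap hi1
    _ = ∫ η, (∫ x, u x * v (x + -η)) ∂heatMeasure t := by
        refine integral_congr_ae (ae_of_all _ fun η => ?_)
        have := integral_add_right_eq_self (μ := volume) (fun x => u x * v (x + -η)) η
        simpa using this
    _ = ∫ η, (∫ x, u x * v (x + η)) ∂heatMeasure t :=
        integral_neg_heatMeasure t (fun η => ∫ x, u x * v (x + η))
    _ = ∫ x, ∫ η, u x * v (x + η) ∂heatMeasure t := (integral_integral_swap hi2).symm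
    _ = ∫ x, u x * heat t v x := by simp only [heat, integral_const_mul]

lemma integral_heat_mul_dzF {u v : ℂ → ℂ} (hu : ContDiff ℝ ∞ u) (huc : HasCompactSupport u)
    (hv : ContDiff ℝ ∞ v) (hvc : HasCompactSupport v) (t : ℝ) :
    ∫ x, heat t u x * dzF v x = -∫ x, heat t (dzF u) x * v x := by
  have cu := hu.continuous
  have cdu := (contDiff_dzF hu).continuous
  have cv := hv.continuous
  have cdv := (contDiff_dzF hv).continuous
  obtain ⟨K, hK⟩ := huc.exists_bound_of_continuous cu
  obtain ⟨K', hK'⟩ := (hasCompactSupport_dzF huc).exists_bound_of_continuous cdu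
  have hi : ∀ {a b : ℂ → ℂ} {M : ℝ}, Continuous a → (∀ x, ‖a x‖ ≤ M) → Continuous b →
      HasCompactSupport b → Integrable (fun z : ℂ × ℂ => a (z.1 + z.2) * b z.1)
        (volume.prod (heatMeasure t)) := fun {a b M} ha hM hb hbc => by
    have h1 : Integrable (fun z : ℂ × ℂ => b z.1) (volume.prod (heatMeasure t)) :=
      (hb.integrable_of_hasCompactSupport hbc).comp_fst _
    exact h1.bdd_mul (c := M) (ha.comp (by fun_prop)).aestronglyMeasurable
      (ae_of_all _ fun z => hM _)
  have hi1 := hi cu hK cdv (hasCompactSupport_dzF hvc)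
  have hi2 := hi cdu hK' cv hvc
  calc ∫ x, heat t u x * dzF v x = ∫ x, ∫ η, u (x + η) * dzF v x ∂heatMeasure t := by
        simp only [heat, integral_mul_const]
    _ = ∫ η, (∫ x, u (x + η) * dzF v x) ∂heatMeasure t := integral_integral_swap hi1
    _ = ∫ η, (-∫ x, dzF u (x + η) * v x) ∂heatMeasure t := by
        refine integral_congr_ae (ae_of_all _ fun η => ?_)
        have h1 : ContDiff ℝ ∞ (fun x => u (x + η)) := hu.comp (contDiff_id.add contDiff_const)
        have := integral_mul_dzF (h1.of_le (by simp))
          (huc.comp_homeomorph (Homeomorph.addRight η)) (hv.of_le (by simp))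
        simp only [dzF] at this ⊢
        simpa only [fderiv_comp_add_right] using this
    _ = -∫ x, ∫ η, dzF u (x + η) * v x ∂heatMeasure t := by
        rw [integral_neg, ← integral_integral_swap hi2]
    _ = -∫ x, heat t (dzF u) x * v x := by simp only [heat, integral_mul_const]

lemma integral_heat_dzF_mul_heat_dzF {u v : ℂ → ℂ} (hu : ContDiff ℝ ∞ u)
    (huc : HasCompactSupport u) (hv : ContDiff ℝ ∞ v) (hvc : HasCompactSupport v) {t : ℝ}
    (ht : 0 ≤ t) : ∫ x, heat t (dzF u) x * heat t (dzF v) x =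
      -∫ x, heat (2 * t) (dzF (dzF u)) x * v x := by
  have hdu := contDiff_dzF hu
  have hduc := hasCompactSupport_dzF huc
  have cdv := (contDiff_dzF hv).continuous
  obtain ⟨K, hK⟩ := hduc.exists_bound_of_continuous hdu.continuous
  rw [← integral_heat_mul (continuous_heat hdu.continuous hK t) (norm_heat_le hK t) cdv
    (cdv.integrable_of_hasCompactSupport (hasCompactSupport_dzF hvc)),
    heat_heat hdu.continuous hK ht ht, ← two_mul, integral_heat_mul_dzF hdu hduc hv hvc]

lemma integrable_heat_mul_heat {u v : ℂ → ℂ} (hu : Continuous u) (huc : HasCompactSupport u)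
    (hv : Continuous v) (hvc : HasCompactSupport v) (t : ℝ) :
    Integrable (fun x => heat t u x * heat t v x) := by
  obtain ⟨K, hK⟩ := huc.exists_bound_of_continuous hu
  exact (integrable_heat hv (hv.integrable_of_hasCompactSupport hvc)).bdd_mul (c := K)
    (continuous_heat hu hK t).aestronglyMeasurable (ae_of_all _ (norm_heat_le hK t))

/-- Moving one semigroup factor and one derivative across gives `-∫ P_{2t}(dzF (dzF u)) v`. Since
`dzF (dzF u)` is the Laplacian of `cauchyTransform (dzF u)`, the sum telescopes with time step `2
δ`. -/
lemma exists_heat_pairing_telescope {u v : ℂ → ℂ} (hu : ContDiff ℝ ∞ u)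
    (huc : HasCompactSupport u) (hv : ContDiff ℝ ∞ v) (hvc : HasCompactSupport v) :
    ∃ K, 0 ≤ K ∧ ∀ δ : ℝ, 0 ≤ δ → 2 * δ ≤ 1 → ∀ N : ℕ,
      ‖(δ : ℂ) * (∑ k ∈ Finset.range N, ∫ x, heat (k * δ) (dzF u) x * heat (k * δ) (dzF v) x) -
        ∫ x, (cauchyTransform (dzF u) x - heat (N * (2 * δ)) (cauchyTransform (dzF u)) x) * v x‖ ≤
      N * √(2 * δ) ^ 3 * K := by
  have hg := contDiff_dzF hu
  have hgc := hasCompactSupport_dzF huc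
  have hgg := contDiff_dzF hg
  have cv := hv.continuous
  have iv := cv.integrable_of_hasCompactSupport (μ := volume) hvc
  obtain ⟨K, hK0, hK⟩ := exists_heat_cauchyTransform_telescope hg hgc
  obtain ⟨M, -, hM⟩ := exists_decay_bound hg.continuous hgc
  have cS := (contDiff_cauchyTransform hg hgc).continuous
  have bS := norm_cauchyTransform_le hM
  obtain ⟨M', hM'⟩ := (hasCompactSupport_dzF hgc).exists_bound_of_continuous hgg.continuous
  refine ⟨K * ∫ x, ‖v x‖, mul_nonneg hK0 (integral_nonneg fun _ => norm_nonneg _),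
    fun δ hδ0 hδ1 N => ?_⟩
  have ik : ∀ t : ℝ, Integrable (fun x => heat t (dzF (dzF u)) x * v x) := fun t =>
    iv.bdd_mul (c := M') (continuous_heat hgg.continuous hM' t).aestronglyMeasurable
      (ae_of_all _ (norm_heat_le hM' t))
  set S := cauchyTransform (dzF u) with hS
  have iS : Integrable (fun x => (S x - heat (N * (2 * δ)) S x) * v x) := by
    refine iv.bdd_mul (c := M * cauchyConst + M * cauchyConst)
      (cS.sub (continuous_heat cS bS _)).aestronglyMeasurable (ae_of_all _ fun x => ?_)
    exact norm_sub_le_of_le (bS x) (norm_heat_le bS _ x)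
  have e : (δ : ℂ) * ∑ k ∈ Finset.range N, ∫ x, heat (k * δ) (dzF u) x * heat (k * δ) (dzF v) x =
      -∫ x, (δ : ℂ) * ∑ k ∈ Finset.range N, heat (k * (2 * δ)) (dzF (dzF u)) x * v x := by
    rw [integral_const_mul, integral_finsetSum _ fun k _ => ik _, ← mul_neg,
      ← Finset.sum_neg_distrib]
    congr 1
    refine Finset.sum_congr rfl fun k _ => ?_
    rw [integral_heat_dzF_mul_heat_dzF hu huc hv hvc (by positivity)]
    congr 3
    ext1 x
    rw [mul_left_comm]
  have isum : Integrable (fun x => (δ : ℂ) *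
      ∑ k ∈ Finset.range N, heat (k * (2 * δ)) (dzF (dzF u)) x * v x) :=
    (integrable_finsetSum _ fun k _ => ik _).const_mul _
  have isum' : Integrable (fun x => -((δ : ℂ) *
      ∑ k ∈ Finset.range N, heat (k * (2 * δ)) (dzF (dzF u)) x * v x)) := isum.neg
  rw [e, ← integral_neg, ← integral_sub isum' iS]
  refine (norm_integral_le_of_norm_le (g := fun x => N * √(2 * δ) ^ 3 * K * ‖v x‖)
    (iv.norm.const_mul _) (ae_of_all _ fun x => ?_)).trans_eq ?_
  · have h := mul_le_mul_of_nonneg_right (hK (2 * δ) (by positivity) hδ1 N x) (norm_nonneg (v x))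
    rw [← norm_mul] at h
    refine le_trans (le_of_eq ?_) (h.trans (le_of_eq (by ring)))
    congr 1
    rw [mul_div_cancel_left₀ δ two_ne_zero, ← Finset.sum_mul]
    ring
  · rw [integral_const_mul, mul_assoc _ K]

end HeatPairing

/-! ### The dual estimate obtained from the Bellman function. -/

section Duality

/-- The functional `D ↦ dz (A ∘ D)`. -/
def dzComp {W : Type*} [NormedAddCommGroup W] [NormedSpace ℝ W] (A : W →L[ℝ] ℂ) :
    (ℂ →L[ℝ] W) →L[ℝ] ℂ :=
  A.comp (ContinuousLinearMap.apply ℝ W 1) -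
    Complex.I • A.comp (ContinuousLinearMap.apply ℝ W Complex.I)

lemma dzComp_apply {W : Type*} [NormedAddCommGroup W] [NormedSpace ℝ W] (A : W →L[ℝ] ℂ)
    (D : ℂ →L[ℝ] W) : dzComp A D = A (D 1) - Complex.I * A (D Complex.I) := rfl

lemma dzComp_heat_fderiv {W : Type*} [NormedAddCommGroup W] [NormedSpace ℝ W] [CompleteSpace W]
    (A : W →L[ℝ] ℂ) {F : ℂ → W} (hF : ContDiff ℝ ∞ F) (hc : HasCompactSupport F) (t : ℝ) (x : ℂ) :
    dzComp A (heat t (fderiv ℝ F) x) = heat t (dzF (fun y => A (F y))) x := by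
  have cF' : Continuous (fderiv ℝ F) := hF.continuous_fderiv (by simp)
  obtain ⟨K, hK⟩ := (hc.fderiv (𝕜 := ℝ)).exists_bound_of_continuous cF'
  have e : ∀ y, dzComp A (fderiv ℝ F y) = dzF (fun y => A (F y)) y := fun y => by
    have h : HasFDerivAt (fun y => A (F y)) (A.comp (fderiv ℝ F y)) y :=
      A.hasFDerivAt.comp y (hF.differentiable (by simp) y).hasFDerivAt
    rw [dzF, h.fderiv, dzComp_apply, dz]
    rfl
  rw [heat, ← ContinuousLinearMap.integral_comp_comm]
  · simp only [e]
    rfl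
  · exact integrable_heatMeasure_of_bounded (by fun_prop) (fun _ => hK _) t

/-- The two components of `WithLp 2 (ℂ × ℂ)`. -/
def l2Equiv : WithLp 2 (ℂ × ℂ) ≃L[ℝ] ℂ × ℂ := WithLp.prodContinuousLinearEquiv 2 ℝ ℂ ℂ

/-- First projection. -/
def l2Fst : WithLp 2 (ℂ × ℂ) →L[ℝ] ℂ :=
  (ContinuousLinearMap.fst ℝ ℂ ℂ).comp l2Equiv.toContinuousLinearMap

/-- Second projection. -/
def l2Snd : WithLp 2 (ℂ × ℂ) →L[ℝ] ℂ :=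
  (ContinuousLinearMap.snd ℝ ℂ ℂ).comp l2Equiv.toContinuousLinearMap

/-- A pair of functions as a function to the Euclidean plane over `ℂ`. -/
def l2Pair (g₁ g₂ : ℂ → ℂ) (x : ℂ) : WithLp 2 (ℂ × ℂ) := l2Equiv.symm (g₁ x, g₂ x)

lemma norm_l2Pair (g₁ g₂ : ℂ → ℂ) (x : ℂ) :
    ‖l2Pair g₁ g₂ x‖ = √(‖g₁ x‖ ^ 2 + ‖g₂ x‖ ^ 2) := WithLp.prod_norm_eq_of_L2 _

lemma contDiff_l2Pair {g₁ g₂ : ℂ → ℂ} (h₁ : ContDiff ℝ ∞ g₁) (h₂ : ContDiff ℝ ∞ g₂) :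
    ContDiff ℝ ∞ (l2Pair g₁ g₂) := l2Equiv.symm.contDiff.comp (h₁.prodMk h₂)

lemma hasCompactSupport_l2Pair {g₁ g₂ : ℂ → ℂ} (h₁ : HasCompactSupport g₁)
    (h₂ : HasCompactSupport g₂) : HasCompactSupport (l2Pair g₁ g₂) := by
  refine HasCompactSupport.intro (h₁.isCompact.union h₂.isCompact) fun x hx => ?_
  rw [Set.mem_union, not_or] at hx
  rw [l2Pair, image_eq_zero_of_notMem_tsupport hx.1, image_eq_zero_of_notMem_tsupport hx.2]
  exact map_zero l2Equiv.symm

lemma holoPairing_heat {f g₁ g₂ : ℂ → ℂ} (hf : ContDiff ℝ ∞ f) (hfc : HasCompactSupport f)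
    (h₁ : ContDiff ℝ ∞ g₁) (hc₁ : HasCompactSupport g₁) (h₂ : ContDiff ℝ ∞ g₂)
    (hc₂ : HasCompactSupport g₂) (t : ℝ) (x : ℂ) :
    holoPairing (heat t (fderiv ℝ f) x) (heat t (fderiv ℝ (l2Pair g₁ g₂)) x) =
      (heat t (dzF f) x * heat t (dzF g₁) x +
        heat t (dzF fun y => conj (f y)) x * heat t (dzF g₂) x).re := by
  have hG := contDiff_l2Pair h₁ h₂
  have hGc := hasCompactSupport_l2Pair hc₁ hc₂
  have e1 := dzComp_heat_fderiv (ContinuousLinearMap.id ℝ ℂ) hf hfc t x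
  have e2 := dzComp_heat_fderiv Complex.conjCLE.toContinuousLinearMap hf hfc t x
  have e3 := dzComp_heat_fderiv l2Fst hG hGc t x
  have e4 := dzComp_heat_fderiv l2Snd hG hGc t x
  have e1' : heat t (dzF f) x = _ := e1.symm
  have e2' : heat t (dzF fun y => conj (f y)) x = _ := e2.symm
  have e3' : heat t (dzF g₁) x = _ := e3.symm
  have e4' : heat t (dzF g₂) x = _ := e4.symm
  rw [e1', e2', e3', e4']
  rfl

lemma tendsto_nat_mul_sqrt_pow {c : ℝ} (hc : 0 ≤ c) :
    Tendsto (fun N : ℕ => (N : ℝ) * √(c / N) ^ 3) atTop (𝓝 0) := by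
  have h : Tendsto (fun N : ℕ => √c ^ 3 * (√(N : ℝ))⁻¹) atTop (𝓝 (√c ^ 3 * 0)) :=
    (tendsto_inv_atTop_zero.comp (Real.tendsto_sqrt_atTop.comp
      tendsto_natCast_atTop_atTop)).const_mul _
  rw [mul_zero] at h
  refine h.congr' ?_
  filter_upwards [eventually_gt_atTop 0] with N hN
  have hN' : (0 : ℝ) < N := by exact_mod_cast hN
  have hs : 0 < √(N : ℝ) := Real.sqrt_pos.2 hN'
  rw [Real.sqrt_div hc]
  nth_rewrite 2 [← Real.sq_sqrt hN'.le]
  field_simp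

variable {φ : ℂ × WithLp 2 (ℂ × ℂ) → ℝ}

/-- The gain of the Bellman integral over `N` steps bounds the summed pairing, which approximates
the left-hand integrals. Both errors are of the form `N √(c / N) ^ 3` and vanish as `N` tends to
infinity. -/
lemma IsBellman.integral_sub_heat_le (hφ : IsBellman φ) (hd : LinearDecay φ) (h0 : ∀ v, φ v ≤ 0)
    {f g₁ g₂ : ℂ → ℂ} (hf : ContDiff ℝ ∞ f) (hfc : HasCompactSupport f)
    (h₁ : ContDiff ℝ ∞ g₁) (hc₁ : HasCompactSupport g₁) (h₂ : ContDiff ℝ ∞ g₂)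
    (hc₂ : HasCompactSupport g₂) {S₁ S₂ : ℂ → ℂ} (hS₁ : S₁ = cauchyTransform (dzF f))
    (hS₂ : S₂ = cauchyTransform (dzF fun y => conj (f y))) {T : ℝ} (hT : 0 ≤ T) :
    ((∫ x, (S₁ x - heat T S₁ x) * g₁ x) + ∫ x, (S₂ x - heat T S₂ x) * g₂ x).re / 2 ≤
      -∫ x, φ (f x, l2Pair g₁ g₂ x) := by
  have hG := contDiff_l2Pair h₁ h₂
  have hGc := hasCompactSupport_l2Pair hc₁ hc₂
  have hf' : ContDiff ℝ ∞ (fun y => conj (f y)) := Complex.conjCLE.contDiff.comp hf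
  have hfc' : HasCompactSupport (fun y => conj (f y)) :=
    hfc.comp_left (g := fun z : ℂ => conj z) (map_zero _)
  obtain ⟨K₁, t₁⟩ := exists_tame hf hfc
  obtain ⟨K₂, t₂⟩ := exists_tame hG hGc
  have tF := t₁.mono (le_max_left K₁ K₂)
  have tG := t₂.mono (le_max_right K₁ K₂)
  set K := max K₁ K₂ with hK
  obtain ⟨M₁, -, hM₁⟩ := exists_heat_pairing_telescope hf hfc h₁ hc₁
  obtain ⟨M₂, -, hM₂⟩ := exists_heat_pairing_telescope hf' hfc' h₂ hc₂
  rw [← hS₁] at hM₁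
  rw [← hS₂] at hM₂
  set L := (∫ x, (S₁ x - heat T S₁ x) * g₁ x) + ∫ x, (S₂ x - heat T S₂ x) * g₂ x with hL
  set C := 6 * (K * heatConst (T / 2)) ^ 2 * momentConst * ∫ y, decay y with hC
  have i1 := fun t => integrable_heat_mul_heat (contDiff_dzF hf).continuous
    (hasCompactSupport_dzF hfc) (contDiff_dzF h₁).continuous (hasCompactSupport_dzF hc₁) t
  have i2 := fun t => integrable_heat_mul_heat (contDiff_dzF hf').continuous
    (hasCompactSupport_dzF hfc') (contDiff_dzF h₂).continuous (hasCompactSupport_dzF hc₂) t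
  have i12 : ∀ t, Integrable fun x => heat t (dzF f) x * heat t (dzF g₁) x +
    heat t (dzF fun y => conj (f y)) x * heat t (dzF g₂) x := fun t => (i1 t).add (i2 t)
  have key : ∀ᶠ N : ℕ in atTop, L.re / 2 ≤ -(∫ x, φ (f x, l2Pair g₁ g₂ x)) +
      (N * √(T / 2 / N) ^ 3 * C + (N * √(T / N) ^ 3 * (M₁ + M₂)) / 2) := by
    have hev : ∀ᶠ N : ℕ in atTop, max 1 T ≤ N :=
      tendsto_natCast_atTop_atTop.eventually_ge_atTop _
    filter_upwards [hev] with N hN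
    have hN1 : (1 : ℝ) ≤ N := (le_max_left _ _).trans hN
    have hNT : T ≤ N := (le_max_right _ _).trans hN
    have hN0 : (0 : ℝ) < N := by linarith
    -- The Bellman flow runs only up to `T / 2`, since the product of two heat factors at time `t`
    -- corresponds to time `2 t`.
    set δ := T / 2 / N with hδ
    have e2δ : 2 * δ = T / N := by rw [hδ]; ring
    have hδ0 : 0 ≤ δ := by positivity
    have h2δ : 2 * δ ≤ 1 := by rw [e2δ, div_le_one hN0]; exact hNT
    have hNδ : N * δ = T / 2 := by rw [hδ]; field_simp
    have hN2δ : N * (2 * δ) = T := by rw [e2δ]; field_simp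
    have b := hφ.telescope hd tF tG
      (β := fun t x => (heat t (dzF f) x * heat t (dzF g₁) x +
        heat t (dzF fun y => conj (f y)) x * heat t (dzF g₂) x).re)
      (fun t _ => (i12 t).re) (fun t x => by
        rw [← holoPairing_heat hf hfc h₁ hc₁ h₂ hc₂]
        exact holoPairing_le _ _) hδ0 (by linarith) N hNδ.le
    have hneg : ∫ y, φ (heat (N * δ) f y, heat (N * δ) (l2Pair g₁ g₂) y) ≤ 0 :=
      integral_nonpos fun y => h0 _
    have a1 := hM₁ δ hδ0 h2δ N
    have a2 := hM₂ δ hδ0 h2δ N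
    rw [hN2δ, e2δ] at a1 a2
    have er : ∀ t, ∫ x, (heat t (dzF f) x * heat t (dzF g₁) x +
        heat t (dzF fun y => conj (f y)) x * heat t (dzF g₂) x).re =
        ((∫ x, heat t (dzF f) x * heat t (dzF g₁) x) +
          ∫ x, heat t (dzF fun y => conj (f y)) x * heat t (dzF g₂) x).re := fun t => by
      rw [← integral_add (i1 t) (i2 t)]
      exact integral_re (i12 t)
    simp only [er] at b
    rw [← Complex.re_sum, Finset.sum_add_distrib] at b
    set P₁ := ∑ k ∈ Finset.range N, ∫ x, heat (k * δ) (dzF f) x * heat (k * δ) (dzF g₁) x with hP₁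
    set P₂ := ∑ k ∈ Finset.range N, ∫ x, heat (k * δ) (dzF fun y => conj (f y)) x *
      heat (k * δ) (dzF g₂) x with hP₂
    have a := norm_add_le_of_le a1 a2
    have a' := (abs_le.1 ((Complex.abs_re_le_norm _).trans a)).1
    have ea : ((δ : ℂ) * P₁ - (∫ x, (S₁ x - heat T S₁ x) * g₁ x) +
        ((δ : ℂ) * P₂ - ∫ x, (S₂ x - heat T S₂ x) * g₂ x)).re =
        δ * (P₁ + P₂).re - L.re := by
      rw [hL, ← Complex.re_ofReal_mul, ← Complex.sub_re]
      congr 1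
      ring
    rw [ea] at a'
    linarith
  have hlim : Tendsto (fun N : ℕ => -(∫ x, φ (f x, l2Pair g₁ g₂ x)) +
      (N * √(T / 2 / N) ^ 3 * C + (N * √(T / N) ^ 3 * (M₁ + M₂)) / 2)) atTop
      (𝓝 (-(∫ x, φ (f x, l2Pair g₁ g₂ x)) + (0 * C + (0 * (M₁ + M₂)) / 2))) :=
    (((tendsto_nat_mul_sqrt_pow (by positivity)).mul_const C).add
      (((tendsto_nat_mul_sqrt_pow hT).mul_const _).div_const 2)).const_add _
  rw [zero_mul, zero_mul, zero_div, add_zero, add_zero] at hlim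
  exact ge_of_tendsto hlim key

lemma tendsto_integral_sub_heat_mul {S g : ℂ → ℂ} (hS : Continuous S) {K : ℝ}
    (hK : ∀ x, ‖S x‖ ≤ K) (h0 : Tendsto S (cocompact ℂ) (𝓝 0)) (hg : Integrable g) :
    Tendsto (fun T => ∫ x, (S x - heat T S x) * g x) atTop (𝓝 (∫ x, S x * g x)) := by
  refine tendsto_integral_filter_of_dominated_convergence (fun x => (K + K) * ‖g x‖)
    (Eventually.of_forall fun T =>
      (hS.sub (continuous_heat hS hK T)).aestronglyMeasurable.mul hg.aestronglyMeasurable)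
    (Eventually.of_forall fun T => ae_of_all _ fun x => ?_) (hg.norm.const_mul _)
    (ae_of_all _ fun x => ?_)
  · rw [norm_mul]
    exact mul_le_mul_of_nonneg_right (norm_sub_le_of_le (hK x) (norm_heat_le hK T x))
      (norm_nonneg _)
  · have := ((tendsto_heat_atTop hS hK h0 x).const_sub (S x)).mul_const (g x)
    rwa [sub_zero] at this

lemma IsBellman.integral_cauchyTransform_le (hφ : IsBellman φ) (hd : LinearDecay φ)
    (h0 : ∀ v, φ v ≤ 0) {f g₁ g₂ : ℂ → ℂ} (hf : ContDiff ℝ ∞ f) (hfc : HasCompactSupport f)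
    (h₁ : ContDiff ℝ ∞ g₁) (hc₁ : HasCompactSupport g₁) (h₂ : ContDiff ℝ ∞ g₂)
    (hc₂ : HasCompactSupport g₂) :
    ((∫ x, cauchyTransform (dzF f) x * g₁ x) +
      ∫ x, cauchyTransform (dzF fun y => conj (f y)) x * g₂ x).re / 2 ≤
      -∫ x, φ (f x, l2Pair g₁ g₂ x) := by
  have hf' : ContDiff ℝ ∞ (fun y => conj (f y)) := Complex.conjCLE.contDiff.comp hf
  have hfc' : HasCompactSupport (fun y => conj (f y)) :=
    hfc.comp_left (g := fun z : ℂ => conj z) (map_zero _)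
  have main : ∀ {u g : ℂ → ℂ}, ContDiff ℝ ∞ u → HasCompactSupport u → ContDiff ℝ ∞ g →
      HasCompactSupport g → Tendsto (fun T => ∫ x, (cauchyTransform (dzF u) x -
        heat T (cauchyTransform (dzF u)) x) * g x) atTop
        (𝓝 (∫ x, cauchyTransform (dzF u) x * g x)) := fun {u g} hu huc hg hgc => by
    obtain ⟨M, -, hM⟩ := exists_decay_bound (contDiff_dzF hu).continuous (hasCompactSupport_dzF huc)
    exact tendsto_integral_sub_heat_mul
      (contDiff_cauchyTransform (contDiff_dzF hu) (hasCompactSupport_dzF huc)).continuous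
      (norm_cauchyTransform_le hM)
      (tendsto_cauchyTransform_cocompact (contDiff_dzF hu).continuous (hasCompactSupport_dzF huc))
      (hg.continuous.integrable_of_hasCompactSupport hgc)
  have h := (main hf hfc h₁ hc₁).add (main hf' hfc' h₂ hc₂)
  have h' := ((Complex.continuous_re.tendsto _).comp h).div_const 2
  refine le_of_tendsto h' ?_
  filter_upwards [eventually_ge_atTop 0] with T hT
  exact hφ.integral_sub_heat_le hd h0 hf hfc h₁ hc₁ h₂ hc₂ rfl rfl hT

end Duality

/-! ### The concrete Bellman function satisfies the abstract hypotheses. -/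

section BellmanProperties

variable {H₂ : Type*} [NormedAddCommGroup H₂] [InnerProductSpace ℝ H₂]

lemma isBellman_bellman {H₁ : Type*} [NormedAddCommGroup H₁] [InnerProductSpace ℝ H₁] {p : ℝ}
    (hp1 : 1 < p) (hp2 : p ≤ 2) :
    IsBellman (fun v : H₁ × H₂ => bellman p v.1 v.2) :=
  ⟨concaveOn_bellman hp1 hp2, fun v w => bellman_two_point hp1 hp2 v.1 w.1 v.2 w.2⟩

lemma mul_rpow_le_mul {K d p : ℝ} (hK : 0 ≤ K) (hd : 0 ≤ d) (hd1 : d ≤ 1) (hp : 1 ≤ p) :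
    (K * d) ^ p ≤ K ^ p * d := by
  rw [Real.mul_rpow hK hd]
  exact mul_le_mul_of_nonneg_left
    ((Real.rpow_le_rpow_of_exponent_ge' hd hd1 zero_le_one hp).trans_eq (Real.rpow_one d))
    (Real.rpow_nonneg hK p)

lemma linearDecay_bellman {H₁ : Type*} [NormedAddCommGroup H₁] {p : ℝ} (hp1 : 1 < p) (hp2 : p ≤ 2) :
    LinearDecay (fun v : H₁ × H₂ => bellman p v.1 v.2) := by
  intro K hK
  have hp : 0 < p - 1 := by linarith
  have hp0 : 0 < p := by linarith
  refine ⟨(K / (p - 1)) ^ p + (p - 1) * (K / p) ^ (p / (p - 1)), fun v d hd hd1 h1 h2 => ?_⟩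
  have hq : 1 ≤ p / (p - 1) := by rw [le_div_iff₀ hp]; linarith
  simp only
  rw [abs_of_nonpos (bellman_nonpos hp1 hp2 _ _)]
  have := le_bellman hp1 hp2 v.1 v.2
  have a1 : (‖v.1‖ / (p - 1)) ^ p ≤ (K / (p - 1)) ^ p * d := by
    refine (Real.rpow_le_rpow (by positivity) ?_ hp0.le).trans
      (mul_rpow_le_mul (by positivity) hd hd1 hp1.le)
    rw [div_mul_eq_mul_div]
    gcongr
  have a2 : (‖v.2‖ / p) ^ (p / (p - 1)) ≤ (K / p) ^ (p / (p - 1)) * d := by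
    refine (Real.rpow_le_rpow (by positivity) ?_ (by positivity)).trans
      (mul_rpow_le_mul (by positivity) hd hd1 hq)
    rw [div_mul_eq_mul_div]
    gcongr
  have a3 := mul_le_mul_of_nonneg_left a2 hp.le
  linarith

end BellmanProperties

/-! ### Extremal test functions and removal of the cutoff. -/

section DualFunction

lemma rpow_add_sub_rpow_le {p a ε : ℝ} (hp2 : p ≤ 2) (ha : 0 ≤ a) (hε : 0 < ε) :
    (a + ε) ^ (p / 2) - ε ^ (p / 2) ≤ (a + ε) ^ ((p - 2) / 2) * a := by
  have e : ∀ s : ℝ, 0 < s → s ^ (p / 2) = s ^ ((p - 2) / 2) * s := fun s hs => by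
    conv_rhs => rw [← Real.rpow_one s, ← Real.rpow_mul hs.le, one_mul, ← Real.rpow_add hs]
    congr 1; ring
  have h := Real.rpow_le_rpow_of_nonpos hε (show ε ≤ a + ε by linarith)
    (show (p - 2) / 2 ≤ 0 by linarith)
  rw [e ε hε, e (a + ε) (by linarith)]
  nlinarith

lemma dual_rpow_le {p a ε c : ℝ} (hp1 : 1 < p) (ha : 0 ≤ a) (hε : 0 < ε) (hc0 : 0 ≤ c)
    (hc1 : c ≤ 1) : (c * (a + ε) ^ ((p - 2) / 2) * √a) ^ (p / (p - 1)) ≤ c * (a + ε) ^ (p / 2) := by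
  have hp : 0 < p - 1 := by linarith
  have hs : 0 < a + ε := by linarith
  have hq : 1 ≤ p / (p - 1) := by rw [le_div_iff₀ hp]; linarith
  have h1 : c * (a + ε) ^ ((p - 2) / 2) * √a ≤ (a + ε) ^ ((p - 1) / 2) * c := by
    have h2 : √a ≤ (a + ε) ^ (1 / 2 : ℝ) := by
      rw [Real.sqrt_eq_rpow]
      exact Real.rpow_le_rpow ha (by linarith) (by norm_num)
    calc c * (a + ε) ^ ((p - 2) / 2) * √a
        ≤ c * (a + ε) ^ ((p - 2) / 2) * (a + ε) ^ (1 / 2 : ℝ) := by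
          gcongr
      _ = (a + ε) ^ ((p - 1) / 2) * c := by
          rw [mul_assoc, ← Real.rpow_add hs, mul_comm]
          congr 2; ring
  refine (Real.rpow_le_rpow (by positivity) h1 (by linarith)).trans
    ((mul_rpow_le_mul (by positivity) hc0 hc1 hq).trans_eq ?_)
  rw [← Real.rpow_mul hs.le, mul_comm]
  congr 2
  field_simp

/-- With `A = |S|² / 4`, the extremal test pair is `(p / 2) A^{(p-2)/2} conj S`, which yields `p ∫
A^{p/2} - (p - 1) ∫ A^{p/2}`. The cutoff `c` gives it compact support, and `ε` removes the
singularity at zeros of `A`. -/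
lemma integral_cutoff_mul_rpow_le {p M : ℝ} (hp1 : 1 < p) (hp2 : p ≤ 2) {S₁ S₂ : ℂ → ℂ}
    (h₁ : ContDiff ℝ ∞ S₁) (h₂ : ContDiff ℝ ∞ S₂)
    (H : ∀ g₁ g₂ : ℂ → ℂ, ContDiff ℝ ∞ g₁ → HasCompactSupport g₁ → ContDiff ℝ ∞ g₂ →
      HasCompactSupport g₂ → ((∫ x, S₁ x * g₁ x) + ∫ x, S₂ x * g₂ x).re / 2 ≤
        M + (p - 1) * ∫ x, (√(‖g₁ x‖ ^ 2 + ‖g₂ x‖ ^ 2) / p) ^ (p / (p - 1)))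
    {c : ℂ → ℝ} (hc : ContDiff ℝ ∞ c) (hcc : HasCompactSupport c) (hc0 : ∀ x, 0 ≤ c x)
    (hc1 : ∀ x, c x ≤ 1) :
    ∫ x, c x * ((‖S₁ x‖ ^ 2 + ‖S₂ x‖ ^ 2) / 4) ^ (p / 2) ≤ M := by
  have hp0 : 0 < p := by linarith
  have hpm : 0 < p - 1 := by linarith
  set A : ℂ → ℝ := fun x => (‖S₁ x‖ ^ 2 + ‖S₂ x‖ ^ 2) / 4 with hA
  have hA0 : ∀ x, 0 ≤ A x := fun x => by simp only [hA]; positivity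
  have hAs : ContDiff ℝ ∞ A := ((h₁.norm_sq ℝ).add (h₂.norm_sq ℝ)).div_const 4
  have cA := hAs.continuous
  have cc := hc.continuous
  have icc : Integrable c := cc.integrable_of_hasCompactSupport hcc
  have ii : ∀ {u : ℂ → ℝ}, Continuous u → Integrable (fun x => c x * u x) := fun hu =>
    (cc.mul hu).integrable_of_hasCompactSupport hcc.mul_right
  have key : ∀ ε : ℝ, 0 < ε → ∫ x, c x * A x ^ (p / 2) ≤ M + p * ε ^ (p / 2) * ∫ x, c x := by
    intro ε hε
    have hAε : ∀ x, A x + ε ≠ 0 := fun x => by have := hA0 x; positivity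
    set r : ℂ → ℝ := fun x => (A x + ε) ^ ((p - 2) / 2) with hr
    have hr0 : ∀ x, 0 ≤ r x := fun x => Real.rpow_nonneg (by linarith [hA0 x]) _
    have hrs : ContDiff ℝ ∞ r := (hAs.add contDiff_const).rpow_const_of_ne hAε
    -- The factor `p / 2` makes the normalised length of the test pair equal to `c r √A`. The cutoff
    -- loses nothing: `c ≤ 1` and the conjugate exponent is at least one, so its power is at most
    -- `c`.
    set m : ℂ → ℝ := fun x => c x * (p * r x / 2) with hm
    have hms : ContDiff ℝ ∞ m := hc.mul ((contDiff_const.mul hrs).div_const 2)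
    have hmc : HasCompactSupport m := hcc.mul_right
    have hm0 : ∀ x, 0 ≤ m x := fun x => mul_nonneg (hc0 x) (by have := hr0 x; positivity)
    have gs : ∀ {S : ℂ → ℂ}, ContDiff ℝ ∞ S → ContDiff ℝ ∞ (fun x => (m x : ℂ) * conj (S x)) :=
      fun hS => (Complex.ofRealCLM.contDiff.comp hms).mul (Complex.conjCLE.contDiff.comp hS)
    have gc : ∀ {S : ℂ → ℂ}, HasCompactSupport (fun x => (m x : ℂ) * conj (S x)) := fun {S} =>
      HasCompactSupport.mul_right (hmc.comp_left (g := fun t : ℝ => (t : ℂ)) Complex.ofReal_zero)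
    have h := H _ _ (gs h₁) gc (gs h₂) gc
    have i1 : ∀ {S : ℂ → ℂ}, ContDiff ℝ ∞ S →
        Integrable (fun x => S x * ((m x : ℂ) * conj (S x))) :=
      fun hS => (hS.continuous.mul (gs hS).continuous).integrable_of_hasCompactSupport gc.mul_left
    have e1 : ((∫ x, S₁ x * ((m x : ℂ) * conj (S₁ x))) +
        ∫ x, S₂ x * ((m x : ℂ) * conj (S₂ x))).re / 2 = p * ∫ x, c x * (r x * A x) := by
      rw [← integral_add (i1 h₁) (i1 h₂), ← integral_const_mul]
      have : ∀ x, S₁ x * ((m x : ℂ) * conj (S₁ x)) + S₂ x * ((m x : ℂ) * conj (S₂ x)) =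
          ((2 * (p * (c x * (r x * A x))) : ℝ) : ℂ) := fun x => by
        have n1 := Complex.mul_conj (S₁ x)
        have n2 := Complex.mul_conj (S₂ x)
        rw [Complex.normSq_eq_norm_sq] at n1 n2
        simp only [hm, hA]
        push_cast at n1 n2 ⊢
        linear_combination (c x * (p * r x / 2) : ℂ) * (n1 + n2)
      simp only [this]
      rw [integral_complex_ofReal, Complex.ofReal_re, integral_const_mul]
      ring
    have e2 : ∀ x, √(‖(m x : ℂ) * conj (S₁ x)‖ ^ 2 + ‖(m x : ℂ) * conj (S₂ x)‖ ^ 2) / p =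
        c x * r x * √(A x) := fun x => by
      have : ‖(m x : ℂ) * conj (S₁ x)‖ ^ 2 + ‖(m x : ℂ) * conj (S₂ x)‖ ^ 2 =
          (2 * m x) ^ 2 * A x := by
        rw [norm_mul, norm_mul, Complex.norm_real, RCLike.norm_conj, RCLike.norm_conj,
          Real.norm_of_nonneg (hm0 x)]
        simp only [hA]
        ring
      rw [this, Real.sqrt_mul (sq_nonneg _), Real.sqrt_sq (by linarith [hm0 x])]
      simp only [hm]
      field_simp
    simp only [e2] at h
    rw [e1] at h
    have cr : Continuous fun x => (A x + ε) ^ (p / 2) :=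
      (cA.add continuous_const).rpow_const fun x => Or.inl (hAε x)
    have m1 : ∫ x, (c x * r x * √(A x)) ^ (p / (p - 1)) ≤ ∫ x, c x * (A x + ε) ^ (p / 2) :=
      integral_mono_of_nonneg (ae_of_all _ fun x => Real.rpow_nonneg
        (mul_nonneg (mul_nonneg (hc0 x) (hr0 x)) (Real.sqrt_nonneg _)) _) (ii cr)
        (ae_of_all _ fun x => dual_rpow_le hp1 (hA0 x) hε (hc0 x) (hc1 x))
    have m2 : (∫ x, c x * (A x + ε) ^ (p / 2)) - ε ^ (p / 2) * (∫ x, c x) ≤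
        ∫ x, c x * (r x * A x) := by
      rw [← integral_const_mul, ← integral_sub (ii cr) (icc.const_mul _)]
      refine integral_mono ((ii cr).sub (icc.const_mul _))
        (ii (hrs.continuous.mul cA)) fun x => ?_
      have := mul_le_mul_of_nonneg_left (rpow_add_sub_rpow_le hp2 (hA0 x) hε) (hc0 x)
      simp only [hr]
      linarith
    have m3 : ∫ x, c x * A x ^ (p / 2) ≤ ∫ x, c x * (A x + ε) ^ (p / 2) := by
      refine integral_mono (ii (cA.rpow_const fun x => Or.inr (by positivity))) (ii cr) fun x => ?_
      exact mul_le_mul_of_nonneg_left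
        (Real.rpow_le_rpow (hA0 x) (by linarith) (by positivity)) (hc0 x)
    have m1' := mul_le_mul_of_nonneg_left m1 hpm.le
    have m2' := mul_le_mul_of_nonneg_left m2 hp0.le
    linarith
  have hlim : Tendsto (fun ε : ℝ => M + p * ε ^ (p / 2) * ∫ x, c x) (𝓝[>] 0)
      (𝓝 (M + p * 0 ^ (p / 2) * ∫ x, c x)) := by
    have h1 : ContinuousAt (fun ε : ℝ => ε ^ (p / 2)) 0 :=
      Real.continuousAt_rpow_const _ _ (Or.inr (by positivity))
    exact (((h1.tendsto.mono_left nhdsWithin_le_nhds).const_mul p).mul_const _).const_add M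
  rw [Real.zero_rpow (by positivity), mul_zero, zero_mul, add_zero] at hlim
  exact ge_of_tendsto hlim (Filter.eventually_of_mem self_mem_nhdsWithin fun ε hε => key ε hε)

/-- Bump functions equal to one on growing balls exhaust the plane. The conclusion is a Lebesgue
integral in `ENNReal`, so integrability of `u` is obtained rather than assumed. -/
lemma lintegral_le_of_integral_cutoff_le {u : ℂ → ℝ} (hu : Continuous u) (hu0 : ∀ x, 0 ≤ u x)
    {M : ℝ} (H : ∀ c : ℂ → ℝ, ContDiff ℝ ∞ c → HasCompactSupport c → (∀ x, 0 ≤ c x) →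
      (∀ x, c x ≤ 1) → ∫ x, c x * u x ≤ M) :
    ∫⁻ x, ENNReal.ofReal (u x) ≤ ENNReal.ofReal M := by
  have hcov : AECover (volume : Measure ℂ) atTop (fun n : ℕ => Metric.closedBall (0 : ℂ) n) :=
    aecover_closedBall tendsto_natCast_atTop_atTop
  have hl := hcov.lintegral_tendsto_of_countably_generated
    (f := fun x => ENNReal.ofReal (u x)) (by fun_prop)
  refine le_of_tendsto hl (eventually_atTop.2 ⟨1, fun n hn => ?_⟩)
  have hn0 : (0 : ℝ) < n := by exact_mod_cast hn
  let b : ContDiffBump (0 : ℂ) := ⟨n, n + 1, hn0, by linarith⟩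
  have hint : Integrable (fun x => b x * u x) :=
    (b.continuous.mul hu).integrable_of_hasCompactSupport b.hasCompactSupport.mul_right
  calc ∫⁻ x in Metric.closedBall (0 : ℂ) n, ENNReal.ofReal (u x)
      = ∫⁻ x in Metric.closedBall (0 : ℂ) n, ENNReal.ofReal (b x * u x) := by
        refine setLIntegral_congr_fun Metric.isClosed_closedBall.measurableSet fun x hx => ?_
        rw [b.one_of_mem_closedBall hx, one_mul]
    _ ≤ ∫⁻ x, ENNReal.ofReal (b x * u x) := setLIntegral_le_lintegral _ _
    _ = ENNReal.ofReal (∫ x, b x * u x) :=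
        (ofReal_integral_eq_lintegral_ofReal hint
          (ae_of_all _ fun x => mul_nonneg b.nonneg (hu0 x))).symm
    _ ≤ ENNReal.ofReal M :=
        ENNReal.ofReal_le_ofReal (H b b.contDiff b.hasCompactSupport (fun _ => b.nonneg)
          fun _ => b.le_one)

end DualFunction

/-! ### From the dual estimate to the norms. -/

section Conclusion

lemma integral_cauchyTransform_pair_le {p : ℝ} (hp1 : 1 < p) (hp2 : p ≤ 2) {f g₁ g₂ : ℂ → ℂ}
    (hf : ContDiff ℝ ∞ f) (hfc : HasCompactSupport f) (h₁ : ContDiff ℝ ∞ g₁)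
    (hc₁ : HasCompactSupport g₁) (h₂ : ContDiff ℝ ∞ g₂) (hc₂ : HasCompactSupport g₂) :
    ((∫ x, cauchyTransform (dzF f) x * g₁ x) +
      ∫ x, cauchyTransform (dzF fun y => conj (f y)) x * g₂ x).re / 2 ≤
      (∫ x, (‖f x‖ / (p - 1)) ^ p) +
        (p - 1) * ∫ x, (√(‖g₁ x‖ ^ 2 + ‖g₂ x‖ ^ 2) / p) ^ (p / (p - 1)) := by
  have hp0 : 0 < p := by linarith
  have hpm : 0 < p - 1 := by linarith
  have hφ := isBellman_bellman (H₁ := ℂ) (H₂ := WithLp 2 (ℂ × ℂ)) hp1 hp2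
  have hd := linearDecay_bellman (H₁ := ℂ) (H₂ := WithLp 2 (ℂ × ℂ)) hp1 hp2
  refine (hφ.integral_cauchyTransform_le hd (fun v => bellman_nonpos hp1 hp2 _ _) hf hfc h₁ hc₁
    h₂ hc₂).trans ?_
  have hG := contDiff_l2Pair h₁ h₂
  have hGc := hasCompactSupport_l2Pair hc₁ hc₂
  obtain ⟨K₁, t₁⟩ := exists_tame hf hfc
  obtain ⟨K₂, t₂⟩ := exists_tame hG hGc
  have i0 := hd.integrable hφ (t₁.mono (le_max_left K₁ K₂)) (t₂.mono (le_max_right K₁ K₂))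
  have i1 : Integrable fun x => (‖f x‖ / (p - 1)) ^ p := by
    refine Continuous.integrable_of_hasCompactSupport
      ((hf.continuous.norm.div_const _).rpow_const fun x => Or.inr hp0.le)
      (hfc.comp_left (g := fun z : ℂ => (‖z‖ / (p - 1)) ^ p) ?_)
    simp [Real.zero_rpow hp0.ne']
  have i2 : Integrable fun x => (‖l2Pair g₁ g₂ x‖ / p) ^ (p / (p - 1)) := by
    refine Continuous.integrable_of_hasCompactSupport
      ((hG.continuous.norm.div_const _).rpow_const fun x => Or.inr (by positivity))
      (hGc.comp_left (g := fun z : WithLp 2 (ℂ × ℂ) => (‖z‖ / p) ^ (p / (p - 1))) ?_)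
    simp [Real.zero_rpow (show p / (p - 1) ≠ 0 by positivity)]
  simp only [← norm_l2Pair]
  rw [← integral_neg, ← integral_const_mul, ← integral_add i1 (i2.const_mul _)]
  refine integral_mono i0.neg (i1.add (i2.const_mul _)) fun x => ?_
  have := le_bellman hp1 hp2 (f x) (l2Pair g₁ g₂ x)
  simp only at this ⊢
  linarith

lemma beurling_eq {f : ℂ → ℂ} (hf : ContDiff ℝ ∞ f) (hc : HasCompactSupport f) :
    beurling f = cauchyTransform (dzF f) :=
  funext fun z => (tendsto_beurlingTrunc hf hc z).limUnder_eq

/-- Concavity of the power `p / 2` at the mean of `a²` and `b²`. Rewriting the half as twice a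
quarter produces the constant `√2` of the theorem. -/
lemma rpow_add_rpow_le {p a b : ℝ} (hp1 : 1 < p) (hp2 : p ≤ 2) (ha : 0 ≤ a) (hb : 0 ≤ b) :
    a ^ p + b ^ p ≤ 2 * √2 ^ p * ((a ^ 2 + b ^ 2) / 4) ^ (p / 2) := by
  have hcv := (Real.concaveOn_rpow (p := p / 2) (by linarith) (by linarith)).2
    (show a ^ 2 ∈ Set.Ici 0 from sq_nonneg a) (show b ^ 2 ∈ Set.Ici 0 from sq_nonneg b)
    (show (0 : ℝ) ≤ 1 / 2 by norm_num) (show (0 : ℝ) ≤ 1 / 2 by norm_num) (by norm_num)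
  simp only [smul_eq_mul] at hcv
  have e : ∀ s : ℝ, 0 ≤ s → (s ^ 2) ^ (p / 2) = s ^ p := fun s hs => by
    rw [← Real.rpow_natCast, ← Real.rpow_mul hs]
    congr 1; push_cast; ring
  rw [e a ha, e b hb] at hcv
  have e2 : √2 ^ p * ((a ^ 2 + b ^ 2) / 4) ^ (p / 2) =
      (1 / 2 * a ^ 2 + 1 / 2 * b ^ 2) ^ (p / 2) := by
    rw [← e √2 (Real.sqrt_nonneg 2), Real.sq_sqrt (by norm_num),
      ← Real.mul_rpow (by norm_num) (by positivity)]
    congr 1; ring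
  rw [mul_assoc, e2]
  linarith

lemma eLpNorm_le_of_lintegral_le {u v : ℂ → ℂ} {p c : ℝ} (hp : 0 < p) (hc : 0 ≤ c)
    (h : ∫⁻ x, ENNReal.ofReal (‖u x‖ ^ p) ≤
      ENNReal.ofReal (c ^ p) * ∫⁻ x, ENNReal.ofReal (‖v x‖ ^ p)) :
    eLpNorm u (ENNReal.ofReal p) volume ≤
      ENNReal.ofReal c * eLpNorm v (ENNReal.ofReal p) volume := by
  have h0 : ENNReal.ofReal p ≠ 0 := by simpa using hp
  have e : ∀ w : ℂ → ℂ, eLpNorm w (ENNReal.ofReal p) volume =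
      (∫⁻ x, ENNReal.ofReal (‖w x‖ ^ p)) ^ (1 / p) := fun w => by
    rw [eLpNorm_eq_lintegral_rpow_enorm_toReal h0 ENNReal.ofReal_ne_top,
      ENNReal.toReal_ofReal hp.le]
    simp only [← ENNReal.ofReal_rpow_of_nonneg (norm_nonneg _) hp.le, ofReal_norm]
  rw [e, e]
  refine (ENNReal.rpow_le_rpow h (by positivity)).trans_eq ?_
  rw [ENNReal.mul_rpow_of_nonneg _ _ (by positivity), ← ENNReal.ofReal_rpow_of_nonneg hc hp.le,
    ← ENNReal.rpow_mul, mul_one_div_cancel hp.ne', ENNReal.rpow_one]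

lemma lintegral_cauchyTransform_add_le {p : ℝ} (hp1 : 1 < p) (hp2 : p ≤ 2) {f : ℂ → ℂ}
    (hf : ContDiff ℝ ∞ f) (hfc : HasCompactSupport f) :
    (∫⁻ x, ENNReal.ofReal (‖cauchyTransform (dzF f) x‖ ^ p)) +
      ∫⁻ x, ENNReal.ofReal (‖cauchyTransform (dzF fun y => conj (f y)) x‖ ^ p) ≤
      2 * (ENNReal.ofReal ((√2 / (p - 1)) ^ p) * ∫⁻ x, ENNReal.ofReal (‖f x‖ ^ p)) := by
  have hp0 : 0 < p := by linarith
  have hpm : 0 < p - 1 := by linarith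
  have hf' : ContDiff ℝ ∞ (fun y => conj (f y)) := Complex.conjCLE.contDiff.comp hf
  have hfc' : HasCompactSupport (fun y => conj (f y)) :=
    hfc.comp_left (g := fun z : ℂ => conj z) (map_zero _)
  have s₁ := contDiff_cauchyTransform (contDiff_dzF hf) (hasCompactSupport_dzF hfc)
  have s₂ := contDiff_cauchyTransform (contDiff_dzF hf') (hasCompactSupport_dzF hfc')
  set S₁ := cauchyTransform (dzF f) with hS₁
  set S₂ := cauchyTransform (dzF fun y => conj (f y)) with hS₂
  have c₁ := s₁.continuous
  have c₂ := s₂.continuous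
  have cA : Continuous fun x => ((‖S₁ x‖ ^ 2 + ‖S₂ x‖ ^ 2) / 4) ^ (p / 2) :=
    Continuous.rpow_const (by fun_prop) fun x => Or.inr (by positivity)
  have hb := lintegral_le_of_integral_cutoff_le cA
    (fun x => Real.rpow_nonneg (by positivity) _) fun c hc hcc hc0 hc1 =>
    integral_cutoff_mul_rpow_le hp1 hp2 s₁ s₂ (fun g₁ g₂ a₁ b₁ a₂ b₂ =>
      integral_cauchyTransform_pair_le hp1 hp2 hf hfc a₁ b₁ a₂ b₂) hc hcc hc0 hc1
  have i1 : Integrable fun x => ‖f x‖ ^ p := by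
    refine Continuous.integrable_of_hasCompactSupport
      (hf.continuous.norm.rpow_const fun x => Or.inr hp0.le)
      (hfc.comp_left (g := fun z : ℂ => ‖z‖ ^ p) ?_)
    simp [Real.zero_rpow hp0.ne']
  have eM : ENNReal.ofReal (∫ x, (‖f x‖ / (p - 1)) ^ p) =
      ENNReal.ofReal ((1 / (p - 1)) ^ p) * ∫⁻ x, ENNReal.ofReal (‖f x‖ ^ p) := by
    have : ∀ x, (‖f x‖ / (p - 1)) ^ p = (1 / (p - 1)) ^ p * ‖f x‖ ^ p := fun x => by
      rw [← Real.mul_rpow (by positivity) (norm_nonneg _)]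
      congr 1; ring
    simp only [this]
    rw [integral_const_mul, ENNReal.ofReal_mul (by positivity),
      ofReal_integral_eq_lintegral_ofReal i1 (ae_of_all _ fun x => by positivity)]
  rw [eM] at hb
  have m₁ : Measurable fun x => ENNReal.ofReal (‖S₁ x‖ ^ p) := by fun_prop
  rw [← lintegral_add_left m₁]
  calc ∫⁻ x, (ENNReal.ofReal (‖S₁ x‖ ^ p) + ENNReal.ofReal (‖S₂ x‖ ^ p))
      ≤ ∫⁻ x, ENNReal.ofReal (2 * √2 ^ p) *
          ENNReal.ofReal (((‖S₁ x‖ ^ 2 + ‖S₂ x‖ ^ 2) / 4) ^ (p / 2)) := by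
        refine lintegral_mono fun x => ?_
        simp only
        rw [← ENNReal.ofReal_add (by positivity) (by positivity),
          ← ENNReal.ofReal_mul (by positivity)]
        exact ENNReal.ofReal_le_ofReal
          (rpow_add_rpow_le hp1 hp2 (norm_nonneg _) (norm_nonneg _))
    _ = ENNReal.ofReal (2 * √2 ^ p) *
          ∫⁻ x, ENNReal.ofReal (((‖S₁ x‖ ^ 2 + ‖S₂ x‖ ^ 2) / 4) ^ (p / 2)) :=
        lintegral_const_mul _ (by fun_prop)
    _ ≤ ENNReal.ofReal (2 * √2 ^ p) *
          (ENNReal.ofReal ((1 / (p - 1)) ^ p) * ∫⁻ x, ENNReal.ofReal (‖f x‖ ^ p)) := by gcongr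
    _ = _ := by
        rw [← mul_assoc, ← mul_assoc, ← ENNReal.ofReal_mul (by positivity), mul_assoc,
          ← Real.mul_rpow (by positivity) (by positivity), mul_one_div,
          ENNReal.ofReal_mul zero_le_two, ENNReal.ofReal_ofNat]

end Conclusion

end

theorem mainTheorem1 (f : ℂ → ℂ) (hf : ContDiff ℝ ∞ f) (hfc : HasCompactSupport f)
    (p : ℝ) (hp1 : 1 < p) (hp2 : p ≤ 2) :
    (∀ z : ℂ, Tendsto (fun ε : ℝ => beurlingTrunc f ε z) (𝓝[>] 0) (𝓝 (beurling f z))) ∧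
    (∀ z : ℂ, Tendsto (fun ε : ℝ => beurlingTrunc (fun w => conj (f w)) ε z) (𝓝[>] 0)
      (𝓝 (beurling (fun w => conj (f w)) z))) ∧
    (eLpNorm (beurling f) (ENNReal.ofReal p) volume ≤
        ENNReal.ofReal (√2 * (pStar p - 1)) * eLpNorm f (ENNReal.ofReal p) volume ∨
      eLpNorm (beurling (fun w => conj (f w))) (ENNReal.ofReal p) volume ≤
        ENNReal.ofReal (√2 * (pStar p - 1)) * eLpNorm f (ENNReal.ofReal p) volume) := by
  have hpm : 0 < p - 1 := by linarith
  have hf' : ContDiff ℝ ∞ (fun y => conj (f y)) := Complex.conjCLE.contDiff.comp hf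
  have hfc' : HasCompactSupport (fun y => conj (f y)) :=
    hfc.comp_left (g := fun z : ℂ => conj z) (map_zero _)
  rw [beurling_eq hf hfc, beurling_eq hf' hfc']
  refine ⟨tendsto_beurlingTrunc hf hfc, tendsto_beurlingTrunc hf' hfc', ?_⟩
  have hstar : √2 * (pStar p - 1) = √2 / (p - 1) := by
    have : p ≤ p / (p - 1) := by
      rw [le_div_iff₀ hpm]
      nlinarith
    rw [pStar, max_eq_right this]
    field_simp
    ring
  rw [hstar]
  have h := lintegral_cauchyTransform_add_le hp1 hp2 hf hfc
  have cancel : ∀ {a b : ENNReal}, 2 * a ≤ 2 * b → a ≤ b := fun hab =>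
    (ENNReal.mul_le_mul_iff_right two_ne_zero ENNReal.ofNat_ne_top).1 hab
  -- The smaller of the two integrals is at most half of their sum.
  rcases le_total (∫⁻ x, ENNReal.ofReal (‖cauchyTransform (dzF f) x‖ ^ p))
    (∫⁻ x, ENNReal.ofReal (‖cauchyTransform (dzF fun y => conj (f y)) x‖ ^ p)) with hle | hle
  · refine Or.inl (eLpNorm_le_of_lintegral_le (by linarith) (by positivity) (cancel ?_))
    rw [two_mul]
    exact (add_le_add le_rfl hle).trans h
  · refine Or.inr (eLpNorm_le_of_lintegral_le (by linarith) (by positivity) (cancel ?_))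
    rw [two_mul]
    exact (add_le_add hle le_rfl).trans h
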